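/- **Setting.** Let $\mathcal K\subset\mathbb R^d$ be a nonempty compact convex set with $\|x-y\|\le D$ for $x,y\in\mathcal K$, where $D>0$; let $\mathcal D$ be a probability law of samples $z$, and let $f(x)=\mathbb E_{z\sim\mathcal D}f(x;z)$ be convex and differentiable on $\mathcal K$. Gradients are taken on $\mathcal K$. Assume that $\mathbb E\nabla f(x;z)=\nabla f(x)$ and $\mathbb E\|\nabla f(x;z)-\nabla f(x)\|^2\le\sigma^2$ for $x\in\mathcal K$; that $\|\nabla f(x;z)-\nabla f(y;z)\|\le L\|x-y\|$ with $L>0$, for almost every $z$ and all $x,y\in\mathcal K$; and that $\mathbb E\|(\nabla f(x;z)-\nabla f(x))-(\nabla f(y;z)-\nabla f(y))\|^2\le\sigma_L^2\|x-y\|^2$ for $x,y\in\mathcal K$. Let $x^*\in\arg\min_{\mathcal K}f$ and $G^*=\|\nabla f(x^*)\|$. **Aggregation.** A (possibly randomized) rule $\mathcal A$ maps any finite nonempty collection of vectors $x_i\in\mathbb R^d$ with weights $s_i>0$ to a vector. It is $(c_\lambda,\lambda)$-weighted robust, where $c_\lambda\ge0$ and $0\le\lambda<\tfrac12$, if the following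 holds for all random vectors $x_i$, all weights $s_i>0$ and every subset $\mathcal G$ of the indices with $\{x_i\}_{i\in\mathcal G}$ independent and $\sum_{i\in\mathcal G}s_i\ge(1-\lambda)\sum_i s_i$. Put $\bar x_{\mathcal G}=\sum_{i\in\mathcal G}s_ix_i/\sum_{i\in\mathcal G}s_i$. Whenever $\mathbb E\|x_i-\bar x_{\mathcal G}\|^2\le\rho_i^2$ for all $i\in\mathcal G$, $$\mathbb E\|\mathcal A(\{x_i\};\{s_i\})-\bar x_{\mathcal G}\|^2\le c_\lambda\,\frac{\sum_{i\in\mathcal G}s_i\rho_i^2}{\sum_{i\in\mathcal G}s_i},$$ the expectation being over the inputs and the independent internal randomness of $\mathcal A$. **Algorithm (asynchronous robust $\mu^2$-SGD).** There are $m$ workers, those in a fixed set being honest and the others Byzantine. Start from $w_1=x_1\in\mathcal K$; every honest worker $i$ draws a sample $z^{(i)}\sim\mathcal D$ and stores the momentum $d^{(i)}=\nabla f(x_1;z^{(i)})$ and the query point $q^{(i)}=x_1$. At iteration $t=1,2,\dots$ one worker $i$ arrives. It sends $d^{(i)}$ if it is honest, and an arbitrary vector if it is Byzantine; the server stores this as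 the last vector of $i$. Let $s^{(j)}_t$ be the number of arrivals of worker $j$ up to $t$. The server applies $\mathcal A$ to the last vectors of all workers with $s_t^{(j)}>0$, with weights $s_t^{(j)}$, obtaining $\hat d_t$, and sets $$w_{t+1}=\Pi_{\mathcal K}(w_t-\eta\alpha_t\hat d_t),\qquad x_{t+1}=\frac{\sum_{k\le t+1}\alpha_kw_k}{\sum_{k\le t+1}\alpha_k},\qquad \alpha_t=t.$$ If $i$ is honest, it draws a fresh $z_t\sim\mathcal D$ and replaces $d^{(i)}$ by $\nabla f(x_t;z_t)+(1-\beta_t)(d^{(i)}-\nabla f(q^{(i)};z_t))$ with $\beta_t=1/s^{(i)}_t$, and then $q^{(i)}$ by $x_t$. The samples are i.i.d., and the sequence of arriving workers may be random but is independent of the samples. A Byzantine vector may depend arbitrarily on everything that happened before it is sent, on the arrival sequence and on extra randomness, but not on samples or on internal randomness of $\mathcal A$ drawn later. **Delays.** $\tau_t^{(i)}$ is $t$ minus the time of the second last arrival of worker $i$ up to time $t$ (time $0$ if there is none), $\tau_t^{\max}=\max_{i}\tau_t^{(i)}$ and $\mu_{\max}=\frac1T\sum_{t\le T}\tau_t^{\max}$.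 Assume that there is $K>0$ such that, for every worker, any time between two consecutive arrivals among the iterations $1,\dots,T$ is at most $K$ times the smallest such time of that worker, and that for every $t\le T$ at most $\lambda t$ of the first $t$ arrivals are Byzantine. **Theorem.** There is a universal constant $C>0$ such that, for every $T\ge1$ and every $\mathcal A$ that is $(c_\lambda,\lambda)$-weighted robust, the following holds with $\tilde\sigma^2=2\sigma^2+32D^2K^2\sigma_L^2$. For every $0<\eta\le\frac1{4LT}$, the output satisfies $x_T\in\mathcal K$ and, the expectation being conditional on the arrival sequence (which determines $\mu_{\max}$), $$\mathbb E[f(x_T)-f(x^*)]\le C\left(\frac{D^2}{\eta T^2}+\frac{G^*D+LD^2\mu_{\max}\sqrt{1+c_\lambda}}{T}+\frac{D\tilde\sigma\sqrt{1+c_\lambda m}}{\sqrt T}\right).$$ In particular, for the learning rate $\eta=\frac1{4LT}$, $$\mathbb E[f(x_T)-f(x^*)]\le C\left(\frac{G^*D+LD^2\mu_{\max}\sqrt{1+c_\lambda}}{T}+\frac{D\tilde\sigma\sqrt{1+c_\lambda m}}{\sqrt T}\right).$$ -/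

import Mathlib

open MeasureTheory ProbabilityTheory
open scoped ENNReal

noncomputable section

namespace AsyncByz

/-- The ambient space `ℝ^d` with the Euclidean norm. -/
abbrev Vec (d : ℕ) := EuclideanSpace ℝ (Fin d)

/-! ### Arrival schedules, update counts and delays

A schedule `a : ℕ → Fin m` says which worker arrives at each iteration `t = 1, 2, …`
(the value `a 0` is never used). Time `0` stands for the initialization. -/

/-- Number of updates made by worker `i` up to and including iteration `t`. -/
def updates {m : ℕ} (a : ℕ → Fin m) (i : Fin m) (t : ℕ) : ℕ :=
  ((Finset.Icc 1 t).filter (fun k => a k = i)).card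

/-- The last iteration `≤ t` at which worker `i` arrived; `0` (the start) if there is none. -/
def lastArrival {m : ℕ} (a : ℕ → Fin m) (i : Fin m) (t : ℕ) : ℕ :=
  ((Finset.Icc 1 t).filter (fun k => a k = i)).sup id

/-- The delay of worker `i` at iteration `t`: the time elapsed since its second last arrival among
the iterations `1, …, t` (counted from the start, time `0`, if there is no such arrival). If `i`
arrives at `t`, then this is the time elapsed since its preceding arrival. -/
def delay {m : ℕ} (a : ℕ → Fin m) (i : Fin m) (t : ℕ) : ℕ :=
  t - lastArrival a i (lastArrival a i t - 1)

/-- The maximal delay at iteration `t`, over all workers. -/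
def maxDelay {m : ℕ} (a : ℕ → Fin m) (t : ℕ) : ℕ :=
  Finset.univ.sup (fun i => delay a i t)

/-- The average over `t = 1, …, T` of the maximal delays. -/
def avgMaxDelay {m : ℕ} (a : ℕ → Fin m) (T : ℕ) : ℝ :=
  (∑ t ∈ Finset.Icc 1 T, (maxDelay a t : ℝ)) / T

/-- The minimal delay of worker `i`: the smallest time between two consecutive arrivals of `i`
among the iterations `1, …, T`. -/
def minDelay {m : ℕ} (a : ℕ → Fin m) (i : Fin m) (T : ℕ) : ℕ :=
  sInf {n | ∃ t ∈ Finset.Icc 1 T, a t = i ∧ 2 ≤ updates a i t ∧ n = delay a i t}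

/-- Bounded delay: for every worker, every time between two consecutive arrivals is at most `κ`
times its minimal delay. -/
def BoundedDelay {m : ℕ} (a : ℕ → Fin m) (T : ℕ) (κ : ℝ) : Prop :=
  ∀ i : Fin m, ∀ t ∈ Finset.Icc 1 T, a t = i → 2 ≤ updates a i t →
    (delay a i t : ℝ) ≤ κ * (minDelay a i T : ℝ)

/-- Bounded Byzantine iterations: for every `t ≤ T`, at most `lam * t` of the first `t` updates
come from workers outside `honest`. -/
def BoundedByzantine {m : ℕ} (a : ℕ → Fin m) (honest : Finset (Fin m)) (T : ℕ) (lam : ℝ) : Prop :=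
  ∀ t ∈ Finset.Icc 1 T,
    ((((Finset.Icc 1 t).filter (fun k => a k ∉ honest)).card : ℕ) : ℝ) ≤ lam * t

/-! ### Weighted robust aggregation -/

/-- A (possibly randomized) weighted aggregation rule: it accepts vectors from any collection `W`
of workers together with their weights, and a random seed, and returns a vector. -/
abbrev AggRule (m d : ℕ) (Ξ : Type*) :=
  (W : Finset (Fin m)) → (W → Vec d) → (W → ℝ) → Ξ → Vec d

/-- The weighted mean `(∑_{i ∈ G} s_i x_i) / (∑_{i ∈ G} s_i)`. -/
def weightedMean {ι : Type*} {d : ℕ} (G : Finset ι) (s : ι → ℝ) (x : ι → Vec d) : Vec d :=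
  (∑ i ∈ G, s i)⁻¹ • ∑ i ∈ G, s i • x i

/-- `(c, lam)`-weighted robustness of the rule `A` whose seed has law `ν`. `P` is the joint law of
the random input vectors; those indexed by `G` are independent of each other, while the joint
behaviour of the others is arbitrary. The expectation is over the inputs and an independent
seed. Expectations of squared norms are taken in `[0, ∞]`. -/
def IsWeightedRobust {m d : ℕ} {Ξ : Type*} [MeasurableSpace Ξ] (ν : Measure Ξ)
    (A : AggRule m d Ξ) (c lam : ℝ) : Prop :=
  0 ≤ c ∧
  ∀ (W : Finset (Fin m)), W.Nonempty →
  ∀ (P : Measure (W → Vec d)), IsProbabilityMeasure P →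
  ∀ (s : W → ℝ), (∀ i, 0 < s i) →
  ∀ (G : Finset W), (1 - lam) * ∑ i, s i ≤ ∑ i ∈ G, s i →
    iIndepFun (fun (i : G) (x : W → Vec d) => x i) P →
  ∀ (ρ : W → ℝ),
    (∀ i ∈ G, 0 ≤ ρ i ∧
      ∫⁻ x, ‖x i - weightedMean G s x‖ₑ ^ 2 ∂P ≤ ENNReal.ofReal (ρ i ^ 2)) →
    ∫⁻ p, ‖A W p.1 s p.2 - weightedMean G s p.1‖ₑ ^ 2 ∂(P.prod ν) ≤
      ENNReal.ofReal (c * ((∑ i ∈ G, s i * ρ i ^ 2) / ∑ i ∈ G, s i))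

/-! ### The algorithm -/

open Classical in
/-- Orthogonal projection onto `S`: a point of `S` nearest to `x` (it exists and is unique when `S`
is nonempty, closed and convex). -/
def proj {d : ℕ} (S : Set (Vec d)) (x : Vec d) : Vec d :=
  if h : ∃ y ∈ S, ∀ y' ∈ S, ‖y - x‖ ≤ ‖y' - x‖ then h.choose else x

/-- Everything the algorithm receives from outside during one execution. -/
structure Trace (m d : ℕ) (Z Ξ : Type*) where
  /-- the worker that arrives at iteration `t` -/
  arrival : ℕ → Fin m
  /-- the sample drawn by each worker at the initialization -/
  initSample : Fin m → Z
  /-- the sample drawn by the worker at iteration `t` -/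
  sample : ℕ → Z
  /-- the internal randomness of the aggregation rule at iteration `t` -/
  seed : ℕ → Ξ
  /-- the vector sent to the server at iteration `t` in case the arriving worker is Byzantine -/
  byzMsg : ℕ → Vec d

/-- State of the system just before an iteration `t`. -/
structure State (m d : ℕ) where
  /-- the iterate `w_t` -/
  w : Vec d
  /-- the sum `∑_{k ≤ t} α_k w_k` -/
  wsum : Vec d
  /-- the query point `x_t` -/
  x : Vec d
  /-- number of updates received from each worker so far -/
  s : Fin m → ℕ
  /-- last vector received from each worker; read only for workers with `0 < s i` -/
  received : Fin m → Vec d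
  /-- corrected momentum currently computed by each honest worker -/
  momentum : Fin m → Vec d
  /-- query point at which that momentum was computed -/
  query : Fin m → Vec d

/-- Fixed data of the algorithm: domain, stochastic gradient oracle `(x, z) ↦ ∇f(x; z)`,
aggregation rule, honest workers, learning rate, importance weights `α_t`, momentum correction
weights (`β` as a function of the number `s_t` of updates of the arriving worker), start point. -/
structure Params (m d : ℕ) (Z Ξ : Type*) where
  dom : Set (Vec d)
  grad : Vec d → Z → Vec d
  agg : AggRule m d Ξ
  honest : Finset (Fin m)
  η : ℝ
  α : ℕ → ℝ
  β : ℕ → ℝ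
  start : Vec d

/-- The parameter choice `α_t = t`, `β_t = 1 / s_t`. -/
def stdParams {m d : ℕ} {Z Ξ : Type*} (dom : Set (Vec d)) (grad : Vec d → Z → Vec d)
    (A : AggRule m d Ξ) (honest : Finset (Fin m)) (η : ℝ) (start : Vec d) : Params m d Z Ξ where
  dom := dom
  grad := grad
  agg := A
  honest := honest
  η := η
  α := fun t => (t : ℝ)
  β := fun s => 1 / (s : ℝ)
  start := start

/-- Initial state, just before iteration `1`. -/
def initState {m d : ℕ} {Z Ξ : Type*} (p : Params m d Z Ξ) (tr : Trace m d Z Ξ) : State m d where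
  w := p.start
  wsum := p.α 1 • p.start
  x := p.start
  s := fun _ => 0
  received := fun _ => 0
  momentum := fun i => p.grad p.start (tr.initSample i)
  query := fun _ => p.start

/-- Iteration `t` of the asynchronous robust `μ²`-SGD algorithm. The server aggregates the last
vectors of all workers it has heard from, weighted by their numbers of updates. -/
def step {m d : ℕ} {Z Ξ : Type*} (p : Params m d Z Ξ) (tr : Trace m d Z Ξ) (t : ℕ)
    (S : State m d) : State m d :=
  let i := tr.arrival t
  let s' : Fin m → ℕ := Function.update S.s i (S.s i + 1)
  let received' : Fin m → Vec d :=
    Function.update S.received i (if i ∈ p.honest then S.momentum i else tr.byzMsg t)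
  let W : Finset (Fin m) := Finset.univ.filter (fun j => 0 < s' j)
  let dhat : Vec d := p.agg W (fun j => received' j) (fun j => (s' j : ℝ)) (tr.seed t)
  let w' : Vec d := proj p.dom (S.w - (p.η * p.α t) • dhat)
  let wsum' : Vec d := S.wsum + p.α (t + 1) • w'
  { w := w'
    wsum := wsum'
    x := (∑ k ∈ Finset.Icc 1 (t + 1), p.α k)⁻¹ • wsum'
    s := s'
    received := received'
    momentum := Function.update S.momentum i
      (p.grad S.x (tr.sample t) +
        (1 - p.β (s' i)) • (S.momentum i - p.grad (S.query i) (tr.sample t)))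
    query := Function.update S.query i S.x }

/-- The state after `n` iterations, that is, just before iteration `n + 1`. -/
def run {m d : ℕ} {Z Ξ : Type*} (p : Params m d Z Ξ) (tr : Trace m d Z Ξ) : ℕ → State m d
  | 0 => initState p tr
  | n + 1 => step p tr (n + 1) (run p tr n)

/-- The output `x_T` (for `T ≥ 1`). -/
def output {m d : ℕ} {Z Ξ : Type*} (p : Params m d Z Ξ) (tr : Trace m d Z Ξ) (T : ℕ) : Vec d :=
  (run p tr (T - 1)).x

/-- The rate `(Gs D + L D² μ_max √(1 + c)) / T + D σ̃ √(1 + c m) / √T` for the arrival schedule `a`,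
where `σ̃² = 2 σ² + 32 D² κ² σL²` and `μ_max` is the average maximal delay. -/
def rate {m : ℕ} (a : ℕ → Fin m) (T : ℕ) (Gs D σ L σL κ c : ℝ) : ℝ :=
  (Gs * D + L * D ^ 2 * avgMaxDelay a T * Real.sqrt (1 + c)) / T +
    D * Real.sqrt (2 * σ ^ 2 + 32 * D ^ 2 * κ ^ 2 * σL ^ 2) * Real.sqrt (1 + c * m) / Real.sqrt T

/-! ### The stochastic objective and the randomness -/

/-- The expected loss `f(x) = E_{z ∼ 𝒟} f(x; z)`. -/
def expLoss {d : ℕ} {Z : Type*} [MeasurableSpace Z] (𝒟 : Measure Z) (F : Vec d → Z → ℝ)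
    (x : Vec d) : ℝ :=
  ∫ z, F x z ∂𝒟

/-- Assumptions on the objective: `dom` is a nonempty compact convex set of diameter at most `D`;
`grad x z` is the gradient on `dom` of the smooth sample loss `F · z`; the expected loss is convex
on `dom` with gradient `gradf`; stochastic gradients are unbiased, with variance at most `σ²` and
smoothness variance at most `σL²`. -/
structure IsStochasticProblem {d : ℕ} {Z : Type*} [MeasurableSpace Z] (𝒟 : Measure Z)
    (dom : Set (Vec d)) (F : Vec d → Z → ℝ) (grad : Vec d → Z → Vec d) (gradf : Vec d → Vec d)
    (D σ L σL : ℝ) : Prop where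
  compact : IsCompact dom
  convex : Convex ℝ dom
  nonempty : dom.Nonempty
  diameter : ∀ x ∈ dom, ∀ y ∈ dom, ‖x - y‖ ≤ D
  loss_integrable : ∀ x ∈ dom, Integrable (F x) 𝒟
  grad_measurable : Measurable (fun q : Vec d × Z => grad q.1 q.2)
  grad_loss : ∀ᵐ z ∂𝒟, ∀ x ∈ dom, HasGradientWithinAt (fun y => F y z) (grad x z) dom x
  loss_convex : ConvexOn ℝ dom (expLoss 𝒟 F)
  grad_expLoss : ∀ x ∈ dom, HasGradientWithinAt (expLoss 𝒟 F) (gradf x) dom x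
  unbiased : ∀ x ∈ dom, Integrable (grad x) 𝒟 ∧ ∫ z, grad x z ∂𝒟 = gradf x
  variance : ∀ x ∈ dom, ∫⁻ z, ‖grad x z - gradf x‖ₑ ^ 2 ∂𝒟 ≤ ENNReal.ofReal (σ ^ 2)
  smooth : ∀ᵐ z ∂𝒟, ∀ x ∈ dom, ∀ y ∈ dom, ‖grad x z - grad y z‖ ≤ L * ‖x - y‖
  smoothness_variance : ∀ x ∈ dom, ∀ y ∈ dom,
    ∫⁻ z, ‖(grad x z - gradf x) - (grad y z - gradf y)‖ₑ ^ 2 ∂𝒟 ≤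
      ENNReal.ofReal (σL ^ 2 * ‖x - y‖ ^ 2)

/-- The excess loss `f(x_T) - f(xstar)` of one execution. -/
def excess {m d : ℕ} {Z Ξ : Type*} [MeasurableSpace Z] (𝒟 : Measure Z) (F : Vec d → Z → ℝ)
    (p : Params m d Z Ξ) (T : ℕ) (xstar : Vec d) (tr : Trace m d Z Ξ) : ℝ :=
  expLoss 𝒟 F (output p tr T) - expLoss 𝒟 F xstar

/-- The σ-algebra generated by the arrival schedule. -/
abbrev scheduleAlgebra {m d : ℕ} {Z Ξ Ω : Type*} (X : Ω → Trace m d Z Ξ) : MeasurableSpace Ω :=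
  MeasurableSpace.comap (fun ω => (X ω).arrival) inferInstance

/-- The probabilistic model of an execution. `ℱ 0` contains the whole arrival schedule, and for
`t ≥ 1` the σ-algebra `ℱ t` is the information available when the server receives the vector of
iteration `t`. The initial samples are i.i.d. and independent of `ℱ 0`; the sample and the seed of
iteration `t` are fresh: independent of each other and of `ℱ t`. In particular all samples are
i.i.d. with law `𝒟` and independent of the arrivals, hence of the delays. A Byzantine vector may
depend in any way on the past, on the schedule and on randomness of its own. -/
structure IsExecution {m d : ℕ} {Z Ξ Ω : Type*} [MeasurableSpace Z] [MeasurableSpace Ξ]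
    [mΩ : MeasurableSpace Ω] (μ : Measure Ω) (𝒟 : Measure Z) (ν : Measure Ξ)
    (ℱ : Filtration ℕ mΩ) (X : Ω → Trace m d Z Ξ) : Prop where
  arrival_meas : Measurable[ℱ 0] (fun ω => (X ω).arrival)
  initSample_meas : Measurable[ℱ 1] (fun ω => (X ω).initSample)
  byzMsg_meas : ∀ t, 1 ≤ t → Measurable[ℱ t] (fun ω => (X ω).byzMsg t)
  fresh_meas : ∀ t, 1 ≤ t → Measurable[ℱ (t + 1)] (fun ω => ((X ω).sample t, (X ω).seed t))
  initSample_law : μ.map (fun ω => (X ω).initSample) = Measure.pi (fun _ => 𝒟)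
  initSample_indep :
    Indep (MeasurableSpace.comap (fun ω => (X ω).initSample) inferInstance) (ℱ 0) μ
  fresh_law : ∀ t, 1 ≤ t → μ.map (fun ω => ((X ω).sample t, (X ω).seed t)) = 𝒟.prod ν
  fresh_indep : ∀ t, 1 ≤ t →
    Indep (MeasurableSpace.comap (fun ω => ((X ω).sample t, (X ω).seed t)) inferInstance) (ℱ t) μ

end AsyncByz

end

/-!
The proof combines a regret bound that holds on every trajectory with a second moment bound on the
error of the aggregated direction.

*Regret* (`anytime_regret`). Since `x_t` is the average of the `w_k` with weights `α_k = k`,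
convexity gives `α_{1:T} (f(x_T) - f(x*)) ≤ ∑ α_t ⟪∇f(x_t), w_t - x*⟫`. Projection turns the
right-hand side into `D² / (2 η)`, plus the drift `∑ α_t ⟪∇f(x_t), w_t - w_{t+1}⟫`, plus the error
term `D ∑ α_t ‖d̂_t - ∇f(x_t)‖`. Summing the drift by parts bounds it by `O(T (G* D + L D²))`, as
`‖x_{t+1} - x_t‖ ≤ 2 D / (t + 1)`. The term `L D² / T` that results is absorbed by the delay term,
because the average maximal delay is at least `1`.

*Momentum noise* (`Params.IsStandard.sum_updates_smul_momentumNoise`,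
`IsExecution.lintegral_noiseComb`). With `β = 1 / s` the error `ε_s` of a momentum satisfies
`s ε_{s+1} = (s - 1) ε_s + Z`, where the innovation `Z = s (ξ(x) - ξ(q)) + ξ(q)` is centred given
the past. The `k`-th arrival of a worker comes no earlier than `k - 1` times its minimal delay, so
`s ‖x - q‖ ≤ 4 D K` and `E ‖Z‖² ≤ σ̃²`. The innovations of all iterations are orthogonal, hence the
weighted sum of the errors of the last vectors has second moment `O(t σ̃²)`, while each single
error has second moment `O(σ̃² / s)`.

*Aggregation* (`IsWeightedRobust.lintegral_sub_sq_le`). The vectors of the honest workers are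
dependent, since their query points depend on all earlier samples. Constant vectors are
independent, however, so robustness applies to Dirac laws; given the inputs it bounds the error of
the rule by the empirical weighted variance, which is then integrated. Together with the bias, of
order `L D τ_t / t`, this yields
`E ‖d̂_t - ∇f(x_t)‖² ≲ (1 + c m) σ̃² / t + (1 + c) (L D τ_t / t)²`
(`IsExecution.lintegral_direction_sub_sq_le`).

*Conditioning* (`IsExecution.condExp_excess_le`). The arrivals up to `T` take finitely many values.
Conditioning on an event of the schedule on which they are constant leaves samples and seeds fresh,
so there the schedule may be taken to be deterministic.
-/

noncomputable section

namespace AsyncByz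

/-! ### Projection onto a closed convex set -/

section Projection

variable {d : ℕ} {S : Set (Vec d)}

lemma proj_spec (hc : IsClosed S) (hne : S.Nonempty) (x : Vec d) :
    proj S x ∈ S ∧ ∀ y ∈ S, ‖proj S x - x‖ ≤ ‖y - x‖ := by
  have h : ∃ y ∈ S, ∀ y' ∈ S, ‖y - x‖ ≤ ‖y' - x‖ := by
    obtain ⟨y, hy, hd⟩ := hc.exists_infDist_eq_dist hne x
    refine ⟨y, hy, fun y' hy' => ?_⟩
    have := Metric.infDist_le_dist_of_mem (x := x) hy'
    rw [hd] at this
    rwa [dist_comm, dist_eq_norm, dist_comm, dist_eq_norm] at this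
  rw [proj, dif_pos h]
  exact h.choose_spec

lemma proj_mem (hc : IsClosed S) (hne : S.Nonempty) (x : Vec d) : proj S x ∈ S :=
  (proj_spec hc hne x).1

lemma proj_inner_le (hc : IsClosed S) (hconv : Convex ℝ S) (hne : S.Nonempty) (x : Vec d)
    {y : Vec d} (hy : y ∈ S) : inner ℝ (x - proj S x) (y - proj S x) ≤ 0 := by
  have h := proj_spec hc hne x
  have : Nonempty S := hne.to_subtype
  refine (norm_eq_iInf_iff_real_inner_le_zero hconv h.1).1 (le_antisymm ?_ ?_) y hy
  · refine le_ciInf fun w => ?_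
    rw [norm_sub_rev x, norm_sub_rev x]
    exact h.2 w w.2
  · exact ciInf_le (f := fun w : S => ‖x - w‖)
      ⟨0, by rintro _ ⟨w, rfl⟩; exact norm_nonneg _⟩ ⟨_, h.1⟩

lemma continuous_proj (hc : IsClosed S) (hconv : Convex ℝ S) (hne : S.Nonempty) :
    Continuous (proj S) := by
  refine (LipschitzWith.of_dist_le_mul (K := 1) fun x y => ?_).continuous
  have h1 := proj_inner_le hc hconv hne x (proj_mem hc hne y)
  have h2 := proj_inner_le hc hconv hne y (proj_mem hc hne x)
  have h3 : ‖proj S x - proj S y‖ ^ 2 ≤ inner ℝ (x - y) (proj S x - proj S y) := by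
    rw [← real_inner_self_eq_norm_sq]
    simp only [inner_sub_left, inner_sub_right] at *
    simp only [real_inner_comm] at *
    linarith
  have h4 := real_inner_le_norm (x - y) (proj S x - proj S y)
  rw [dist_eq_norm, dist_eq_norm, NNReal.coe_one, one_mul]
  by_contra! h
  nlinarith [norm_nonneg (x - y), norm_nonneg (proj S x - proj S y)]

end Projection

/-! ### Anytime online-to-batch conversion -/

section Regret

variable {d : ℕ} {S : Set (Vec d)} {f : Vec d → ℝ} {g : Vec d → Vec d}

/-- The first-order condition for convexity, for a gradient within the domain. Such a gradient need
not be unique, but its products with feasible directions are. -/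
lemma add_inner_gradientWithin_le (hf : ConvexOn ℝ S f) {x y g : Vec d}
    (hx : x ∈ S) (hy : y ∈ S) (hg : HasGradientWithinAt f g S x) :
    f x + inner ℝ g (y - x) ≤ f y := by
  have hmaps : Set.MapsTo (AffineMap.lineMap x y : ℝ → Vec d) (Set.Icc 0 1) S := by
    intro t ht
    exact hf.1.lineMap_mem hx hy ht
  have hconv : ConvexOn ℝ (Set.Icc (0 : ℝ) 1) (f ∘ (AffineMap.lineMap x y : ℝ → Vec d)) :=
    (hf.comp_affineMap (AffineMap.lineMap x y)).subset hmaps (convex_Icc 0 1)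
  have hl : HasDerivWithinAt (AffineMap.lineMap x y : ℝ → Vec d) (y - x) (Set.Icc 0 1) 0 :=
    AffineMap.hasDerivWithinAt_lineMap
  have hg' : HasFDerivWithinAt f (InnerProductSpace.toDual ℝ (Vec d) g) S
      (AffineMap.lineMap x y (0 : ℝ)) := by
    rw [AffineMap.lineMap_apply_zero]; exact hg.hasFDerivWithinAt
  have hder := hg'.comp_hasDerivWithinAt (0 : ℝ) hl hmaps
  have := hconv.le_slope_of_hasDerivWithinAt (x := 0) (y := 1) (by simp) (by simp) one_pos hder
  simp [slope_def_field] at this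
  linarith

/-- The regret of anytime projected gradient descent with weights `n + 1` and arbitrary
directions `v n`. The drift terms `⟪g (x n), w n - w (n + 1)⟫` are summed by parts, using that
consecutive averages are within `2 D / (n + 1)` of each other; this needs no co-coercivity of `g`,
which may fail for functions that are smooth on `S` only. -/
lemma anytime_regret {D L G η : ℝ} (hD : 0 ≤ D) (hL : 0 ≤ L) (hη : 0 < η)
    (hdiam : ∀ x ∈ S, ∀ y ∈ S, ‖x - y‖ ≤ D)
    (hgrad : ∀ x ∈ S, ∀ y ∈ S, f x + inner ℝ (g x) (y - x) ≤ f y)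
    (hlip : ∀ x ∈ S, ∀ y ∈ S, ‖g x - g y‖ ≤ L * ‖x - y‖)
    {u : Vec d} (hu : u ∈ S) (hG : ‖g u‖ ≤ G)
    (w x v : ℕ → Vec d) (hw : ∀ n, w n ∈ S) (hx : ∀ n, x n ∈ S) (hx0 : x 0 = w 0)
    (hxs : ∀ n : ℕ, (((n : ℝ) + 1) * (n + 2) / 2) • (x (n + 1) - x n) =
      ((n : ℝ) + 2) • (w (n + 1) - x (n + 1)))
    (hstep : ∀ n : ℕ, ∀ y ∈ S,
      inner ℝ (w n - (η * ((n : ℝ) + 1)) • v n - w (n + 1)) (y - w (n + 1)) ≤ 0) (N : ℕ) :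
    ((N : ℝ) + 1) * (N + 2) / 2 * (f (x N) - f u) ≤
      D ^ 2 / (2 * η) + (N + 1) * (2 * G * D + 4 * L * D ^ 2) +
        D * ∑ n ∈ Finset.range (N + 1), ((n : ℝ) + 1) * ‖v n - g (x n)‖ := by
  have hgb : ∀ n, ‖g (x n)‖ ≤ G + L * D := fun n => by
    have h1 := hlip (x n) (hx n) u hu
    have h2 := mul_le_mul_of_nonneg_left (hdiam (x n) (hx n) u hu) hL
    have h3 := norm_le_norm_add_norm_sub' (g (x n)) (g u)
    linarith
  have hG0 : 0 ≤ G := (norm_nonneg _).trans hG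
  have hbd : ∀ n k, |inner ℝ (g (x n)) (w k - u)| ≤ (G + L * D) * D := fun n k =>
    (abs_real_inner_le_norm _ _).trans
      (mul_le_mul (hgb n) (hdiam _ (hw k) _ hu) (norm_nonneg _) (by positivity))
  -- online-to-batch: convexity at `x n`, towards `x (n - 1)` and towards `u`
  have h1 : ∀ N : ℕ, ((N : ℝ) + 1) * (N + 2) / 2 * (f (x N) - f u) ≤
      ∑ n ∈ Finset.range (N + 1), ((n : ℝ) + 1) * inner ℝ (g (x n)) (w n - u) := by
    intro N
    induction N with
    | zero =>
      have := hgrad (x 0) (hx 0) u hu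
      rw [← neg_sub (x 0) u, inner_neg_right] at this
      simp [hx0] at *
      linarith
    | succ N ih =>
      rw [Finset.sum_range_succ]
      have ha := hgrad (x (N + 1)) (hx _) (x N) (hx _)
      have hb := hgrad (x (N + 1)) (hx _) u hu
      have hc := congrArg (fun z => inner ℝ (g (x (N + 1))) z) (hxs N)
      simp only [inner_smul_right, inner_sub_right] at ha hb hc
      simp only [inner_sub_right] at ih ⊢
      push_cast
      have hN : (0 : ℝ) ≤ N := N.cast_nonneg
      have ha' := mul_le_mul_of_nonneg_left ha
        (by positivity : (0 : ℝ) ≤ ((N : ℝ) + 1) * (N + 2) / 2)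
      have hb' := mul_le_mul_of_nonneg_left hb (by positivity : (0 : ℝ) ≤ (N : ℝ) + 2)
      linarith
  have hxd : ∀ n : ℕ, ((n : ℝ) + 1) * ‖x (n + 1) - x n‖ ≤ 2 * D := by
    intro n
    have h := congrArg norm (hxs n)
    rw [norm_smul, norm_smul, Real.norm_of_nonneg (by positivity),
      Real.norm_of_nonneg (by positivity)] at h
    have hd := hdiam _ (hw (n + 1)) _ (hx (n + 1))
    have h2 : ((n : ℝ) + 2) * (((n : ℝ) + 1) * ‖x (n + 1) - x n‖) ≤ (n + 2) * (2 * D) := by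
      have := mul_le_mul_of_nonneg_left hd (by positivity : (0 : ℝ) ≤ (n : ℝ) + 2)
      linarith
    exact le_of_mul_le_mul_left h2 (by positivity)
  -- summation by parts: the bracket changes by `g (x (n + 1))` and by the increment of `g`
  have h2 : ∀ N : ℕ, ∑ n ∈ Finset.range (N + 1),
      ((n : ℝ) + 1) * inner ℝ (g (x n)) (w n - w (n + 1)) ≤
      (N + 1) * (D * (G + L * D) + 2 * L * D ^ 2) -
        (N + 1) * inner ℝ (g (x N)) (w (N + 1) - u) := by
    intro N
    induction N with
    | zero =>
      have := (abs_le.1 (hbd 0 0)).2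
      have h0 : 0 ≤ 2 * L * D ^ 2 := by positivity
      simp only [inner_sub_right] at *
      simp
      linarith
    | succ N ih =>
      rw [Finset.sum_range_succ]
      have ha := (abs_le.1 (hbd (N + 1) (N + 1))).2
      have hb : ((N : ℝ) + 1) * inner ℝ (g (x (N + 1)) - g (x N)) (w (N + 1) - u) ≤
          2 * L * D ^ 2 := by
        have e1 := real_inner_le_norm (g (x (N + 1)) - g (x N)) (w (N + 1) - u)
        have e2 : ‖g (x (N + 1)) - g (x N)‖ * ‖w (N + 1) - u‖ ≤ L * ‖x (N + 1) - x N‖ * D :=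
          mul_le_mul (hlip _ (hx _) _ (hx _)) (hdiam _ (hw _) _ hu) (norm_nonneg _) (by positivity)
        calc _ ≤ ((N : ℝ) + 1) * (L * ‖x (N + 1) - x N‖ * D) :=
              mul_le_mul_of_nonneg_left (e1.trans e2) (by positivity)
          _ = L * D * (((N : ℝ) + 1) * ‖x (N + 1) - x N‖) := by ring
          _ ≤ L * D * (2 * D) := mul_le_mul_of_nonneg_left (hxd N) (by positivity)
          _ = _ := by ring
      simp only [inner_sub_right, inner_sub_left] at *
      push_cast
      linarith
  have h3 : ∀ n : ℕ, ((n : ℝ) + 1) * inner ℝ (v n) (w (n + 1) - u) ≤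
      (‖w n - u‖ ^ 2 - ‖w (n + 1) - u‖ ^ 2) / (2 * η) := by
    intro n
    have h := hstep n u hu
    have e : ‖w n - u‖ ^ 2 = ‖w n - w (n + 1)‖ ^ 2 +
        2 * inner ℝ (w n - w (n + 1)) (w (n + 1) - u) + ‖w (n + 1) - u‖ ^ 2 := by
      rw [← norm_add_sq_real]; congr 2; abel
    have e' : inner ℝ (w n - (η * ((n : ℝ) + 1)) • v n - w (n + 1)) (u - w (n + 1)) =
        - inner ℝ (w n - w (n + 1)) (w (n + 1) - u) +
          η * ((n + 1) * inner ℝ (v n) (w (n + 1) - u)) := by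
      simp only [inner_sub_left, inner_sub_right, real_inner_smul_left]
      ring
    rw [le_div_iff₀ (by positivity)]
    nlinarith [sq_nonneg ‖w n - w (n + 1)‖]
  have h4 : ∑ n ∈ Finset.range (N + 1), ((n : ℝ) + 1) * inner ℝ (v n) (w (n + 1) - u) ≤
      D ^ 2 / (2 * η) := by
    refine (Finset.sum_le_sum fun n _ => h3 n).trans ?_
    rw [← Finset.sum_div, Finset.sum_range_sub' (fun n => ‖w n - u‖ ^ 2)]
    have := pow_le_pow_left₀ (norm_nonneg _) (hdiam _ (hw 0) _ hu) 2
    gcongr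
    linarith [sq_nonneg ‖w (N + 1) - u‖]
  have h5 : ∑ n ∈ Finset.range (N + 1),
      ((n : ℝ) + 1) * inner ℝ (g (x n) - v n) (w (n + 1) - u) ≤
      D * ∑ n ∈ Finset.range (N + 1), ((n : ℝ) + 1) * ‖v n - g (x n)‖ := by
    rw [Finset.mul_sum]
    refine Finset.sum_le_sum fun n _ => ?_
    have e1 := real_inner_le_norm (g (x n) - v n) (w (n + 1) - u)
    have e2 := mul_le_mul_of_nonneg_left (hdiam _ (hw (n + 1)) _ hu) (norm_nonneg (g (x n) - v n))
    rw [norm_sub_rev (v n)]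
    calc _ ≤ ((n : ℝ) + 1) * (‖g (x n) - v n‖ * D) :=
          mul_le_mul_of_nonneg_left (e1.trans e2) (by positivity)
      _ = _ := by ring
  have hsum : ∑ n ∈ Finset.range (N + 1), ((n : ℝ) + 1) * inner ℝ (g (x n)) (w n - u) =
      ∑ n ∈ Finset.range (N + 1), ((n : ℝ) + 1) * inner ℝ (v n) (w (n + 1) - u) +
      ∑ n ∈ Finset.range (N + 1), ((n : ℝ) + 1) * inner ℝ (g (x n)) (w n - w (n + 1)) +
      ∑ n ∈ Finset.range (N + 1), ((n : ℝ) + 1) * inner ℝ (g (x n) - v n) (w (n + 1) - u) := by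
    rw [← Finset.sum_add_distrib, ← Finset.sum_add_distrib]
    refine Finset.sum_congr rfl fun n _ => ?_
    simp only [inner_sub_left, inner_sub_right]
    ring
  have h6 : -(((N : ℝ) + 1) * inner ℝ (g (x N)) (w (N + 1) - u)) ≤ (N + 1) * ((G + L * D) * D) := by
    rw [← mul_neg]
    exact mul_le_mul_of_nonneg_left (by linarith [(abs_le.1 (hbd N (N + 1))).1]) (by positivity)
  have := h1 N
  have := h2 N
  rw [hsum] at *
  nlinarith

end Regret

/-! ### Update counts and arrival times -/

section Schedule

variable {m : ℕ} (a : ℕ → Fin m) (i : Fin m)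

@[simp] lemma updates_zero : updates a i 0 = 0 := by simp [updates]

lemma Icc_one_succ (n : ℕ) : Finset.Icc 1 (n + 1) = insert (n + 1) (Finset.Icc 1 n) := by
  ext k; simp only [Finset.mem_Icc, Finset.mem_insert]; omega

lemma updates_succ (n : ℕ) :
    updates a i (n + 1) = updates a i n + if a (n + 1) = i then 1 else 0 := by
  rw [updates, Icc_one_succ, Finset.filter_insert]
  split_ifs with h
  · rw [Finset.card_insert_of_notMem (by simp)]; rfl
  · rfl

@[simp] lemma lastArrival_zero : lastArrival a i 0 = 0 := by simp [lastArrival]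

lemma lastArrival_le (n : ℕ) : lastArrival a i n ≤ n := by
  refine Finset.sup_le fun k hk => ?_
  simp at hk
  exact hk.1.2

lemma lastArrival_succ (n : ℕ) :
    lastArrival a i (n + 1) = if a (n + 1) = i then n + 1 else lastArrival a i n := by
  have := lastArrival_le a i n
  rw [lastArrival, Icc_one_succ, Finset.filter_insert]
  split_ifs with h
  · rw [Finset.sup_insert]
    change max (n + 1) (lastArrival a i n) = n + 1
    omega
  · rfl

/-- The last arrival of a worker that has already arrived is an arrival. -/
lemma lastArrival_spec {n : ℕ} (h : 0 < updates a i n) :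
    1 ≤ lastArrival a i n ∧ a (lastArrival a i n) = i ∧
      updates a i (lastArrival a i n) = updates a i n ∧
      updates a i (lastArrival a i n - 1) + 1 = updates a i n := by
  induction n with
  | zero => simp at h
  | succ n ih =>
    by_cases hn : a (n + 1) = i
    · rw [lastArrival_succ, if_pos hn]
      simp [hn, updates_succ]
    · rw [lastArrival_succ, if_neg hn]
      have e : updates a i (n + 1) = updates a i n := by simp [updates_succ, hn]
      rw [e] at h ⊢
      exact ih h

lemma sum_updates (G : Finset (Fin m)) (n : ℕ) :
    ∑ i ∈ G, updates a i n = ((Finset.Icc 1 n).filter (fun k => a k ∈ G)).card := by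
  rw [Finset.card_eq_sum_card_fiberwise (f := a) (t := G) (fun k hk => by simp at hk; exact hk.2)]
  refine Finset.sum_congr rfl fun i hi => ?_
  rw [updates, Finset.filter_filter]
  congr 1
  ext k
  simp only [Finset.mem_filter]
  constructor
  · rintro ⟨h1, rfl⟩; exact ⟨h1, hi, rfl⟩
  · rintro ⟨h1, -, h2⟩; exact ⟨h1, h2⟩

lemma sum_updates_univ (n : ℕ) : ∑ i, updates a i n = n := by
  rw [sum_updates]; simp

/-- Under the bound on Byzantine iterations, honest workers hold a `1 - lam` share of the
weights. -/
lemma BoundedByzantine.le_sum_updates {a : ℕ → Fin m} {honest : Finset (Fin m)} {T : ℕ} {lam : ℝ}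
    (h : BoundedByzantine a honest T lam) {t : ℕ} (ht : t ∈ Finset.Icc 1 T) :
    (1 - lam) * t ≤ ∑ i ∈ honest, (updates a i t : ℝ) := by
  have h1 := h t ht
  have h2 : ((Finset.Icc 1 t).filter (fun k => a k ∈ honest)).card +
      ((Finset.Icc 1 t).filter (fun k => a k ∉ honest)).card = t := by
    rw [Finset.card_filter_add_card_filter_not]; simp
  rw [← sum_updates] at h2
  have h3 : ((∑ i ∈ honest, updates a i t : ℕ) : ℝ) +
      (((Finset.Icc 1 t).filter (fun k => a k ∉ honest)).card : ℕ) = t := by exact_mod_cast h2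
  push_cast at h3
  linarith

lemma delay_of_arrival {t : ℕ} (ht : 1 ≤ t) (h : a t = i) :
    delay a i t = t - lastArrival a i (t - 1) := by
  obtain ⟨n, rfl⟩ : ∃ n, t = n + 1 := ⟨t - 1, by omega⟩
  rw [delay, lastArrival_succ, if_pos h]

/-- The `k`-th arrival of a worker occurs no earlier than `k - 1` times its minimal delay. -/
lemma updates_sub_one_mul_minDelay_le (T : ℕ) {t : ℕ} (ht : t ∈ Finset.Icc 1 T) (h : a t = i) :
    (updates a i t - 1) * minDelay a i T ≤ t := by
  induction t using Nat.strong_induction_on with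
  | _ t ih =>
    have ht' := Finset.mem_Icc.1 ht
    by_cases h2 : 2 ≤ updates a i t
    · obtain ⟨n, rfl⟩ : ∃ n, t = n + 1 := ⟨t - 1, by omega⟩
      have hu : updates a i (n + 1) = updates a i n + 1 := by simp [updates_succ, h]
      obtain ⟨h3, h4, h5, -⟩ := lastArrival_spec a i (n := n) (by omega)
      have h6 := lastArrival_le a i n
      have h7 := ih (lastArrival a i n) (by omega) (Finset.mem_Icc.2 ⟨h3, by omega⟩) h4
      have h8 : minDelay a i T ≤ delay a i (n + 1) := Nat.sInf_le ⟨n + 1, ht, h, h2, rfl⟩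
      rw [delay_of_arrival a i (by omega) h, Nat.add_sub_cancel] at h8
      rw [h5] at h7
      rw [hu]
      obtain ⟨r, hr⟩ : ∃ r, updates a i n = r + 1 := ⟨updates a i n - 1, by omega⟩
      rw [hr] at h7 ⊢
      simp only [Nat.add_sub_cancel] at h7 ⊢
      rw [Nat.add_mul, one_mul]
      omega
    · have : updates a i t - 1 = 0 := by omega
      simp [this]

/-- At the `k`-th arrival of a worker, with `k ≥ 2`, its delay is at most `2 κ t / k`. -/
lemma BoundedDelay.updates_mul_delay_le {a : ℕ → Fin m} {T : ℕ} {κ : ℝ} (hκ : 0 < κ)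
    (hb : BoundedDelay a T κ) {t : ℕ} (ht : t ∈ Finset.Icc 1 T) (h2 : 2 ≤ updates a (a t) t) :
    (updates a (a t) t : ℝ) * delay a (a t) t ≤ 2 * κ * t := by
  have h1 := hb (a t) t ht rfl h2
  have h3 : ((updates a (a t) t - 1 : ℕ) : ℝ) * minDelay a (a t) T ≤ t := by
    exact_mod_cast updates_sub_one_mul_minDelay_le a (a t) T ht rfl
  rw [Nat.cast_sub (by omega), Nat.cast_one] at h3
  have h4 : (2 : ℝ) ≤ updates a (a t) t := by exact_mod_cast h2
  have h5 : (0 : ℝ) ≤ minDelay a (a t) T := Nat.cast_nonneg _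
  calc (updates a (a t) t : ℝ) * delay a (a t) t
      ≤ updates a (a t) t * (κ * minDelay a (a t) T) := by gcongr
    _ ≤ (2 * (updates a (a t) t - 1)) * (κ * minDelay a (a t) T) := by gcongr; linarith
    _ = 2 * κ * ((updates a (a t) t - 1) * minDelay a (a t) T) := by ring
    _ ≤ 2 * κ * t := by gcongr

lemma delay_le_maxDelay (t : ℕ) : delay a i t ≤ maxDelay a t :=
  Finset.le_sup (f := fun i => delay a i t) (Finset.mem_univ i)

lemma one_le_maxDelay {t : ℕ} (ht : 1 ≤ t) : 1 ≤ maxDelay a t := by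
  refine le_trans ?_ (delay_le_maxDelay a (a t) t)
  rw [delay_of_arrival a _ ht rfl]
  have := lastArrival_le a (a t) (t - 1)
  omega

lemma one_le_avgMaxDelay {T : ℕ} (hT : 1 ≤ T) : 1 ≤ avgMaxDelay a T := by
  have hT' : (0 : ℝ) < T := by exact_mod_cast hT
  rw [avgMaxDelay, le_div_iff₀ hT', one_mul]
  calc (T : ℝ) = ∑ t ∈ Finset.Icc 1 T, (1 : ℝ) := by simp
    _ ≤ _ := Finset.sum_le_sum fun t ht => by
      exact_mod_cast one_le_maxDelay a (Finset.mem_Icc.1 ht).1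

end Schedule

section ScheduleCongr

variable {m : ℕ} {a b : ℕ → Fin m} {T : ℕ}

lemma lastArrival_congr (h : ∀ k ∈ Finset.Icc 1 T, a k = b k) (i : Fin m) {t : ℕ} (ht : t ≤ T) :
    lastArrival a i t = lastArrival b i t := by
  unfold lastArrival
  refine congrArg (fun F => Finset.sup F id) (Finset.filter_congr fun k hk => ?_)
  rw [h k (Finset.Icc_subset_Icc_right ht hk)]

lemma delay_congr (h : ∀ k ∈ Finset.Icc 1 T, a k = b k) (i : Fin m) {t : ℕ} (ht : t ≤ T) :
    delay a i t = delay b i t := by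
  have := lastArrival_le b i t
  rw [delay, delay, lastArrival_congr h i ht, lastArrival_congr h i (by omega)]

lemma avgMaxDelay_congr (h : ∀ k ∈ Finset.Icc 1 T, a k = b k) :
    avgMaxDelay a T = avgMaxDelay b T := by
  rw [avgMaxDelay, avgMaxDelay]
  congr 1
  refine Finset.sum_congr rfl fun t ht => ?_
  rw [maxDelay, maxDelay]
  congr 2
  funext i
  exact delay_congr h i (Finset.mem_Icc.1 ht).2

lemma rate_congr (h : ∀ k ∈ Finset.Icc 1 T, a k = b k) (Gs D σ L σL κ c : ℝ) :
    rate a T Gs D σ L σL κ c = rate b T Gs D σ L σL κ c := by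
  rw [rate, rate, avgMaxDelay_congr h]

end ScheduleCongr

/-! ### Trajectories of the algorithm -/

section Trajectory

variable {m d : ℕ} {Z Ξ : Type*}

/-- The direction `d̂_t` that the server computes from the state just before iteration `t`. -/
def direction (p : Params m d Z Ξ) (tr : Trace m d Z Ξ) (t : ℕ) (S : State m d) : Vec d :=
  let i := tr.arrival t
  let s' : Fin m → ℕ := Function.update S.s i (S.s i + 1)
  let received' : Fin m → Vec d :=
    Function.update S.received i (if i ∈ p.honest then S.momentum i else tr.byzMsg t)
  p.agg (Finset.univ.filter (fun j => 0 < s' j)) (fun j => received' j) (fun j => (s' j : ℝ))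
    (tr.seed t)

/-- The standing assumptions on the parameters: the weights `α_t = t` and `β_t = 1 / s_t`, and a
closed convex domain that contains the starting point. -/
structure Params.IsStandard (p : Params m d Z Ξ) : Prop where
  α_eq : ∀ t : ℕ, p.α t = t
  β_eq : ∀ s : ℕ, p.β s = 1 / s
  isClosed : IsClosed p.dom
  convex : Convex ℝ p.dom
  start_mem : p.start ∈ p.dom

variable {p : Params m d Z Ξ} (tr : Trace m d Z Ξ)

lemma run_s (i : Fin m) (n : ℕ) : (run p tr n).s i = updates tr.arrival i n := by
  induction n with
  | zero => simp [run, initState]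
  | succ n ih =>
    change Function.update (run p tr n).s (tr.arrival (n + 1)) _ i = _
    rw [updates_succ]
    by_cases h : i = tr.arrival (n + 1)
    · subst h; simp [ih]
    · rw [Function.update_of_ne h, ih, if_neg (Ne.symm h), add_zero]

lemma run_momentum_arrival (n : ℕ) :
    (run p tr (n + 1)).momentum (tr.arrival (n + 1)) =
      p.grad (run p tr n).x (tr.sample (n + 1)) +
        (1 - p.β (updates tr.arrival (tr.arrival (n + 1)) (n + 1))) •
          ((run p tr n).momentum (tr.arrival (n + 1)) -
            p.grad ((run p tr n).query (tr.arrival (n + 1))) (tr.sample (n + 1))) := by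
  rw [← run_s (p := p)]
  simp [run, step]

lemma sum_Icc_cast (n : ℕ) : ∑ k ∈ Finset.Icc 1 (n + 1), (k : ℝ) = (n + 1) * (n + 2) / 2 := by
  induction n with
  | zero => norm_num
  | succ n ih =>
    rw [Icc_one_succ, Finset.sum_insert (by simp), ih]; push_cast; ring

lemma run_query (i : Fin m) (n : ℕ) :
    (run p tr n).query i = (run p tr (lastArrival tr.arrival i n - 1)).x := by
  induction n with
  | zero => simp [run, initState]
  | succ n ih =>
    change Function.update (run p tr n).query (tr.arrival (n + 1)) (run p tr n).x i = _
    rw [lastArrival_succ]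
    by_cases h : i = tr.arrival (n + 1)
    · subst h; simp
    · rw [Function.update_of_ne h, ih, if_neg (Ne.symm h)]

lemma run_received {i : Fin m} (hi : i ∈ p.honest) {n : ℕ} (hn : 0 < updates tr.arrival i n) :
    (run p tr n).received i = (run p tr (lastArrival tr.arrival i n - 1)).momentum i := by
  induction n with
  | zero => simp at hn
  | succ n ih =>
    change Function.update (run p tr n).received (tr.arrival (n + 1)) _ i = _
    rw [lastArrival_succ]
    by_cases h : i = tr.arrival (n + 1)
    · subst h; simp [hi]
    · rw [updates_succ, if_neg (Ne.symm h)] at hn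
      rw [Function.update_of_ne h, ih hn, if_neg (Ne.symm h)]

namespace Params.IsStandard

lemma run_w_mem (hp : p.IsStandard) (n : ℕ) : (run p tr n).w ∈ p.dom := by
  cases n with
  | zero => exact hp.start_mem
  | succ n => exact proj_mem hp.isClosed ⟨_, hp.start_mem⟩ _

lemma run_x (hp : p.IsStandard) (n : ℕ) :
    (((n : ℝ) + 1) * (n + 2) / 2) • (run p tr n).x = (run p tr n).wsum := by
  have h0 : (((n : ℝ) + 1) * (n + 2) / 2) ≠ 0 := by positivity
  cases n with
  | zero => simp [run, initState, hp.α_eq]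
  | succ n =>
    have e : ∑ k ∈ Finset.Icc 1 (n + 1 + 1), p.α k =
        (((n + 1 : ℕ) : ℝ) + 1) * ((n + 1 : ℕ) + 2) / 2 := by
      rw [← sum_Icc_cast]; exact Finset.sum_congr rfl fun k _ => hp.α_eq k
    change _ • ((∑ k ∈ Finset.Icc 1 (n + 1 + 1), p.α k)⁻¹ • (run p tr (n + 1)).wsum) = _
    rw [e, smul_inv_smul₀ h0]

lemma run_x_succ (hp : p.IsStandard) (n : ℕ) : (((n : ℝ) + 2) * (n + 3) / 2) • (run p tr (n + 1)).x =
    (((n : ℝ) + 1) * (n + 2) / 2) • (run p tr n).x + ((n : ℝ) + 2) • (run p tr (n + 1)).w := by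
  have h := hp.run_x tr (n + 1)
  rw [hp.run_x tr n]
  have e : (run p tr (n + 1)).wsum =
      (run p tr n).wsum + p.α (n + 1 + 1) • (run p tr (n + 1)).w := rfl
  rw [e, hp.α_eq] at h
  push_cast at h
  convert h using 2 <;> ring_nf

lemma run_x_sub (hp : p.IsStandard) (n : ℕ) : (((n : ℝ) + 1) * (n + 2) / 2) • ((run p tr (n + 1)).x - (run p tr n).x) =
    ((n : ℝ) + 2) • ((run p tr (n + 1)).w - (run p tr (n + 1)).x) := by
  have h := hp.run_x_succ tr n
  rw [smul_sub, smul_sub, sub_eq_sub_iff_add_eq_add, add_comm (_ • (run p tr (n + 1)).w), ← h,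
    ← add_smul]
  congr 1; ring

lemma run_x_mem (hp : p.IsStandard) (n : ℕ) : (run p tr n).x ∈ p.dom := by
  induction n with
  | zero => exact hp.start_mem
  | succ n ih =>
    have h := hp.run_x_succ tr n
    have h0 : (((n : ℝ) + 2) * (n + 3) / 2) ≠ 0 := by positivity
    have : (run p tr (n + 1)).x = ((n + 1) / (n + 3) : ℝ) • (run p tr n).x +
        (2 / (n + 3) : ℝ) • (run p tr (n + 1)).w := by
      rw [← inv_smul_smul₀ h0 (run p tr (n + 1)).x, h, smul_add, smul_smul, smul_smul]
      congr 2 <;> field_simp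
    rw [this]
    exact hp.convex ih (hp.run_w_mem tr _) (by positivity) (by positivity) (by field_simp; ring)

lemma run_query_mem (hp : p.IsStandard) (i : Fin m) (n : ℕ) : (run p tr n).query i ∈ p.dom := by
  rw [run_query]; exact hp.run_x_mem tr _

/-- Query points move slowly: the average at iteration `s` makes up a share `α_{1:s} / α_{1:t}` of
the average at iteration `t`. For `s = 0` the query point is the start, which is also that of
iteration `1`. -/
lemma norm_run_x_sub_le (hp : p.IsStandard) {D : ℝ} (hdiam : ∀ x ∈ p.dom, ∀ y ∈ p.dom, ‖x - y‖ ≤ D) {s t : ℕ}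
    (hs : s ≤ t) (ht : 1 ≤ t) :
    t * ‖(run p tr (t - 1)).x - (run p tr (s - 1)).x‖ ≤ 2 * D * (t - s) := by
  have hD : 0 ≤ D := (norm_nonneg _).trans (hdiam _ hp.start_mem _ hp.start_mem)
  have key : ∀ k n : ℕ, ((((n + k : ℕ) : ℝ) + 1) * ((n + k : ℕ) + 2) / 2) *
      ‖(run p tr (n + k)).x - (run p tr n).x‖ ≤
      D * ((((n + k : ℕ) : ℝ) + 1) * ((n + k : ℕ) + 2) / 2 - ((n : ℝ) + 1) * (n + 2) / 2) := by
    intro k n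
    induction k with
    | zero => simp
    | succ k ih =>
      rw [← add_assoc]
      generalize n + k = l at *
      have h := hp.run_x_succ tr l
      have e : (((l : ℝ) + 2) * (l + 3) / 2) • ((run p tr (l + 1)).x - (run p tr n).x) =
          (((l : ℝ) + 1) * (l + 2) / 2) • ((run p tr l).x - (run p tr n).x) +
          ((l : ℝ) + 2) • ((run p tr (l + 1)).w - (run p tr n).x) := by
        rw [smul_sub, h, smul_sub, smul_sub]
        have : (((l : ℝ) + 2) * (l + 3) / 2) = ((l : ℝ) + 1) * (l + 2) / 2 + (l + 2) := by ring
        rw [this, add_smul _ _ (run p tr n).x]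
        abel
      have h2 := norm_add_le ((((l : ℝ) + 1) * (l + 2) / 2) • ((run p tr l).x - (run p tr n).x))
        (((l : ℝ) + 2) • ((run p tr (l + 1)).w - (run p tr n).x))
      rw [← e] at h2
      simp only [norm_smul] at h2
      rw [Real.norm_of_nonneg (by positivity), Real.norm_of_nonneg (by positivity),
        Real.norm_of_nonneg (by positivity)] at h2
      have h3 := mul_le_mul_of_nonneg_left
        (hdiam _ (hp.run_w_mem tr (l + 1)) _ (hp.run_x_mem tr n))
        (by positivity : (0 : ℝ) ≤ (l : ℝ) + 2)
      push_cast
      have e1 : ((l : ℝ) + 1 + 1) * (l + 1 + 2) / 2 = (l + 2) * (l + 3) / 2 := by ring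
      rw [e1]
      linarith
  have key2 : ∀ s : ℕ, 1 ≤ s → s ≤ t →
      t * ‖(run p tr (t - 1)).x - (run p tr (s - 1)).x‖ ≤ 2 * D * (t - s) := by
    intro s hs1 hst
    obtain ⟨n, rfl⟩ : ∃ n, s = n + 1 := ⟨s - 1, by omega⟩
    obtain ⟨k, rfl⟩ : ∃ k, t = n + k + 1 := ⟨t - (n + 1), by omega⟩
    have h := key k n
    simp only [Nat.add_sub_cancel]
    push_cast at h ⊢
    have hpos : (0 : ℝ) < (n : ℝ) + k + 2 := by positivity
    refine le_of_mul_le_mul_right ?_ hpos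
    have : (0 : ℝ) ≤ D * k * (k + 1 : ℝ) := by positivity
    have : (0 : ℝ) ≤ D * k := by positivity
    nlinarith
  rcases Nat.eq_zero_or_pos s with rfl | h
  · have := key2 1 le_rfl ht
    push_cast at this ⊢
    linarith
  · exact key2 s h hs

/-- The last vector of a worker was computed before its last arrival, at the query point of its
second last arrival. -/
lemma norm_run_x_sub_query_le (hp : p.IsStandard) {D : ℝ} (hdiam : ∀ x ∈ p.dom, ∀ y ∈ p.dom, ‖x - y‖ ≤ D) (i : Fin m)
    {t : ℕ} (ht : 1 ≤ t) :
    t * ‖(run p tr (t - 1)).x - (run p tr (lastArrival tr.arrival i t - 1)).query i‖ ≤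
      2 * D * delay tr.arrival i t := by
  have h1 := lastArrival_le tr.arrival i t
  have h2 := lastArrival_le tr.arrival i (lastArrival tr.arrival i t - 1)
  rw [run_query]
  refine (hp.norm_run_x_sub_le tr hdiam (by omega) ht).trans_eq ?_
  rw [delay, Nat.cast_sub (by omega)]

end Params.IsStandard

/-- The direction in terms of the state after the iteration. -/
lemma direction_eq (n : ℕ) : direction p tr (n + 1) (run p tr n) =
    p.agg (Finset.univ.filter (fun j => 0 < updates tr.arrival j (n + 1)))
      (fun j => (run p tr (n + 1)).received j) (fun j => (updates tr.arrival j (n + 1) : ℝ))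
      (tr.seed (n + 1)) := by
  have e : (fun j => updates tr.arrival j (n + 1)) = (run p tr (n + 1)).s :=
    funext fun j => (run_s tr j (n + 1)).symm
  have e' : ∀ u : Fin m → ℕ, (fun j => updates tr.arrival j (n + 1)) = u →
      direction p tr (n + 1) (run p tr n) =
      p.agg (Finset.univ.filter (fun j => 0 < u j))
      (fun j => (run p tr (n + 1)).received j) (fun j => (u j : ℝ))
      (tr.seed (n + 1)) → direction p tr (n + 1) (run p tr n) =
    p.agg (Finset.univ.filter (fun j => 0 < updates tr.arrival j (n + 1)))
      (fun j => (run p tr (n + 1)).received j) (fun j => (updates tr.arrival j (n + 1) : ℝ))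
      (tr.seed (n + 1)) := by
    rintro _ rfl h; exact h
  exact e' _ e rfl

lemma run_w_succ (n : ℕ) : (run p tr (n + 1)).w =
    proj p.dom ((run p tr n).w - (p.η * p.α (n + 1)) • direction p tr (n + 1) (run p tr n)) := rfl

/-- The regret bound along a trajectory of the algorithm. -/
lemma Params.IsStandard.excess_le (hp : p.IsStandard) {f : Vec d → ℝ} {g : Vec d → Vec d}
    {D L G : ℝ} (hL : 0 ≤ L) (hη : 0 < p.η)
    (hdiam : ∀ x ∈ p.dom, ∀ y ∈ p.dom, ‖x - y‖ ≤ D)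
    (hgrad : ∀ x ∈ p.dom, ∀ y ∈ p.dom, f x + inner ℝ (g x) (y - x) ≤ f y)
    (hlip : ∀ x ∈ p.dom, ∀ y ∈ p.dom, ‖g x - g y‖ ≤ L * ‖x - y‖)
    {u : Vec d} (hu : u ∈ p.dom) (hG : ‖g u‖ ≤ G) (N : ℕ) :
    ((N : ℝ) + 1) * (N + 2) / 2 * (f (run p tr N).x - f u) ≤
      D ^ 2 / (2 * p.η) + (N + 1) * (2 * G * D + 4 * L * D ^ 2) +
        D * ∑ n ∈ Finset.range (N + 1), ((n : ℝ) + 1) *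
          ‖direction p tr (n + 1) (run p tr n) - g (run p tr n).x‖ := by
  have hD : 0 ≤ D := (norm_nonneg _).trans (hdiam _ hp.start_mem _ hp.start_mem)
  refine anytime_regret hD hL hη hdiam hgrad hlip hu hG (fun n => (run p tr n).w)
    (fun n => (run p tr n).x) (fun n => direction p tr (n + 1) (run p tr n))
    (hp.run_w_mem tr) (hp.run_x_mem tr) rfl (hp.run_x_sub tr) (fun n y hy => ?_) N
  have := proj_inner_le hp.isClosed hp.convex ⟨_, hp.start_mem⟩
    ((run p tr n).w - (p.η * p.α (n + 1)) • direction p tr (n + 1) (run p tr n)) hy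
  rw [← run_w_succ, hp.α_eq] at this
  push_cast at this
  exact this

end Trajectory

/-! ### Second moments and fresh randomness -/

section Probability

variable {Ω α β E : Type*} {m : MeasurableSpace Ω} [mΩ : MeasurableSpace Ω] [MeasurableSpace α]
  [MeasurableSpace β] [NormedAddCommGroup E] {μ : Measure Ω}

lemma lintegral_comp_fresh [IsProbabilityMeasure μ] (hm : m ≤ mΩ) {Y : Ω → α}
    (hY : Measurable[m] Y) {z : Ω → β} (hz : Measurable z) {𝒟 : Measure β} [SFinite 𝒟]
    (hlaw : μ.map z = 𝒟) (hind : Indep (MeasurableSpace.comap z inferInstance) m μ)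
    {h : α → β → ℝ≥0∞} (hh : Measurable (Function.uncurry h)) :
    ∫⁻ ω, h (Y ω) (z ω) ∂μ = ∫⁻ ω, ∫⁻ b, h (Y ω) b ∂𝒟 ∂μ := by
  have hY' : Measurable Y := hY.mono hm le_rfl
  have hi : IndepFun Y z μ :=
    (IndepFun_iff_Indep _ _ _).2 (indep_of_indep_of_le_left hind.symm hY.comap_le)
  have hmap := (indepFun_iff_map_prod_eq_prod_map_map hY'.aemeasurable hz.aemeasurable).1 hi
  calc ∫⁻ ω, h (Y ω) (z ω) ∂μ = ∫⁻ q, Function.uncurry h q ∂(μ.map fun ω => (Y ω, z ω)) := by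
        rw [lintegral_map hh (hY'.prodMk hz)]; rfl
    _ = ∫⁻ y, ∫⁻ b, h y b ∂𝒟 ∂(μ.map Y) := by
        rw [hmap, hlaw, lintegral_prod _ hh.aemeasurable]; rfl
    _ = _ := lintegral_map hh.lintegral_prod_right' hY'

lemma enorm_sq_eq_ofReal (y : E) :
    ‖y‖ₑ ^ 2 = ENNReal.ofReal (‖y‖ ^ 2) := by
  rw [← ofReal_norm, ENNReal.ofReal_pow (norm_nonneg _)]

lemma integrable_norm_sq_of_lintegral_le {Y : Ω → E} (hY : AEStronglyMeasurable Y μ) {v : ℝ}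
    (hv : 0 ≤ v) (h : ∫⁻ ω, ‖Y ω‖ₑ ^ 2 ∂μ ≤ ENNReal.ofReal v) :
    Integrable (fun ω => ‖Y ω‖ ^ 2) μ ∧ ∫ ω, ‖Y ω‖ ^ 2 ∂μ ≤ v := by
  simp only [enorm_sq_eq_ofReal] at h
  have hm : AEStronglyMeasurable (fun ω => ‖Y ω‖ ^ 2) μ := hY.norm.pow 2
  refine ⟨⟨hm, ?_⟩, ?_⟩
  · rw [hasFiniteIntegral_iff_ofReal (.of_forall fun _ => sq_nonneg _)]
    exact h.trans_lt ENNReal.ofReal_lt_top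
  · rw [integral_eq_lintegral_of_nonneg_ae (.of_forall fun _ => sq_nonneg _) hm]
    exact ENNReal.toReal_le_of_le_ofReal hv h

/-- A variable whose second moment is at most `v` is integrable with mean norm at most `b`
whenever `v ≤ b ^ 2`. -/
lemma integral_norm_le_of_lintegral_sq_le [IsProbabilityMeasure μ] {Y : Ω → E} (hY : AEStronglyMeasurable Y μ) {b : ℝ}
    (hb : 0 ≤ b) (h : ∫⁻ ω, ‖Y ω‖ₑ ^ 2 ∂μ ≤ ENNReal.ofReal (b ^ 2)) :
    Integrable (fun ω => ‖Y ω‖) μ ∧ ∫ ω, ‖Y ω‖ ∂μ ≤ b := by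
  obtain ⟨h1, h2⟩ := integrable_norm_sq_of_lintegral_le hY (sq_nonneg b) h
  have h3 : Integrable (fun ω => ‖Y ω‖) μ := by
    refine (h1.add (integrable_const (1 : ℝ))).mono' hY.norm (.of_forall fun ω => ?_)
    simp only [Pi.add_apply, norm_norm]
    nlinarith [sq_nonneg (‖Y ω‖ - 1)]
  refine ⟨h3, le_of_forall_pos_le_add fun ε hε => ?_⟩
  -- `‖Y‖ ≤ ‖Y‖² / (2 b') + b' / 2`, with `b' = b + ε` to cover `b = 0`
  have h4 : ∫ ω, ‖Y ω‖ ∂μ ≤ ∫ ω, (‖Y ω‖ ^ 2 / (2 * (b + ε)) + (b + ε) / 2) ∂μ := by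
    refine integral_mono h3 ((h1.div_const _).add (integrable_const _)) fun ω => ?_
    have hpos : 0 < b + ε := by positivity
    simp only
    rw [← sub_nonneg]
    have : ‖Y ω‖ ^ 2 / (2 * (b + ε)) + (b + ε) / 2 - ‖Y ω‖ =
        (‖Y ω‖ - (b + ε)) ^ 2 / (2 * (b + ε)) := by field_simp; ring
    rw [this]; positivity
  rw [integral_add (h1.div_const _) (integrable_const _), integral_div] at h4
  simp at h4
  have h5 : (∫ ω, ‖Y ω‖ ^ 2 ∂μ) / (2 * (b + ε)) ≤ (b + ε) / 2 := by
    rw [div_le_iff₀ (by positivity)]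
    nlinarith
  linarith

/-- Adding a centred variable to a constant adds its variance. -/
lemma lintegral_enorm_add_sq_le [InnerProductSpace ℝ E] [CompleteSpace E]
    [IsProbabilityMeasure μ] (y : E) {h : Ω → E} (hh : Integrable h μ)
    (h0 : ∫ ω, h ω ∂μ = 0) {v : ℝ} (hv : 0 ≤ v)
    (h2 : ∫⁻ ω, ‖h ω‖ₑ ^ 2 ∂μ ≤ ENNReal.ofReal v) :
    ∫⁻ ω, ‖y + h ω‖ₑ ^ 2 ∂μ ≤ ‖y‖ₑ ^ 2 + ENNReal.ofReal v := by
  obtain ⟨h3, h4⟩ := integrable_norm_sq_of_lintegral_le hh.aestronglyMeasurable hv h2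
  have h5 : Integrable (fun ω => 2 * inner ℝ y (h ω)) μ := (hh.const_inner y).const_mul 2
  simp only [enorm_sq_eq_ofReal]
  have e : ∀ ω, ‖y + h ω‖ ^ 2 = ‖y‖ ^ 2 + 2 * inner ℝ y (h ω) + ‖h ω‖ ^ 2 := fun ω =>
    norm_add_sq_real _ _
  have h6 : Integrable (fun ω => ‖y + h ω‖ ^ 2) μ := by
    simp only [e]; exact ((integrable_const _).add h5).add h3
  rw [← ofReal_integral_eq_lintegral_ofReal h6 (.of_forall fun _ => sq_nonneg _),
    ← ENNReal.ofReal_add (sq_nonneg _) hv]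
  refine ENNReal.ofReal_le_ofReal ?_
  have e2 : ∫ ω, (‖y‖ ^ 2 + 2 * inner ℝ y (h ω)) ∂μ = ‖y‖ ^ 2 := by
    rw [integral_add (integrable_const _) h5, integral_const_mul, integral_inner hh, h0]
    simp
  have e3 : ∫ ω, (‖y‖ ^ 2 + 2 * inner ℝ y (h ω) + ‖h ω‖ ^ 2) ∂μ =
      ∫ ω, (‖y‖ ^ 2 + 2 * inner ℝ y (h ω)) ∂μ + ∫ ω, ‖h ω‖ ^ 2 ∂μ :=
    integral_add ((integrable_const _).add h5) h3
  simp only [e]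
  rw [e3, e2]
  linarith

/-- A martingale increment driven by fresh randomness adds at most its conditional variance to
the second moment. -/
lemma lintegral_enorm_add_fresh_sq_le [InnerProductSpace ℝ E] [CompleteSpace E]
    [MeasurableSpace E] [BorelSpace E] [SecondCountableTopology E] [IsProbabilityMeasure μ] (hm : m ≤ mΩ)
    {M : Ω → E} (hM : Measurable[m] M) {Y : Ω → α} (hY : Measurable[m] Y)
    {z : Ω → β} (hz : Measurable z) {𝒟 : Measure β} [IsProbabilityMeasure 𝒟]
    (hlaw : μ.map z = 𝒟) (hind : Indep (MeasurableSpace.comap z inferInstance) m μ)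
    {h : α → β → E} (hh : Measurable (Function.uncurry h)) {v : ℝ} (hv : 0 ≤ v)
    (hint : ∀ ω, Integrable (h (Y ω)) 𝒟) (h0 : ∀ ω, ∫ b, h (Y ω) b ∂𝒟 = 0)
    (h2 : ∀ ω, ∫⁻ b, ‖h (Y ω) b‖ₑ ^ 2 ∂𝒟 ≤ ENNReal.ofReal v) :
    ∫⁻ ω, ‖M ω + h (Y ω) (z ω)‖ₑ ^ 2 ∂μ ≤ ∫⁻ ω, ‖M ω‖ₑ ^ 2 ∂μ + ENNReal.ofReal v := by
  have hmeas : Measurable (Function.uncurry fun (q : E × α) (b : β) => ‖q.1 + h q.2 b‖ₑ ^ 2) := by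
    have : Measurable fun q : (E × α) × β => h q.1.2 q.2 :=
      hh.comp (g := Function.uncurry h) ((measurable_snd.comp measurable_fst).prodMk measurable_snd)
    exact ((measurable_fst.comp measurable_fst).add this).enorm.pow_const 2
  rw [lintegral_comp_fresh hm (hM.prodMk hY) hz hlaw hind hmeas]
  calc _ ≤ ∫⁻ ω, (‖M ω‖ₑ ^ 2 + ENNReal.ofReal v) ∂μ :=
        lintegral_mono fun ω => lintegral_enorm_add_sq_le _ (hint ω) (h0 ω) hv (h2 ω)
    _ = _ := by rw [lintegral_add_right _ measurable_const]; simp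

end Probability

/-! ### Noise of stochastic gradients -/

section Noise

variable {d : ℕ} {Z : Type*} [MeasurableSpace Z] (𝒟 : Measure Z) (grad : Vec d → Z → Vec d)

/-- The mean of the stochastic gradient at `x`. It agrees with `∇f` on the domain and, unlike an
arbitrary extension of `∇f`, is measurable everywhere. -/
def meanGrad (x : Vec d) : Vec d := ∫ z, grad x z ∂𝒟

/-- The error of the stochastic gradient at `x` for the sample `z`. -/
def gradNoise (x : Vec d) (z : Z) : Vec d := grad x z - meanGrad 𝒟 grad x

/-- The innovation that the `s`-th update of a worker with last query point `q` contributes to `s`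
times the error of its momentum, when it queries `x` with the sample `z`. -/
def innovation (s : ℕ) (x q : Vec d) (z : Z) : Vec d :=
  (s : ℝ) • gradNoise 𝒟 grad x z - ((s : ℝ) - 1) • gradNoise 𝒟 grad q z

variable {𝒟 grad}

lemma measurable_meanGrad [SFinite 𝒟] (hg : Measurable fun q : Vec d × Z => grad q.1 q.2) :
    Measurable (meanGrad 𝒟 grad) :=
  (hg.stronglyMeasurable.integral_prod_right (ν := 𝒟)).measurable

lemma measurable_gradNoise [SFinite 𝒟] (hg : Measurable fun q : Vec d × Z => grad q.1 q.2) :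
    Measurable fun q : Vec d × Z => gradNoise 𝒟 grad q.1 q.2 :=
  hg.sub ((measurable_meanGrad hg).comp measurable_fst)

lemma measurable_innovation [SFinite 𝒟]
    (hg : Measurable fun q : Vec d × Z => grad q.1 q.2) (s : ℕ) :
    Measurable (Function.uncurry fun (q : Vec d × Vec d) (z : Z) =>
      innovation 𝒟 grad s q.1 q.2 z) := by
  have h := measurable_gradNoise (𝒟 := 𝒟) hg
  have h1 : Measurable fun q : (Vec d × Vec d) × Z => gradNoise 𝒟 grad q.1.1 q.2 :=
    h.comp ((measurable_fst.comp measurable_fst).prodMk measurable_snd)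
  have h2 : Measurable fun q : (Vec d × Vec d) × Z => gradNoise 𝒟 grad q.1.2 q.2 :=
    h.comp ((measurable_snd.comp measurable_fst).prodMk measurable_snd)
  exact (h1.const_smul (s : ℝ)).sub (h2.const_smul ((s : ℝ) - 1))

namespace IsStochasticProblem

variable {dom : Set (Vec d)} {F : Vec d → Z → ℝ} {gradf : Vec d → Vec d} {D σ L σL : ℝ}

lemma meanGrad_eq (hP : IsStochasticProblem 𝒟 dom F grad gradf D σ L σL) {x : Vec d}
    (hx : x ∈ dom) : meanGrad 𝒟 grad x = gradf x := (hP.unbiased x hx).2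

lemma integrable_gradNoise [IsProbabilityMeasure 𝒟]
    (hP : IsStochasticProblem 𝒟 dom F grad gradf D σ L σL) {x : Vec d}
    (hx : x ∈ dom) : Integrable (gradNoise 𝒟 grad x) 𝒟 :=
  (hP.unbiased x hx).1.sub (integrable_const _)

lemma integral_gradNoise [IsProbabilityMeasure 𝒟]
    (hP : IsStochasticProblem 𝒟 dom F grad gradf D σ L σL) {x : Vec d}
    (hx : x ∈ dom) : ∫ z, gradNoise 𝒟 grad x z ∂𝒟 = 0 := by
  simp only [gradNoise]
  rw [integral_sub (hP.unbiased x hx).1 (integrable_const _)]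
  simp [meanGrad]

lemma lintegral_gradNoise (hP : IsStochasticProblem 𝒟 dom F grad gradf D σ L σL) {x : Vec d}
    (hx : x ∈ dom) : ∫⁻ z, ‖gradNoise 𝒟 grad x z‖ₑ ^ 2 ∂𝒟 ≤ ENNReal.ofReal (σ ^ 2) := by
  simp only [gradNoise, hP.meanGrad_eq hx]
  exact hP.variance x hx

lemma norm_meanGrad_sub_le [IsProbabilityMeasure 𝒟]
    (hP : IsStochasticProblem 𝒟 dom F grad gradf D σ L σL) {x y : Vec d}
    (hx : x ∈ dom) (hy : y ∈ dom) :
    ‖meanGrad 𝒟 grad x - meanGrad 𝒟 grad y‖ ≤ L * ‖x - y‖ := by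
  rw [meanGrad, meanGrad, ← integral_sub (hP.unbiased x hx).1 (hP.unbiased y hy).1]
  have := norm_integral_le_of_norm_le_const (μ := 𝒟) (f := fun z => grad x z - grad y z)
    (hP.smooth.mono fun z hz => hz x hx y hy)
  simpa using this

lemma integrable_innovation [IsProbabilityMeasure 𝒟]
    (hP : IsStochasticProblem 𝒟 dom F grad gradf D σ L σL) {x q : Vec d}
    (hx : x ∈ dom) (hq : q ∈ dom) (s : ℕ) : Integrable (innovation 𝒟 grad s x q) 𝒟 :=
  ((hP.integrable_gradNoise hx).smul (s : ℝ)).sub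
    ((hP.integrable_gradNoise hq).smul ((s : ℝ) - 1))

lemma integral_innovation [IsProbabilityMeasure 𝒟]
    (hP : IsStochasticProblem 𝒟 dom F grad gradf D σ L σL) {x q : Vec d}
    (hx : x ∈ dom) (hq : q ∈ dom) (s : ℕ) : ∫ z, innovation 𝒟 grad s x q z ∂𝒟 = 0 := by
  have e : ∫ z, innovation 𝒟 grad s x q z ∂𝒟 =
      ∫ z, (s : ℝ) • gradNoise 𝒟 grad x z ∂𝒟 - ∫ z, ((s : ℝ) - 1) • gradNoise 𝒟 grad q z ∂𝒟 :=
    integral_sub ((hP.integrable_gradNoise hx).smul (s : ℝ))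
      ((hP.integrable_gradNoise hq).smul ((s : ℝ) - 1))
  rw [e, integral_smul, integral_smul, hP.integral_gradNoise hx, hP.integral_gradNoise hq]
  simp

/-- The innovation is `s (ξ(x) - ξ(q)) + ξ(q)`: the smoothness variance controls the first term,
since a bounded delay makes `‖x - q‖` of order `1 / s`. -/
lemma lintegral_innovation [IsProbabilityMeasure 𝒟]
    (hP : IsStochasticProblem 𝒟 dom F grad gradf D σ L σL) {κ : ℝ}
    {x q : Vec d} (hx : x ∈ dom) (hq : q ∈ dom) {s : ℕ} (hs : 1 ≤ s)
    (hd : 2 ≤ s → s * ‖x - q‖ ≤ 4 * D * κ) :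
    ∫⁻ z, ‖innovation 𝒟 grad s x q z‖ₑ ^ 2 ∂𝒟 ≤
      ENNReal.ofReal (2 * σ ^ 2 + 32 * D ^ 2 * κ ^ 2 * σL ^ 2) := by
  -- for `s = 1` there is no bound on `‖x - q‖`, but the coefficient of `ξ(q)` vanishes
  rcases hs.lt_or_eq with h2 | rfl
  · have e : ∀ z, ‖innovation 𝒟 grad s x q z‖ₑ ^ 2 ≤
        ENNReal.ofReal (2 * (s : ℝ) ^ 2) * ‖(grad x z - gradf x) - (grad q z - gradf q)‖ₑ ^ 2 +
          ENNReal.ofReal 2 * ‖gradNoise 𝒟 grad q z‖ₑ ^ 2 := by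
      intro z
      have e1 : innovation 𝒟 grad s x q z =
          (s : ℝ) • ((grad x z - gradf x) - (grad q z - gradf q)) + gradNoise 𝒟 grad q z := by
        simp only [innovation, gradNoise, hP.meanGrad_eq hx, hP.meanGrad_eq hq]
        module
      rw [e1]
      simp only [enorm_sq_eq_ofReal]
      rw [← ENNReal.ofReal_mul (by positivity), ← ENNReal.ofReal_mul (by positivity),
        ← ENNReal.ofReal_add (by positivity) (by positivity)]
      refine ENNReal.ofReal_le_ofReal ?_
      have h3 := norm_add_le ((s : ℝ) • ((grad x z - gradf x) - (grad q z - gradf q)))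
        (gradNoise 𝒟 grad q z)
      have h4 := pow_le_pow_left₀ (norm_nonneg _) h3 2
      have h5 : ‖(s : ℝ) • ((grad x z - gradf x) - (grad q z - gradf q))‖ =
          s * ‖(grad x z - gradf x) - (grad q z - gradf q)‖ := by
        rw [norm_smul, Real.norm_of_nonneg (by positivity)]
      rw [h5] at h4
      nlinarith [sq_nonneg (s * ‖(grad x z - gradf x) - (grad q z - gradf q)‖ -
        ‖gradNoise 𝒟 grad q z‖)]
    refine (lintegral_mono e).trans ?_
    have hm : Measurable fun z => ‖gradNoise 𝒟 grad q z‖ₑ ^ 2 :=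
      ((measurable_gradNoise hP.grad_measurable).comp
        (measurable_const.prodMk measurable_id)).enorm.pow_const 2
    rw [lintegral_add_right _ (hm.const_mul _), lintegral_const_mul' _ _ ENNReal.ofReal_ne_top,
      lintegral_const_mul' _ _ ENNReal.ofReal_ne_top]
    refine (add_le_add (mul_le_mul_right (hP.smoothness_variance x hx q hq) _)
      (mul_le_mul_right (hP.lintegral_gradNoise hq) _)).trans ?_
    rw [← ENNReal.ofReal_mul (by positivity), ← ENNReal.ofReal_mul (by positivity),
      ← ENNReal.ofReal_add (by positivity) (by positivity)]
    refine ENNReal.ofReal_le_ofReal ?_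
    have h6 := pow_le_pow_left₀ (by positivity) (hd h2) 2
    have h7 := mul_le_mul_of_nonneg_right h6 (sq_nonneg σL)
    nlinarith
  · have e : innovation 𝒟 grad 1 x q = gradNoise 𝒟 grad x := by
      funext z; simp [innovation]
    rw [e]
    refine (hP.lintegral_gradNoise hx).trans (ENNReal.ofReal_le_ofReal ?_)
    have : 0 ≤ 32 * D ^ 2 * κ ^ 2 * σL ^ 2 := by positivity
    nlinarith [sq_nonneg σ]

end IsStochasticProblem

end Noise

/-! ### Noise of the momenta -/

section MomentumNoise

variable {m d : ℕ} {Z Ξ : Type*} [MeasurableSpace Z] (𝒟 : Measure Z)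
  (p : Params m d Z Ξ) (tr : Trace m d Z Ξ)

/-- The error of the momentum of worker `i` after `n` iterations, as an estimate of the gradient at
the query point of that worker. -/
def momentumNoise (n : ℕ) (i : Fin m) : Vec d :=
  (run p tr n).momentum i - meanGrad 𝒟 p.grad ((run p tr n).query i)

/-- The innovation of iteration `k`. -/
def runInnovation (k : ℕ) : Vec d :=
  innovation 𝒟 p.grad (updates tr.arrival (tr.arrival k) k) (run p tr (k - 1)).x
    ((run p tr (k - 1)).query (tr.arrival k)) (tr.sample k)

variable {p}

lemma momentumNoise_succ_of_ne {n : ℕ} {i : Fin m} (h : i ≠ tr.arrival (n + 1)) :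
    momentumNoise 𝒟 p tr (n + 1) i = momentumNoise 𝒟 p tr n i := by
  simp [momentumNoise, run, step, Function.update_of_ne h]

lemma momentumNoise_of_updates_eq_zero {n : ℕ} {i : Fin m} (h : updates tr.arrival i n = 0) :
    momentumNoise 𝒟 p tr n i = gradNoise 𝒟 p.grad p.start (tr.initSample i) := by
  induction n with
  | zero => rfl
  | succ n ih =>
    rw [updates_succ] at h
    have hi : i ≠ tr.arrival (n + 1) := by
      rintro rfl; simp at h
    rw [← ih (by omega), momentumNoise_succ_of_ne 𝒟 tr hi]

/-- With `β = 1 / s`, the weighted momentum error `s ε` is the sum of the innovations. -/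
lemma Params.IsStandard.updates_smul_momentumNoise (hp : p.IsStandard) (n : ℕ) (i : Fin m) :
    (updates tr.arrival i n : ℝ) • momentumNoise 𝒟 p tr n i =
      ∑ k ∈ (Finset.Icc 1 n).filter (fun k => tr.arrival k = i), runInnovation 𝒟 p tr k := by
  induction n with
  | zero => simp
  | succ n ih =>
    rw [Icc_one_succ, Finset.filter_insert]
    by_cases h : tr.arrival (n + 1) = i
    · rw [if_pos h, Finset.sum_insert (by simp), ← ih, runInnovation]
      have hm := run_momentum_arrival (p := p) tr n
      rw [h] at hm
      have hq : (run p tr (n + 1)).query i = (run p tr n).x := by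
        subst h
        simp [run, step]
      have hs : (updates tr.arrival i (n + 1) : ℝ) = updates tr.arrival i n + 1 := by
        rw [updates_succ, if_pos h]; push_cast; rfl
      rw [h, momentumNoise, momentumNoise, hm, hq, hp.β_eq, innovation, gradNoise, gradNoise, hs]
      simp only [Nat.add_sub_cancel]
      have h0 : (updates tr.arrival i n : ℝ) + 1 ≠ 0 := by positivity
      have e : ((updates tr.arrival i n : ℝ) + 1) * (1 - 1 / (updates tr.arrival i n + 1)) =
          updates tr.arrival i n := by field_simp; ring
      rw [smul_sub, smul_add, smul_smul, e]
      module
    · rw [if_neg h, ← ih, updates_succ, if_neg h, add_zero,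
        momentumNoise_succ_of_ne 𝒟 tr (Ne.symm h)]

/-- A linear combination of the initial errors and of the innovations up to iteration `n`. -/
def noiseComb (p : Params m d Z Ξ) (u : Fin m → ℝ) (v : ℕ → ℝ) (n : ℕ) : Vec d :=
  ∑ i, u i • gradNoise 𝒟 p.grad p.start (tr.initSample i) +
    ∑ k ∈ Finset.Icc 1 n, v k • runInnovation 𝒟 p tr k

/-- The coefficient of the innovation of iteration `k` in the weighted error of the last vector
sent by the worker of iteration `k`, when the server aggregates at iteration `n`. The last vector
was computed one update before its arrival, which turns the factor `s - 1` into `s`. -/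
def noiseCoeff (a : ℕ → Fin m) (n k : ℕ) : ℝ :=
  if k < lastArrival a (a k) n then
    (updates a (a k) n : ℝ) / ((updates a (a k) n : ℝ) - 1) else 0

/-- The errors of the last vectors of the workers in `H`, with weights `s`, are a combination of
initial errors and innovations. -/
lemma Params.IsStandard.sum_updates_smul_momentumNoise (hp : p.IsStandard) (n : ℕ)
    (H : Finset (Fin m)) (hH : ∀ i ∈ H, 0 < updates tr.arrival i n) :
    ∑ i ∈ H, (updates tr.arrival i n : ℝ) •
        momentumNoise 𝒟 p tr (lastArrival tr.arrival i n - 1) i =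
      noiseComb 𝒟 tr p (fun i => if i ∈ H ∧ updates tr.arrival i n = 1 then 1 else 0)
        (fun k => if tr.arrival k ∈ H then noiseCoeff tr.arrival n k else 0) n := by
  have key : ∀ i ∈ H, (updates tr.arrival i n : ℝ) •
        momentumNoise 𝒟 p tr (lastArrival tr.arrival i n - 1) i =
      (if updates tr.arrival i n = 1 then (1 : ℝ) else 0) •
          gradNoise 𝒟 p.grad p.start (tr.initSample i) +
        ∑ k ∈ (Finset.Icc 1 n).filter (fun k => tr.arrival k = i),
          noiseCoeff tr.arrival n k • runInnovation 𝒟 p tr k := by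
    intro i hi
    obtain ⟨h1, h2, h3, h4⟩ := lastArrival_spec _ _ (hH i hi)
    have hln := lastArrival_le tr.arrival i n
    have hsub : ∑ k ∈ (Finset.Icc 1 n).filter (fun k => tr.arrival k = i),
          noiseCoeff tr.arrival n k • runInnovation 𝒟 p tr k =
        ((updates tr.arrival i n : ℝ) / ((updates tr.arrival i n : ℝ) - 1)) •
        ∑ k ∈ (Finset.Icc 1 (lastArrival tr.arrival i n - 1)).filter (fun k => tr.arrival k = i),
          runInnovation 𝒟 p tr k := by
      rw [Finset.smul_sum]
      symm
      refine Finset.sum_subset_zero_on_sdiff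
        (Finset.filter_subset_filter _ (Finset.Icc_subset_Icc_right (by omega))) ?_ ?_
      · intro k hk
        simp only [Finset.mem_sdiff, Finset.mem_filter, Finset.mem_Icc] at hk
        have : ¬ k < lastArrival tr.arrival i n := by
          intro hlt; exact hk.2 ⟨⟨hk.1.1.1, by omega⟩, hk.1.2⟩
        rw [noiseCoeff, hk.1.2, if_neg this, zero_smul]
      · intro k hk
        simp only [Finset.mem_filter, Finset.mem_Icc] at hk
        have : k < lastArrival tr.arrival i n := by omega
        rw [noiseCoeff, hk.2, if_pos this]
    rw [hsub, ← hp.updates_smul_momentumNoise]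
    by_cases hs : updates tr.arrival i n = 1
    · rw [momentumNoise_of_updates_eq_zero 𝒟 tr (by omega), hs]
      simp
    · have h5 : (updates tr.arrival i (lastArrival tr.arrival i n - 1) : ℝ) =
          updates tr.arrival i n - 1 := by
        rw [← h4]; push_cast; ring
      have h6 : (updates tr.arrival i n : ℝ) - 1 ≠ 0 := by
        rw [sub_ne_zero]; exact_mod_cast hs
      rw [if_neg hs, zero_smul, zero_add, h5, smul_smul, div_mul_cancel₀ _ h6]
  rw [Finset.sum_congr rfl key, Finset.sum_add_distrib, noiseComb]
  congr 1
  · rw [← Finset.sum_filter_add_sum_filter_not Finset.univ (fun i => i ∈ H)]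
    rw [Finset.filter_mem_eq_inter, Finset.univ_inter]
    symm
    rw [Finset.sum_eq_zero (s := Finset.univ.filter fun i => i ∉ H), add_zero]
    · exact Finset.sum_congr rfl fun i hi => by simp [hi]
    · intro i hi
      simp only [Finset.mem_filter, Finset.mem_univ, true_and] at hi
      simp [hi]
  · have : ∀ k ∈ Finset.Icc 1 n, (if tr.arrival k ∈ H then noiseCoeff tr.arrival n k else 0) •
        runInnovation 𝒟 p tr k = ∑ i ∈ H, if tr.arrival k = i then
          noiseCoeff tr.arrival n k • runInnovation 𝒟 p tr k else 0 := by
      intro k _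
      rw [Finset.sum_ite_eq, ite_smul, zero_smul]
    rw [Finset.sum_congr rfl this, Finset.sum_comm]
    exact Finset.sum_congr rfl fun i _ => by rw [Finset.sum_filter]

lemma noiseCoeff_sq_le (a : ℕ → Fin m) {n k : ℕ} (hk : 1 ≤ k) : noiseCoeff a n k ^ 2 ≤ 4 := by
  rw [noiseCoeff]
  split_ifs with h
  · have hpos : 0 < updates a (a k) n := by
      rw [updates, Finset.card_pos]
      have := lastArrival_le a (a k) n
      exact ⟨k, by simp; omega⟩
    obtain ⟨h1, h2, h3, h4⟩ := lastArrival_spec a (a k) hpos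
    have h5 : 0 < updates a (a k) (lastArrival a (a k) n - 1) := by
      rw [updates, Finset.card_pos]
      exact ⟨k, by simp; omega⟩
    have h6 : (2 : ℝ) ≤ updates a (a k) n := by exact_mod_cast (by omega : 2 ≤ updates a (a k) n)
    have h7 : (updates a (a k) n : ℝ) / (updates a (a k) n - 1) ≤ 2 := by
      rw [div_le_iff₀ (by linarith)]; linarith
    have h8 : 0 ≤ (updates a (a k) n : ℝ) / (updates a (a k) n - 1) :=
      div_nonneg (by linarith) (by linarith)
    nlinarith
  · norm_num

/-- Each worker with a single update contributes its initial error, and there are at most `n`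
of them; the `n` innovations have coefficients at most `2`. -/
lemma sum_noiseComb_coeff_sq_le (a : ℕ → Fin m) (n : ℕ) (H : Finset (Fin m)) :
    ∑ i, (if i ∈ H ∧ updates a i n = 1 then (1 : ℝ) else 0) ^ 2 +
      ∑ k ∈ Finset.Icc 1 n, (if a k ∈ H then noiseCoeff a n k else 0) ^ 2 ≤ 5 * n := by
  have h1 : ∑ i, (if i ∈ H ∧ updates a i n = 1 then (1 : ℝ) else 0) ^ 2 ≤ n := by
    calc _ ≤ ∑ i, (updates a i n : ℝ) := Finset.sum_le_sum fun i _ => by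
          split_ifs with h
          · simp [h.2]
          · simp
      _ = n := by exact_mod_cast sum_updates_univ a n
  have h2 : ∑ k ∈ Finset.Icc 1 n, (if a k ∈ H then noiseCoeff a n k else 0) ^ 2 ≤
      ∑ k ∈ Finset.Icc 1 n, (4 : ℝ) := Finset.sum_le_sum fun k hk => by
    split_ifs with h
    · exact noiseCoeff_sq_le a (Finset.mem_Icc.1 hk).1
    · norm_num
  rw [Finset.sum_const, Nat.card_Icc, nsmul_eq_mul, Nat.add_sub_cancel] at h2
  linarith

/-- For one worker with `s ≥ 2` updates, `s - 1` innovations have the coefficient `s / (s - 1)`. -/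
lemma sum_noiseComb_coeff_sq_singleton_le (a : ℕ → Fin m) (n : ℕ) (j : Fin m)
    (hj : 0 < updates a j n) :
    ∑ i, (if i ∈ ({j} : Finset (Fin m)) ∧ updates a i n = 1 then (1 : ℝ) else 0) ^ 2 +
      ∑ k ∈ Finset.Icc 1 n, (if a k ∈ ({j} : Finset (Fin m)) then noiseCoeff a n k else 0) ^ 2 ≤
      2 * updates a j n := by
  obtain ⟨h1, h2, h3, h4⟩ := lastArrival_spec a j hj
  have hln := lastArrival_le a j n
  have e1 : ∑ i, (if i ∈ ({j} : Finset (Fin m)) ∧ updates a i n = 1 then (1 : ℝ) else 0) ^ 2 =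
      if updates a j n = 1 then 1 else 0 := by
    rw [Finset.sum_eq_single j]
    · simp
    · intro i _ hi; simp [hi]
    · simp
  have e2 : ∑ k ∈ Finset.Icc 1 n,
        (if a k ∈ ({j} : Finset (Fin m)) then noiseCoeff a n k else 0) ^ 2 =
      ∑ k ∈ (Finset.Icc 1 (lastArrival a j n - 1)).filter (fun k => a k = j),
        ((updates a j n : ℝ) / ((updates a j n : ℝ) - 1)) ^ 2 := by
    symm
    refine Finset.sum_subset_zero_on_sdiff (fun k hk => ?_) ?_ ?_
    · simp only [Finset.mem_filter, Finset.mem_Icc] at hk ⊢; omega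
    · intro k hk
      simp only [Finset.mem_sdiff, Finset.mem_filter, Finset.mem_Icc] at hk
      simp only [Finset.mem_singleton]
      split_ifs with h
      · have : ¬ k < lastArrival a j n := fun hlt => hk.2 ⟨⟨hk.1.1, by omega⟩, h⟩
        rw [noiseCoeff, h, if_neg this]; norm_num
      · norm_num
    · intro k hk
      simp only [Finset.mem_filter, Finset.mem_Icc] at hk
      have : k < lastArrival a j n := by omega
      simp only [Finset.mem_singleton, hk.2, if_true]
      rw [noiseCoeff, hk.2, if_pos this]
  rw [e1, e2, Finset.sum_const, nsmul_eq_mul]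
  have h5 : ((((Finset.Icc 1 (lastArrival a j n - 1)).filter (fun k => a k = j)).card : ℕ) : ℝ) =
      updates a j n - 1 := by
    rw [← h4]; push_cast; rw [updates]; ring
  rw [h5]
  split_ifs with hs
  · rw [hs]; norm_num
  · have h6 : (2 : ℝ) ≤ updates a j n := by exact_mod_cast (by omega : 2 ≤ updates a j n)
    generalize (updates a j n : ℝ) = s at *
    have h7 : (s - 1) * (s / (s - 1)) ^ 2 = s ^ 2 / (s - 1) := by
      have : s - 1 ≠ 0 := by linarith
      field_simp
    rw [h7, zero_add, div_le_iff₀ (by linarith)]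
    nlinarith

end MomentumNoise

/-! ### Sums of independent centred vectors -/

section Independent

variable {Ω ι E : Type*} [mΩ : MeasurableSpace Ω] [NormedAddCommGroup E] [InnerProductSpace ℝ E]
  [CompleteSpace E] [MeasurableSpace E] [BorelSpace E] [SecondCountableTopology E]
  {μ : Measure Ω} [IsProbabilityMeasure μ]

lemma lintegral_enorm_sum_sq_le {X : ι → Ω → E} (hX : ∀ i, Measurable (X i))
    (hind : iIndepFun X μ) (hint : ∀ i, Integrable (X i) μ) (h0 : ∀ i, ∫ ω, X i ω ∂μ = 0)
    {v : ι → ℝ} (hv : ∀ i, 0 ≤ v i) (h2 : ∀ i, ∫⁻ ω, ‖X i ω‖ₑ ^ 2 ∂μ ≤ ENNReal.ofReal (v i))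
    (S : Finset ι) :
    ∫⁻ ω, ‖∑ i ∈ S, X i ω‖ₑ ^ 2 ∂μ ≤ ENNReal.ofReal (∑ i ∈ S, v i) := by
  classical
  induction S using Finset.induction_on with
  | empty => simp
  | insert j S hj ih =>
    have hM : Measurable (∑ i ∈ S, X i) := by
      rw [Finset.sum_fn]; exact Finset.measurable_sum _ fun i _ => hX i
    have hi : IndepFun (∑ i ∈ S, X i) (X j) μ := hind.indepFun_finsetSum_of_notMem hX hj
    have := Measure.isProbabilityMeasure_map (μ := μ) (hX j).aemeasurable
    -- `X j` itself plays the role of the fresh randomness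
    have h := lintegral_enorm_add_fresh_sq_le (μ := μ) (m := MeasurableSpace.comap
      (∑ i ∈ S, X i) inferInstance) hM.comap_le (M := ∑ i ∈ S, X i)
      (comap_measurable _) (α := Unit) (Y := fun _ => ()) measurable_const (hX j) (𝒟 := μ.map (X j))
      rfl ((IndepFun_iff_Indep _ _ _).1 hi.symm) (h := fun _ e => e) measurable_snd (hv j)
      (fun _ => (integrable_map_measure aestronglyMeasurable_id (hX j).aemeasurable).2 (hint j))
      (fun _ => (integral_map (hX j).aemeasurable aestronglyMeasurable_id).trans (h0 j))
      (fun _ => by rw [lintegral_map (measurable_enorm.pow_const 2) (hX j)]; exact h2 j)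
    simp only [Finset.sum_apply] at h
    rw [Finset.sum_insert hj, add_comm (v j),
      ENNReal.ofReal_add (Finset.sum_nonneg fun i _ => hv i) (hv j)]
    simp only [Finset.sum_insert hj]
    calc _ = ∫⁻ ω, ‖∑ i ∈ S, X i ω + X j ω‖ₑ ^ 2 ∂μ := by simp only [add_comm]
      _ ≤ _ := h.trans (add_le_add_left ih _)

end Independent

/-! ### Robust aggregation of fixed vectors -/

section Robust

lemma iIndepFun_dirac {α ι β : Type*} [MeasurableSpace α] [MeasurableSpace β] (x : α)
    (f : ι → α → β) (hf : ∀ i, Measurable (f i)) : iIndepFun f (Measure.dirac x) := by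
  rw [iIndepFun_iff_measure_inter_preimage_eq_mul]
  intro S sets hS
  have h1 : MeasurableSet (⋂ i ∈ S, f i ⁻¹' sets i) :=
    S.measurableSet_biInter fun i hi => hf i (hS i hi)
  rw [Measure.dirac_apply' _ h1]
  have h2 : ∀ i ∈ S, Measure.dirac x (f i ⁻¹' sets i) = (f i ⁻¹' sets i).indicator 1 x :=
    fun i hi => Measure.dirac_apply' _ (hf i (hS i hi))
  rw [Finset.prod_congr rfl h2]
  by_cases h : ∀ i ∈ S, x ∈ f i ⁻¹' sets i
  · rw [Set.indicator_of_mem (Set.mem_iInter₂.2 h),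
      Finset.prod_eq_one fun i hi => Set.indicator_of_mem (h i hi) _]
    rfl
  · rw [Set.indicator_of_notMem fun hx => h (Set.mem_iInter₂.1 hx)]
    push Not at h
    obtain ⟨i, hi, hx⟩ := h
    rw [Finset.prod_eq_zero hi (Set.indicator_of_notMem hx _)]

variable {m d : ℕ} {Ξ : Type*} [MeasurableSpace Ξ] {ν : Measure Ξ}

/-- A weighted mean minimizes the weighted sum of squared distances. -/
lemma sum_mul_norm_sub_weightedMean_sq_le {ι : Type*} (G : Finset ι) {s : ι → ℝ}
    (hs : ∀ i, 0 < s i) (x : ι → Vec d) (y : Vec d) :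
    ∑ i ∈ G, s i * ‖x i - weightedMean G s x‖ ^ 2 ≤ ∑ i ∈ G, s i * ‖x i - y‖ ^ 2 := by
  rcases G.eq_empty_or_nonempty with rfl | hG
  · simp
  have hS : 0 < ∑ i ∈ G, s i := Finset.sum_pos (fun i _ => hs i) hG
  set μ := weightedMean G s x with hμ
  have h0 : ∑ i ∈ G, s i • (x i - μ) = 0 := by
    simp only [smul_sub]
    rw [Finset.sum_sub_distrib, ← Finset.sum_smul, hμ, weightedMean, smul_inv_smul₀ hS.ne', sub_self]
  have e : ∀ i ∈ G, s i * ‖x i - y‖ ^ 2 = s i * ‖x i - μ‖ ^ 2 +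
      2 * inner ℝ (s i • (x i - μ)) (μ - y) + s i * ‖μ - y‖ ^ 2 := by
    intro i _
    rw [← sub_add_sub_cancel (x i) μ y, norm_add_sq_real, real_inner_smul_left]
    ring
  rw [Finset.sum_congr rfl e, Finset.sum_add_distrib, Finset.sum_add_distrib, ← Finset.mul_sum,
    ← sum_inner, h0, inner_zero_left, ← Finset.sum_mul]
  have := mul_nonneg hS.le (sq_nonneg ‖μ - y‖)
  linarith

/-- Robustness for deterministic inputs, obtained from a Dirac law: constants are independent. The
error is bounded through the distances to an arbitrary point `y`. -/
lemma IsWeightedRobust.lintegral_sub_sq_le {A : AggRule m d Ξ} {c lam : ℝ} [SFinite ν]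
    (hA : IsWeightedRobust ν A c lam)
    (hmeas : ∀ (W : Finset (Fin m)) (s : W → ℝ),
      Measurable (fun p : (W → Vec d) × Ξ => A W p.1 s p.2))
    {W : Finset (Fin m)} (hW : W.Nonempty) {s : W → ℝ} (hs : ∀ i, 0 < s i) (G : Finset W)
    (hG : (1 - lam) * ∑ i, s i ≤ ∑ i ∈ G, s i) (x : W → Vec d) (y : Vec d) :
    ∫⁻ ξ, ‖A W x s ξ - weightedMean G s x‖ₑ ^ 2 ∂ν ≤
      ENNReal.ofReal (c * ((∑ i ∈ G, s i * ‖x i - y‖ ^ 2) / ∑ i ∈ G, s i)) := by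
  have h := hA.2 W hW (Measure.dirac x) inferInstance s hs G hG
    (iIndepFun_dirac x _ fun i => measurable_pi_apply _)
    (fun i => ‖x i - weightedMean G s x‖) (fun i _ => ⟨norm_nonneg _, by
      have hm : Measurable fun z : W → Vec d => ‖z i - weightedMean G s z‖ₑ ^ 2 := by
        unfold weightedMean; fun_prop
      rw [lintegral_dirac' _ hm, enorm_sq_eq_ofReal]⟩)
  have hm : Measurable fun p : (W → Vec d) × Ξ => ‖A W p.1 s p.2 - weightedMean G s p.1‖ₑ ^ 2 := by
    have h1 : Measurable fun p : (W → Vec d) × Ξ => weightedMean G s p.1 := by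
      unfold weightedMean; fun_prop
    exact ((hmeas W s).sub h1).enorm.pow_const 2
  rw [Measure.dirac_prod, lintegral_map hm measurable_prodMk_left] at h
  refine h.trans (ENNReal.ofReal_le_ofReal ?_)
  refine mul_le_mul_of_nonneg_left ?_ hA.1
  exact div_le_div_of_nonneg_right (sum_mul_norm_sub_weightedMean_sq_le G hs x y)
    (Finset.sum_nonneg fun i _ => (hs i).le)

end Robust

/-! ### Executions with a deterministic schedule -/

section Measurability

variable {m d : ℕ} {Z Ξ Ω : Type*} {p : Params m d Z Ξ} {b : ℕ → Fin m}

/-- All components of a random state other than the update counts are measurable. -/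
structure MeasurableState (m₀ : MeasurableSpace Ω) (S : Ω → State m d) : Prop where
  w : Measurable[m₀] fun ω => (S ω).w
  wsum : Measurable[m₀] fun ω => (S ω).wsum
  x : Measurable[m₀] fun ω => (S ω).x
  received : ∀ i, Measurable[m₀] fun ω => (S ω).received i
  momentum : ∀ i, Measurable[m₀] fun ω => (S ω).momentum i
  query : ∀ i, Measurable[m₀] fun ω => (S ω).query i

lemma MeasurableState.mono {m₁ m₂ : MeasurableSpace Ω} (h : m₁ ≤ m₂) {S : Ω → State m d}
    (hS : MeasurableState m₁ S) : MeasurableState m₂ S where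
  w := hS.w.mono h le_rfl
  wsum := hS.wsum.mono h le_rfl
  x := hS.x.mono h le_rfl
  received i := (hS.received i).mono h le_rfl
  momentum i := (hS.momentum i).mono h le_rfl
  query i := (hS.query i).mono h le_rfl

variable [m₀ : MeasurableSpace Ω] {X : Ω → Trace m d Z Ξ}

lemma measurable_direction [MeasurableSpace Ξ] (hagg : ∀ (W : Finset (Fin m)) (s : W → ℝ),
      Measurable (fun q : (W → Vec d) × Ξ => p.agg W q.1 s q.2))
    (hb : ∀ ω, (X ω).arrival = b) (n : ℕ)
    (hrec : ∀ i, Measurable fun ω => (run p (X ω) (n + 1)).received i)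
    (hξ : Measurable fun ω => (X ω).seed (n + 1)) :
    Measurable fun ω => direction p (X ω) (n + 1) (run p (X ω) n) := by
  have e : ∀ ω, direction p (X ω) (n + 1) (run p (X ω) n) =
      p.agg (Finset.univ.filter (fun j => 0 < updates b j (n + 1)))
        (fun j => (run p (X ω) (n + 1)).received j) (fun j => (updates b j (n + 1) : ℝ))
        ((X ω).seed (n + 1)) := fun ω => by rw [direction_eq, hb ω]
  simp only [e]
  have h1 : Measurable fun ω => (fun j : {j // j ∈ Finset.univ.filter
      (fun j => 0 < updates b j (n + 1))} => (run p (X ω) (n + 1)).received j) :=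
    measurable_pi_lambda _ fun j => hrec j
  exact (hagg _ (fun j => (updates b j (n + 1) : ℝ))).comp (h1.prodMk hξ)

lemma MeasurableState.received_succ (hb : ∀ ω, (X ω).arrival = b) {n : ℕ}
    (hS : MeasurableState m₀ fun ω => run p (X ω) n)
    (hbyz : Measurable fun ω => (X ω).byzMsg (n + 1)) (i : Fin m) :
    Measurable fun ω => (run p (X ω) (n + 1)).received i := by
  have e : ∀ ω, (run p (X ω) (n + 1)).received i = if i = b (n + 1) then
      (if i ∈ p.honest then (run p (X ω) n).momentum i else (X ω).byzMsg (n + 1))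
      else (run p (X ω) n).received i := by
    intro ω
    rw [← hb ω]
    by_cases h : i = (X ω).arrival (n + 1)
    · rw [if_pos h, h]; simp [run, step]
    · rw [if_neg h]; simp [run, step, Function.update_of_ne h]
  simp only [e]
  split_ifs
  · exact hS.momentum i
  · exact hbyz
  · exact hS.received i

lemma Params.IsStandard.measurableState_succ [MeasurableSpace Z] [MeasurableSpace Ξ]
    (hp : p.IsStandard)
    (hg : Measurable fun q : Vec d × Z => p.grad q.1 q.2)
    (hagg : ∀ (W : Finset (Fin m)) (s : W → ℝ),
      Measurable (fun q : (W → Vec d) × Ξ => p.agg W q.1 s q.2))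
    (hb : ∀ ω, (X ω).arrival = b) {n : ℕ} (hS : MeasurableState m₀ fun ω => run p (X ω) n)
    (hbyz : Measurable fun ω => (X ω).byzMsg (n + 1))
    (hz : Measurable fun ω => (X ω).sample (n + 1))
    (hξ : Measurable fun ω => (X ω).seed (n + 1)) :
    MeasurableState m₀ fun ω => run p (X ω) (n + 1) := by
  have hrec := hS.received_succ hb hbyz
  have hw : Measurable fun ω => (run p (X ω) (n + 1)).w := by
    simp only [run_w_succ]
    exact (continuous_proj hp.isClosed hp.convex ⟨_, hp.start_mem⟩).measurable.comp
      (hS.w.sub ((measurable_direction hagg hb n hrec hξ).const_smul (p.η * p.α (n + 1))))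
  have hwsum : Measurable fun ω => (run p (X ω) (n + 1)).wsum :=
    hS.wsum.add (hw.const_smul (p.α (n + 1 + 1)))
  refine ⟨hw, hwsum, hwsum.const_smul (∑ k ∈ Finset.Icc 1 (n + 1 + 1), p.α k)⁻¹, hrec, ?_, ?_⟩
  · intro i
    by_cases h : i = b (n + 1)
    · have e : ∀ ω, (run p (X ω) (n + 1)).momentum i = p.grad (run p (X ω) n).x
          ((X ω).sample (n + 1)) + (1 - p.β (updates b i (n + 1))) • ((run p (X ω) n).momentum i -
            p.grad ((run p (X ω) n).query i) ((X ω).sample (n + 1))) := by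
        intro ω
        have := run_momentum_arrival (p := p) (X ω) n
        rwa [hb ω, ← h] at this
      simp only [e]
      have h1 : Measurable fun ω => p.grad (run p (X ω) n).x ((X ω).sample (n + 1)) :=
        hg.comp (hS.x.prodMk hz)
      have h2 : Measurable fun ω => p.grad ((run p (X ω) n).query i) ((X ω).sample (n + 1)) :=
        hg.comp ((hS.query i).prodMk hz)
      exact h1.add (((hS.momentum i).sub h2).const_smul (1 - p.β (updates b i (n + 1))))
    · have e : ∀ ω, (run p (X ω) (n + 1)).momentum i = (run p (X ω) n).momentum i := by
        intro ω
        rw [← hb ω] at h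
        simp [run, step, Function.update_of_ne h]
      simp only [e]
      exact hS.momentum i
  · intro i
    by_cases h : i = b (n + 1)
    · have e : ∀ ω, (run p (X ω) (n + 1)).query i = (run p (X ω) n).x := by
        intro ω
        rw [← hb ω] at h
        rw [h]
        simp [run, step]
      simp only [e]
      exact hS.x
    · have e : ∀ ω, (run p (X ω) (n + 1)).query i = (run p (X ω) n).query i := by
        intro ω
        rw [← hb ω] at h
        simp [run, step, Function.update_of_ne h]
      simp only [e]
      exact hS.query i

lemma measurable_noiseComb [MeasurableSpace Z] {𝒟 : Measure Z} [SFinite 𝒟]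
    (hg : Measurable fun q : Vec d × Z => p.grad q.1 q.2)
    (hb : ∀ ω, (X ω).arrival = b) (u : Fin m → ℝ) (v : ℕ → ℝ) (n : ℕ)
    (hinit : Measurable fun ω => (X ω).initSample)
    (hz : ∀ k ∈ Finset.Icc 1 n, Measurable fun ω => (X ω).sample k)
    (hS : ∀ k ∈ Finset.Icc 1 n, MeasurableState m₀ fun ω => run p (X ω) (k - 1)) :
    Measurable fun ω => noiseComb 𝒟 (X ω) p u v n := by
  have hξ : Measurable (gradNoise 𝒟 p.grad p.start) :=
    (measurable_gradNoise hg).comp (measurable_const.prodMk measurable_id)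
  have h1 : Measurable fun ω => ∑ i, u i • gradNoise 𝒟 p.grad p.start ((X ω).initSample i) :=
    Finset.measurable_sum _ fun i _ =>
      (hξ.comp ((measurable_pi_apply i).comp hinit)).const_smul (u i)
  have h2 : Measurable fun ω => ∑ k ∈ Finset.Icc 1 n, v k • runInnovation 𝒟 p (X ω) k := by
    refine Finset.measurable_sum _ fun k hk => ?_
    have h3 := (measurable_innovation (𝒟 := 𝒟) hg (updates b (b k) k)).comp
      (((hS k hk).x.prodMk ((hS k hk).query (b k))).prodMk (hz k hk))
    simp only [runInnovation, hb]
    exact h3.const_smul (v k)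
  exact h1.add h2

end Measurability

section Execution

variable {m d : ℕ} {Z Ξ Ω : Type*} [MeasurableSpace Z] [MeasurableSpace Ξ]
  [mΩ : MeasurableSpace Ω] {μ : Measure Ω} {𝒟 : Measure Z} {ν : Measure Ξ}
  {ℱ : Filtration ℕ mΩ} {X : Ω → Trace m d Z Ξ} {p : Params m d Z Ξ} {b : ℕ → Fin m}

lemma IsExecution.sample_meas (hX : IsExecution μ 𝒟 ν ℱ X) {t : ℕ} (ht : 1 ≤ t) :
    Measurable[ℱ (t + 1)] fun ω => (X ω).sample t :=
  measurable_fst.comp (hX.fresh_meas t ht)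

lemma IsExecution.seed_meas (hX : IsExecution μ 𝒟 ν ℱ X) {t : ℕ} (ht : 1 ≤ t) :
    Measurable[ℱ (t + 1)] fun ω => (X ω).seed t :=
  measurable_snd.comp (hX.fresh_meas t ht)

lemma IsExecution.sample_law [IsProbabilityMeasure ν] (hX : IsExecution μ 𝒟 ν ℱ X) {t : ℕ}
    (ht : 1 ≤ t) : μ.map (fun ω => (X ω).sample t) = 𝒟 := by
  have h := congrArg (Measure.map Prod.fst) (hX.fresh_law t ht)
  rw [Measure.map_map measurable_fst ((hX.fresh_meas t ht).mono (ℱ.le _) le_rfl),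
    Measure.map_fst_prod] at h
  rwa [measure_univ, one_smul] at h

lemma IsExecution.seed_law [IsProbabilityMeasure 𝒟] [SFinite ν] (hX : IsExecution μ 𝒟 ν ℱ X)
    {t : ℕ} (ht : 1 ≤ t) : μ.map (fun ω => (X ω).seed t) = ν := by
  have h := congrArg (Measure.map Prod.snd) (hX.fresh_law t ht)
  rw [Measure.map_map measurable_snd ((hX.fresh_meas t ht).mono (ℱ.le _) le_rfl),
    Measure.map_snd_prod] at h
  rwa [measure_univ, one_smul] at h

lemma IsExecution.sample_indep (hX : IsExecution μ 𝒟 ν ℱ X) {t : ℕ} (ht : 1 ≤ t) :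
    Indep (MeasurableSpace.comap (fun ω => (X ω).sample t) inferInstance) (ℱ t) μ := by
  refine indep_of_indep_of_le_left (hX.fresh_indep t ht) ?_
  have : (fun ω => (X ω).sample t) = Prod.fst ∘ fun ω => ((X ω).sample t, (X ω).seed t) := rfl
  rw [this, ← MeasurableSpace.comap_comp]
  exact MeasurableSpace.comap_mono measurable_fst.comap_le

lemma IsExecution.seed_indep (hX : IsExecution μ 𝒟 ν ℱ X) {t : ℕ} (ht : 1 ≤ t) :
    Indep (MeasurableSpace.comap (fun ω => (X ω).seed t) inferInstance) (ℱ t) μ := by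
  refine indep_of_indep_of_le_left (hX.fresh_indep t ht) ?_
  have : (fun ω => (X ω).seed t) = Prod.snd ∘ fun ω => ((X ω).sample t, (X ω).seed t) := rfl
  rw [this, ← MeasurableSpace.comap_comp]
  exact MeasurableSpace.comap_mono measurable_snd.comap_le

lemma IsExecution.measurableState (hX : IsExecution μ 𝒟 ν ℱ X) (hp : p.IsStandard)
    (hg : Measurable fun q : Vec d × Z => p.grad q.1 q.2)
    (hagg : ∀ (W : Finset (Fin m)) (s : W → ℝ),
      Measurable (fun q : (W → Vec d) × Ξ => p.agg W q.1 s q.2))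
    (hb : ∀ ω, (X ω).arrival = b) (n : ℕ) :
    MeasurableState (ℱ (n + 1)) fun ω => run p (X ω) n := by
  induction n with
  | zero =>
    refine ⟨measurable_const, measurable_const, measurable_const, fun _ => measurable_const,
      fun i => ?_, fun _ => measurable_const⟩
    have h1 : Measurable fun z => p.grad p.start z := hg.comp (measurable_const.prodMk measurable_id)
    exact h1.comp ((measurable_pi_apply i).comp hX.initSample_meas)
  | succ n ih =>
    have hle : ℱ (n + 1) ≤ ℱ (n + 1 + 1) := ℱ.mono (Nat.le_succ _)
    exact @Params.IsStandard.measurableState_succ m d Z Ξ Ω p b (ℱ (n + 1 + 1)) X _ _ hp hg hagg hb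
      n (ih.mono hle) ((hX.byzMsg_meas (n + 1) (by omega)).mono hle le_rfl)
      (hX.sample_meas (by omega)) (hX.seed_meas (by omega))

/-- The total gradient noise level `σ̃² = 2 σ² + 32 D² κ² σL²`. -/
def noiseLevel (D σ κ σL : ℝ) : ℝ := 2 * σ ^ 2 + 32 * D ^ 2 * κ ^ 2 * σL ^ 2

lemma noiseLevel_nonneg (D σ κ σL : ℝ) : 0 ≤ noiseLevel D σ κ σL := by
  unfold noiseLevel; positivity

variable [IsProbabilityMeasure 𝒟]
  {F : Vec d → Z → ℝ} {gradf : Vec d → Vec d} {D σ L σL κ : ℝ} {T : ℕ}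

lemma IsExecution.lintegral_noiseComb_zero (hX : IsExecution μ 𝒟 ν ℱ X) (hp : p.IsStandard)
    (hP : IsStochasticProblem 𝒟 p.dom F p.grad gradf D σ L σL) (κ : ℝ)
    (u : Fin m → ℝ) (v : ℕ → ℝ) :
    ∫⁻ ω, ‖noiseComb 𝒟 (X ω) p u v 0‖ₑ ^ 2 ∂μ ≤
      ENNReal.ofReal ((∑ i, u i ^ 2) * noiseLevel D σ κ σL) := by
  have hξ : Measurable (gradNoise 𝒟 p.grad p.start) :=
    (measurable_gradNoise hP.grad_measurable).comp (measurable_const.prodMk measurable_id)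
  have hm : Measurable fun z : Fin m → Z => ‖∑ i, u i • gradNoise 𝒟 p.grad p.start (z i)‖ₑ ^ 2 := by
    fun_prop
  have e : ∫⁻ ω, ‖noiseComb 𝒟 (X ω) p u v 0‖ₑ ^ 2 ∂μ =
      ∫⁻ z, ‖∑ i, u i • gradNoise 𝒟 p.grad p.start (z i)‖ₑ ^ 2 ∂(Measure.pi fun _ : Fin m => 𝒟) := by
    rw [← hX.initSample_law, lintegral_map hm (hX.initSample_meas.mono (ℱ.le _) le_rfl)]
    simp [noiseComb]
  have hle : σ ^ 2 ≤ noiseLevel D σ κ σL := by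
    have : 0 ≤ 32 * D ^ 2 * κ ^ 2 * σL ^ 2 := by positivity
    unfold noiseLevel
    nlinarith [sq_nonneg σ]
  rw [e, Finset.sum_mul]
  have hmp : ∀ i, MeasurePreserving (fun z : Fin m → Z => z i) (Measure.pi fun _ : Fin m => 𝒟) 𝒟 :=
    fun i => measurePreserving_eval (fun _ => 𝒟) i
  have hint : ∀ i, Integrable (fun z => u i • gradNoise 𝒟 p.grad p.start z) 𝒟 := fun i =>
    (hP.integrable_gradNoise hp.start_mem).smul (u i)
  refine lintegral_enorm_sum_sq_le (μ := Measure.pi fun _ : Fin m => 𝒟)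
    (X := fun i z => u i • gradNoise 𝒟 p.grad p.start (z i)) (fun i => by fun_prop)
    (iIndepFun_pi (X := fun i z => u i • gradNoise 𝒟 p.grad p.start z)
      fun i => (hξ.const_smul (u i)).aemeasurable)
    (fun i => (hmp i).integrable_comp_of_integrable (hint i)) (fun i => ?_)
    (fun i => mul_nonneg (sq_nonneg _) (noiseLevel_nonneg _ _ _ _)) (fun i => ?_) _
  · have h1 := integral_map (μ := Measure.pi fun _ : Fin m => 𝒟) (hmp i).measurable.aemeasurable
      (f := fun z => u i • gradNoise 𝒟 p.grad p.start z)
      (hξ.const_smul (u i)).aestronglyMeasurable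
    rw [(hmp i).map_eq, integral_smul, hP.integral_gradNoise hp.start_mem, smul_zero] at h1
    exact h1.symm
  · have h1 := (hmp i).lintegral_comp (f := fun z => ‖u i • gradNoise 𝒟 p.grad p.start z‖ₑ ^ 2)
      (by fun_prop)
    rw [h1]
    simp only [enorm_smul, mul_pow]
    rw [lintegral_const_mul _ (by fun_prop), enorm_sq_eq_ofReal, Real.norm_eq_abs, sq_abs,
      ENNReal.ofReal_mul (sq_nonneg _)]
    gcongr
    exact (hP.lintegral_gradNoise hp.start_mem).trans (ENNReal.ofReal_le_ofReal hle)

lemma IsExecution.measurable_noiseComb (hX : IsExecution μ 𝒟 ν ℱ X) (hp : p.IsStandard)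
    (hg : Measurable fun q : Vec d × Z => p.grad q.1 q.2)
    (hagg : ∀ (W : Finset (Fin m)) (s : W → ℝ),
      Measurable (fun q : (W → Vec d) × Ξ => p.agg W q.1 s q.2))
    (hb : ∀ ω, (X ω).arrival = b) (u : Fin m → ℝ) (v : ℕ → ℝ) (n : ℕ) :
    Measurable[ℱ (n + 1)] fun ω => noiseComb 𝒟 (X ω) p u v n :=
  @AsyncByz.measurable_noiseComb m d Z Ξ Ω p b (ℱ (n + 1)) X _ 𝒟 _ hg hb u v n
    (hX.initSample_meas.mono (ℱ.mono (by omega)) le_rfl)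
    (fun k hk => (hX.sample_meas (Finset.mem_Icc.1 hk).1).mono
      (ℱ.mono (by have := Finset.mem_Icc.1 hk; omega)) le_rfl)
    (fun k hk => (hX.measurableState hp hg hagg hb (k - 1)).mono
      (ℱ.mono (by have := Finset.mem_Icc.1 hk; omega)))

/-- Initial errors and innovations are orthogonal, and each has second moment at most `σ̃²`. -/
lemma IsExecution.lintegral_noiseComb [IsProbabilityMeasure μ] [IsProbabilityMeasure ν]
    (hX : IsExecution μ 𝒟 ν ℱ X) (hp : p.IsStandard)
    (hP : IsStochasticProblem 𝒟 p.dom F p.grad gradf D σ L σL)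
    (hagg : ∀ (W : Finset (Fin m)) (s : W → ℝ),
      Measurable (fun q : (W → Vec d) × Ξ => p.agg W q.1 s q.2))
    (hb : ∀ ω, (X ω).arrival = b) (hκ : 0 < κ) (hdelay : BoundedDelay b T κ)
    (u : Fin m → ℝ) (v : ℕ → ℝ) {n : ℕ} (hn : n ≤ T) :
    ∫⁻ ω, ‖noiseComb 𝒟 (X ω) p u v n‖ₑ ^ 2 ∂μ ≤
      ENNReal.ofReal ((∑ i, u i ^ 2 + ∑ k ∈ Finset.Icc 1 n, v k ^ 2) * noiseLevel D σ κ σL) := by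
  have hD : 0 ≤ D := (norm_nonneg _).trans (hP.diameter _ hp.start_mem _ hp.start_mem)
  induction n with
  | zero => simpa using hX.lintegral_noiseComb_zero hp hP κ u v
  | succ n ih =>
    have hS := hX.measurableState hp hP.grad_measurable hagg hb n
    have hk : n + 1 ∈ Finset.Icc 1 T := Finset.mem_Icc.2 ⟨by omega, hn⟩
    have hs1 : 1 ≤ updates b (b (n + 1)) (n + 1) := by rw [updates_succ]; simp
    have e : ∀ ω, noiseComb 𝒟 (X ω) p u v (n + 1) = noiseComb 𝒟 (X ω) p u v n +
        v (n + 1) • innovation 𝒟 p.grad (updates b (b (n + 1)) (n + 1)) (run p (X ω) n).x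
          ((run p (X ω) n).query (b (n + 1))) ((X ω).sample (n + 1)) := by
      intro ω
      rw [noiseComb, noiseComb, Icc_one_succ, Finset.sum_insert (by simp), runInnovation, hb ω]
      simp only [Nat.add_sub_cancel]
      abel
    simp only [e]
    have hnl := noiseLevel_nonneg D σ κ σL
    have hx : ∀ ω, (run p (X ω) n).x ∈ p.dom := fun ω => hp.run_x_mem (X ω) n
    have hq : ∀ ω, (run p (X ω) n).query (b (n + 1)) ∈ p.dom := fun ω =>
      hp.run_query_mem (X ω) (b (n + 1)) n
    have hvar : ∀ ω, ∫⁻ z, ‖innovation 𝒟 p.grad (updates b (b (n + 1)) (n + 1)) (run p (X ω) n).x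
        ((run p (X ω) n).query (b (n + 1))) z‖ₑ ^ 2 ∂𝒟 ≤
        ENNReal.ofReal (noiseLevel D σ κ σL) := by
      intro ω
      refine hP.lintegral_innovation (hx ω) (hq ω) hs1 fun h2 => ?_
      have h3 := hdelay.updates_mul_delay_le hκ hk h2
      have h4 := hp.norm_run_x_sub_query_le (X ω) hP.diameter (b (n + 1)) (t := n + 1) (by omega)
      rw [hb ω, lastArrival_succ, if_pos rfl] at h4
      simp only [Nat.add_sub_cancel] at h4
      have hpos : (0 : ℝ) < (n + 1 : ℕ) := by positivity
      refine le_of_mul_le_mul_left ?_ hpos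
      have h5 := mul_le_mul_of_nonneg_left h4
        (Nat.cast_nonneg (α := ℝ) (updates b (b (n + 1)) (n + 1)))
      have h6 := mul_le_mul_of_nonneg_left h3 hD
      linarith
    have key := lintegral_enorm_add_fresh_sq_le (μ := μ) (ℱ.le (n + 1))
      (hX.measurable_noiseComb hp hP.grad_measurable hagg hb u v n)
      (Y := fun ω => ((run p (X ω) n).x, (run p (X ω) n).query (b (n + 1))))
      (hS.x.prodMk (hS.query _))
      ((hX.sample_meas (t := n + 1) (by omega)).mono (ℱ.le _) le_rfl)
      (hX.sample_law (by omega)) (hX.sample_indep (by omega))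
      (h := fun q z => v (n + 1) • innovation 𝒟 p.grad (updates b (b (n + 1)) (n + 1)) q.1 q.2 z)
      ((measurable_innovation hP.grad_measurable _).const_smul (v (n + 1)))
      (v := v (n + 1) ^ 2 * noiseLevel D σ κ σL) (by positivity)
      (fun ω => (hP.integrable_innovation (hx ω) (hq ω) _).smul (v (n + 1)))
      (fun ω => by
        simp only
        rw [integral_smul, hP.integral_innovation (hx ω) (hq ω), smul_zero])
      (fun ω => by
        simp only [enorm_smul, mul_pow]
        rw [lintegral_const_mul' _ _ (by finiteness), enorm_sq_eq_ofReal, Real.norm_eq_abs,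
          sq_abs, ENNReal.ofReal_mul (sq_nonneg _)]
        gcongr
        exact hvar ω)
    refine key.trans ((add_le_add_left (ih (by omega)) _).trans_eq ?_)
    rw [← ENNReal.ofReal_add (by positivity) (by positivity), Icc_one_succ,
      Finset.sum_insert (by simp)]
    congr 1
    ring

end Execution

/-! ### Error of the aggregated direction -/

section DirectionError

variable {m d : ℕ} {Z Ξ : Type*} [MeasurableSpace Z]
  {p : Params m d Z Ξ} {𝒟 : Measure Z}

/-- The honest workers that the server has heard from up to iteration `t`. -/
def activeHonest (honest : Finset (Fin m)) (a : ℕ → Fin m) (t : ℕ) : Finset (Fin m) :=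
  honest.filter fun i => 0 < updates a i t

lemma sum_activeHonest_updates (honest : Finset (Fin m)) (a : ℕ → Fin m) (t : ℕ) :
    ∑ i ∈ activeHonest honest a t, (updates a i t : ℝ) = ∑ i ∈ honest, (updates a i t : ℝ) := by
  rw [activeHonest, Finset.sum_filter]
  refine Finset.sum_congr rfl fun i _ => ?_
  split_ifs with h
  · rfl
  · simp [Nat.eq_zero_of_not_pos h]

/-- The error of the last vector of worker `i` when the server aggregates at iteration `t`,
multiplied by the weight of that vector. -/
def weightedNoise (𝒟 : Measure Z) (p : Params m d Z Ξ) (tr : Trace m d Z Ξ) (t : ℕ) (i : Fin m) :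
    Vec d :=
  (updates tr.arrival i t : ℝ) • momentumNoise 𝒟 p tr (lastArrival tr.arrival i t - 1) i

lemma norm_add_sq_le_two_mul (x y : Vec d) : ‖x + y‖ ^ 2 ≤ 2 * ‖x‖ ^ 2 + 2 * ‖y‖ ^ 2 := by
  have := pow_le_pow_left₀ (norm_nonneg _) (norm_add_le x y) 2
  nlinarith [sq_nonneg (‖x‖ - ‖y‖)]

variable (tr : Trace m d Z Ξ) {D L : ℝ}

/-- The bias of the last vector of an honest worker is due to its delay. -/
lemma Params.IsStandard.norm_received_sub_le (hp : p.IsStandard) (hL : 0 ≤ L)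
    (hdiam : ∀ x ∈ p.dom, ∀ y ∈ p.dom, ‖x - y‖ ≤ D)
    (hlip : ∀ x ∈ p.dom, ∀ y ∈ p.dom, ‖meanGrad 𝒟 p.grad x - meanGrad 𝒟 p.grad y‖ ≤ L * ‖x - y‖)
    (n : ℕ) {i : Fin m} (hi : i ∈ activeHonest p.honest tr.arrival (n + 1)) :
    ‖(run p tr (n + 1)).received i - meanGrad 𝒟 p.grad (run p tr n).x -
      momentumNoise 𝒟 p tr (lastArrival tr.arrival i (n + 1) - 1) i‖ ≤
      2 * L * D * maxDelay tr.arrival (n + 1) / (n + 1) := by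
  have hD : 0 ≤ D := (norm_nonneg _).trans (hdiam _ hp.start_mem _ hp.start_mem)
  rw [activeHonest, Finset.mem_filter] at hi
  rw [run_received tr hi.1 hi.2, momentumNoise, sub_sub_sub_cancel_left, norm_sub_rev]
  have h1 := hlip _ (hp.run_x_mem tr n) _
    (hp.run_query_mem tr i (lastArrival tr.arrival i (n + 1) - 1))
  have h2 := hp.norm_run_x_sub_query_le tr hdiam i (t := n + 1) (by omega)
  simp only [Nat.add_sub_cancel] at h2
  have h3 : (delay tr.arrival i (n + 1) : ℝ) ≤ maxDelay tr.arrival (n + 1) := by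
    exact_mod_cast delay_le_maxDelay tr.arrival i (n + 1)
  rw [le_div_iff₀ (by positivity)]
  push_cast at h2
  have h4 := mul_le_mul_of_nonneg_left h2 hL
  have h5 := mul_le_mul_of_nonneg_left h3 (by positivity : 0 ≤ 2 * L * D)
  have h6 := mul_le_mul_of_nonneg_right h1 (by positivity : (0 : ℝ) ≤ (n : ℝ) + 1)
  linarith

lemma Params.IsStandard.updates_mul_norm_received_sub_sq_le (hp : p.IsStandard) (hL : 0 ≤ L)
    (hdiam : ∀ x ∈ p.dom, ∀ y ∈ p.dom, ‖x - y‖ ≤ D)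
    (hlip : ∀ x ∈ p.dom, ∀ y ∈ p.dom, ‖meanGrad 𝒟 p.grad x - meanGrad 𝒟 p.grad y‖ ≤ L * ‖x - y‖)
    (n : ℕ) {i : Fin m} (hi : i ∈ activeHonest p.honest tr.arrival (n + 1)) :
    (updates tr.arrival i (n + 1) : ℝ) *
        ‖(run p tr (n + 1)).received i - meanGrad 𝒟 p.grad (run p tr n).x‖ ^ 2 ≤
      2 * (‖weightedNoise 𝒟 p tr (n + 1) i‖ ^ 2 / updates tr.arrival i (n + 1)) +
        2 * updates tr.arrival i (n + 1) *
          (2 * L * D * maxDelay tr.arrival (n + 1) / (n + 1)) ^ 2 := by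
  have h1 := hp.norm_received_sub_le tr hL hdiam hlip n hi
  have h2 := pow_le_pow_left₀ (norm_nonneg _) h1 2
  rw [activeHonest, Finset.mem_filter] at hi
  have hs : (0 : ℝ) < updates tr.arrival i (n + 1) := by exact_mod_cast hi.2
  have h3 := norm_add_sq_le_two_mul (momentumNoise 𝒟 p tr (lastArrival tr.arrival i (n + 1) - 1) i)
    ((run p tr (n + 1)).received i - meanGrad 𝒟 p.grad (run p tr n).x -
      momentumNoise 𝒟 p tr (lastArrival tr.arrival i (n + 1) - 1) i)
  rw [add_sub_cancel] at h3
  have h4 : ‖weightedNoise 𝒟 p tr (n + 1) i‖ ^ 2 / updates tr.arrival i (n + 1) =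
      updates tr.arrival i (n + 1) *
        ‖momentumNoise 𝒟 p tr (lastArrival tr.arrival i (n + 1) - 1) i‖ ^ 2 := by
    rw [weightedNoise, norm_smul, Real.norm_of_nonneg hs.le]
    field_simp
  rw [h4]
  have := mul_le_mul_of_nonneg_left (h3.trans (add_le_add_right (mul_le_mul_of_nonneg_left h2
    (by norm_num : (0 : ℝ) ≤ 2)) _)) hs.le
  linarith

lemma Params.IsStandard.norm_weightedMean_sub_sq_le (hp : p.IsStandard) (hL : 0 ≤ L)
    (hdiam : ∀ x ∈ p.dom, ∀ y ∈ p.dom, ‖x - y‖ ≤ D)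
    (hlip : ∀ x ∈ p.dom, ∀ y ∈ p.dom, ‖meanGrad 𝒟 p.grad x - meanGrad 𝒟 p.grad y‖ ≤ L * ‖x - y‖)
    (n : ℕ) {S : ℝ} (hS : S = ∑ i ∈ activeHonest p.honest tr.arrival (n + 1),
      (updates tr.arrival i (n + 1) : ℝ)) (hS0 : 0 < S) :
    ‖S⁻¹ • ∑ i ∈ activeHonest p.honest tr.arrival (n + 1),
        (updates tr.arrival i (n + 1) : ℝ) • (run p tr (n + 1)).received i -
        meanGrad 𝒟 p.grad (run p tr n).x‖ ^ 2 ≤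
      2 * (‖∑ i ∈ activeHonest p.honest tr.arrival (n + 1),
        weightedNoise 𝒟 p tr (n + 1) i‖ ^ 2 / S ^ 2) +
        2 * (2 * L * D * maxDelay tr.arrival (n + 1) / (n + 1)) ^ 2 := by
  set H := activeHonest p.honest tr.arrival (n + 1) with hH
  set g := meanGrad 𝒟 p.grad (run p tr n).x
  set B := 2 * L * D * maxDelay tr.arrival (n + 1) / (n + 1) with hB
  have e : S⁻¹ • ∑ i ∈ H, (updates tr.arrival i (n + 1) : ℝ) • (run p tr (n + 1)).received i - g =
      S⁻¹ • ∑ i ∈ H, weightedNoise 𝒟 p tr (n + 1) i +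
      S⁻¹ • ∑ i ∈ H, (updates tr.arrival i (n + 1) : ℝ) • ((run p tr (n + 1)).received i - g -
        momentumNoise 𝒟 p tr (lastArrival tr.arrival i (n + 1) - 1) i) := by
    simp only [smul_sub, Finset.sum_sub_distrib, weightedNoise]
    rw [← Finset.sum_smul, ← hS, inv_smul_smul₀ hS0.ne']
    abel
  have h1 : ‖S⁻¹ • ∑ i ∈ H, (updates tr.arrival i (n + 1) : ℝ) •
      ((run p tr (n + 1)).received i - g -
        momentumNoise 𝒟 p tr (lastArrival tr.arrival i (n + 1) - 1) i)‖ ≤ B := by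
    rw [norm_smul, norm_inv, Real.norm_of_nonneg hS0.le, inv_mul_le_iff₀ hS0, hS, Finset.sum_mul]
    refine norm_sum_le_of_le _ fun i hi => ?_
    rw [norm_smul, Real.norm_of_nonneg (Nat.cast_nonneg _)]
    exact mul_le_mul_of_nonneg_left (hp.norm_received_sub_le tr hL hdiam hlip n hi)
      (Nat.cast_nonneg _)
  have h2 : ‖S⁻¹ • ∑ i ∈ H, weightedNoise 𝒟 p tr (n + 1) i‖ ^ 2 =
      ‖∑ i ∈ H, weightedNoise 𝒟 p tr (n + 1) i‖ ^ 2 / S ^ 2 := by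
    rw [norm_smul, norm_inv, Real.norm_of_nonneg hS0.le, mul_pow, inv_pow]
    field_simp
  rw [e, ← h2]
  refine (norm_add_sq_le_two_mul _ _).trans ?_
  have h3 := pow_le_pow_left₀ (norm_nonneg _) h1 2
  linarith

end DirectionError

section SecondMoment

variable {m d : ℕ} {Z Ξ Ω : Type*} [MeasurableSpace Z] [MeasurableSpace Ξ]
  [mΩ : MeasurableSpace Ω] {μ : Measure Ω} {𝒟 : Measure Z} {ν : Measure Ξ}
  {ℱ : Filtration ℕ mΩ} {X : Ω → Trace m d Z Ξ} {p : Params m d Z Ξ} {b : ℕ → Fin m}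
  [IsProbabilityMeasure 𝒟] [IsProbabilityMeasure μ] [IsProbabilityMeasure ν]
  {F : Vec d → Z → ℝ} {gradf : Vec d → Vec d} {D σ L σL κ : ℝ} {T : ℕ}

/-- Second moments of the weighted noise: `2 s σ̃²` for a worker with `s` updates, and at most
`5 t σ̃²` for the sum over any set of workers, by orthogonality. -/
lemma IsExecution.weightedNoise_moments (hX : IsExecution μ 𝒟 ν ℱ X) (hp : p.IsStandard)
    (hP : IsStochasticProblem 𝒟 p.dom F p.grad gradf D σ L σL)
    (hagg : ∀ (W : Finset (Fin m)) (s : W → ℝ),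
      Measurable (fun q : (W → Vec d) × Ξ => p.agg W q.1 s q.2))
    (hb : ∀ ω, (X ω).arrival = b) (hκ : 0 < κ) (hdelay : BoundedDelay b T κ)
    {t : ℕ} (ht : t ≤ T) (H : Finset (Fin m)) (hH : ∀ i ∈ H, 0 < updates b i t) :
    (Integrable (fun ω => ‖∑ i ∈ H, weightedNoise 𝒟 p (X ω) t i‖ ^ 2) μ ∧
      ∫ ω, ‖∑ i ∈ H, weightedNoise 𝒟 p (X ω) t i‖ ^ 2 ∂μ ≤ 5 * t * noiseLevel D σ κ σL) ∧
    ∀ j ∈ H, Integrable (fun ω => ‖weightedNoise 𝒟 p (X ω) t j‖ ^ 2) μ ∧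
      ∫ ω, ‖weightedNoise 𝒟 p (X ω) t j‖ ^ 2 ∂μ ≤ 2 * updates b j t * noiseLevel D σ κ σL := by
  have hnl := noiseLevel_nonneg D σ κ σL
  have key : ∀ (H : Finset (Fin m)) (v : ℝ), (∀ i ∈ H, 0 < updates b i t) →
      (∑ i, (if i ∈ H ∧ updates b i t = 1 then (1 : ℝ) else 0) ^ 2 +
        ∑ k ∈ Finset.Icc 1 t, (if b k ∈ H then noiseCoeff b t k else 0) ^ 2 ≤ v) →
      Integrable (fun ω => ‖∑ i ∈ H, weightedNoise 𝒟 p (X ω) t i‖ ^ 2) μ ∧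
      ∫ ω, ‖∑ i ∈ H, weightedNoise 𝒟 p (X ω) t i‖ ^ 2 ∂μ ≤ v * noiseLevel D σ κ σL := by
    intro H v hH hv
    have e : ∀ ω, ∑ i ∈ H, weightedNoise 𝒟 p (X ω) t i = noiseComb 𝒟 (X ω) p
        (fun i => if i ∈ H ∧ updates b i t = 1 then 1 else 0)
        (fun k => if b k ∈ H then noiseCoeff b t k else 0) t := by
      intro ω
      have := hp.sum_updates_smul_momentumNoise 𝒟 (X ω) t H (by rw [hb ω]; exact hH)
      rw [hb ω] at this
      rw [← this]
      simp only [weightedNoise, hb ω]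
    have hv0 : 0 ≤ v := le_trans (by positivity) hv
    simp only [e]
    refine integrable_norm_sq_of_lintegral_le
      ((hX.measurable_noiseComb hp hP.grad_measurable hagg hb _ _ t).mono
        (ℱ.le _) le_rfl).aestronglyMeasurable (by positivity) ?_
    refine (hX.lintegral_noiseComb hp hP hagg hb hκ hdelay _ _ ht).trans ?_
    exact ENNReal.ofReal_le_ofReal (mul_le_mul_of_nonneg_right hv hnl)
  refine ⟨key H _ hH (sum_noiseComb_coeff_sq_le b t H), fun j hj => ?_⟩
  have := key {j} _ (by simpa using hH j hj)
    (sum_noiseComb_coeff_sq_singleton_le b t j (hH j hj))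
  simpa only [Finset.sum_singleton] using this

set_option maxHeartbeats 1000000 in
/-- The mean squared error of the aggregated direction: robustness contributes the weighted variance
of the honest vectors, the honest mean contributes the average noise, and both contribute the bias
due to delays. -/
lemma IsExecution.lintegral_direction_sub_sq_le (hX : IsExecution μ 𝒟 ν ℱ X) (hp : p.IsStandard)
    (hP : IsStochasticProblem 𝒟 p.dom F p.grad gradf D σ L σL)
    (hagg : ∀ (W : Finset (Fin m)) (s : W → ℝ),
      Measurable (fun q : (W → Vec d) × Ξ => p.agg W q.1 s q.2))
    (hb : ∀ ω, (X ω).arrival = b) (hL : 0 ≤ L) (hκ : 0 < κ) (hdelay : BoundedDelay b T κ)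
    {c lam : ℝ} (hA : IsWeightedRobust ν p.agg c lam) (hlam : lam < 1 / 2)
    (hbyz : BoundedByzantine b p.honest T lam) {n : ℕ} (hn : n + 1 ≤ T) :
    ∫⁻ ω, ‖direction p (X ω) (n + 1) (run p (X ω) n) -
        meanGrad 𝒟 p.grad (run p (X ω) n).x‖ₑ ^ 2 ∂μ ≤
      ENNReal.ofReal (80 * (1 + c * m) * noiseLevel D σ κ σL / (n + 1) +
        16 * (1 + c) * (L * D * maxDelay b (n + 1) / (n + 1)) ^ 2) := by
  have hc := hA.1
  have hnl := noiseLevel_nonneg D σ κ σL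
  set H := activeHonest p.honest b (n + 1) with hH
  set S : ℝ := ∑ i ∈ H, (updates b i (n + 1) : ℝ) with hS
  set B : ℝ := 2 * L * D * maxDelay b (n + 1) / (n + 1) with hB
  set W : Finset (Fin m) := Finset.univ.filter (fun j => 0 < updates b j (n + 1)) with hW
  set s : W → ℝ := fun j => (updates b j (n + 1) : ℝ) with hs
  set G : Finset W := Finset.univ.filter (fun j : W => (j : Fin m) ∈ p.honest) with hG
  set g : Ω → Vec d := fun ω => meanGrad 𝒟 p.grad (run p (X ω) n).x with hg
  set rec : Ω → W → Vec d := fun ω j => (run p (X ω) (n + 1)).received j with hrec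
  have hHpos : ∀ i ∈ H, 0 < updates b i (n + 1) := fun i hi => (Finset.mem_filter.1 hi).2
  -- sums over `G` are sums over `H`
  have hGH : ∀ {M : Type} [AddCommMonoid M] (f : Fin m → M), ∑ j ∈ G, f j = ∑ i ∈ H, f i := by
    intro M _ f
    rw [hG, Finset.sum_filter, Finset.sum_coe_sort W (fun i => if i ∈ p.honest then f i else 0),
      ← Finset.sum_filter]
    congr 1
    ext i
    simp [hW, hH, activeHonest, and_comm]
  have hWsum : ∑ j, s j = ((n + 1 : ℕ) : ℝ) := by
    have e : ((n + 1 : ℕ) : ℝ) = ∑ i, (updates b i (n + 1) : ℝ) := by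
      exact_mod_cast (sum_updates_univ b (n + 1)).symm
    rw [e, hs, Finset.sum_coe_sort W (fun i => (updates b i (n + 1) : ℝ)), hW, Finset.sum_filter]
    refine Finset.sum_congr rfl fun i _ => ?_
    split_ifs with h
    · rfl
    · simp [Nat.eq_zero_of_not_pos h]
  have hGsum : ∑ j ∈ G, s j = S := hGH (fun i => (updates b i (n + 1) : ℝ))
  have hSlam : (1 - lam) * ((n + 1 : ℕ) : ℝ) ≤ S := by
    rw [hS, sum_activeHonest_updates]
    exact hbyz.le_sum_updates (Finset.mem_Icc.2 ⟨by omega, hn⟩)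
  have hShalf : ((n : ℝ) + 1) / 2 ≤ S := by
    refine le_trans ?_ hSlam
    push_cast
    nlinarith [(Nat.cast_nonneg n : (0 : ℝ) ≤ n)]
  have hS0 : 0 < S := lt_of_lt_of_le (by positivity) hShalf
  have hWne : W.Nonempty := ⟨b (n + 1), by simp [hW, updates_succ]⟩
  have hspos : ∀ j, 0 < s j := fun j => by
    exact Nat.cast_pos.2 (Finset.mem_filter.1 j.2).2
  -- measurability
  have hstate := hX.measurableState hp hP.grad_measurable hagg hb n
  have hrecm : Measurable[ℱ (n + 1)] rec := by
    refine @measurable_pi_lambda Ω W (fun _ => Vec d) (ℱ (n + 1)) _ _ fun j => ?_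
    exact @MeasurableState.received_succ m d Z Ξ Ω p b (ℱ (n + 1)) X hb n hstate
      (hX.byzMsg_meas (n + 1) (by omega)) j
  have hwm : Measurable fun x : W → Vec d => weightedMean G s x := by
    unfold weightedMean; fun_prop
  have hdir : ∀ ω, direction p (X ω) (n + 1) (run p (X ω) n) =
      p.agg W (rec ω) s ((X ω).seed (n + 1)) := fun ω => by rw [direction_eq, hb ω]
  have hdirm : Measurable fun ω => p.agg W (rec ω) s ((X ω).seed (n + 1)) :=
    (hagg W s).comp ((hrecm.mono (ℱ.le _) le_rfl).prodMk
      ((hX.seed_meas (by omega)).mono (ℱ.le _) le_rfl))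
  have hmeanm : Measurable fun ω => weightedMean G s (rec ω) :=
    hwm.comp (hrecm.mono (ℱ.le _) le_rfl)
  -- the robustness bound, integrated over the seed
  have hrob : ∫⁻ ω, ‖p.agg W (rec ω) s ((X ω).seed (n + 1)) - weightedMean G s (rec ω)‖ₑ ^ 2 ∂μ ≤
      ∫⁻ ω, ENNReal.ofReal (c * ((∑ j ∈ G, s j * ‖rec ω j - g ω‖ ^ 2) / ∑ j ∈ G, s j)) ∂μ := by
    have hmeas : Measurable (Function.uncurry fun (x : W → Vec d) (ξ : Ξ) =>
        ‖p.agg W x s ξ - weightedMean G s x‖ₑ ^ 2) :=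
      ((hagg W s).sub (hwm.comp measurable_fst)).enorm.pow_const 2
    rw [lintegral_comp_fresh (ℱ.le (n + 1)) hrecm
      ((hX.seed_meas (t := n + 1) (by omega)).mono (ℱ.le _) le_rfl) (hX.seed_law (by omega))
      (hX.seed_indep (by omega)) hmeas]
    refine lintegral_mono fun ω => ?_
    refine hA.lintegral_sub_sq_le hagg hWne hspos G ?_ (rec ω) (g ω)
    rw [hWsum, hGsum]
    exact hSlam
  -- pointwise bounds in terms of the noise
  set N : Ω → Fin m → Vec d := fun ω i => weightedNoise 𝒟 p (X ω) (n + 1) i with hN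
  have hp1 : ∀ ω, (∑ j ∈ G, s j * ‖rec ω j - g ω‖ ^ 2) / ∑ j ∈ G, s j ≤
      2 / S * ∑ i ∈ H, ‖N ω i‖ ^ 2 / updates b i (n + 1) + 2 * B ^ 2 := by
    intro ω
    have e : ∑ j ∈ G, s j * ‖rec ω j - g ω‖ ^ 2 = ∑ i ∈ H, (updates b i (n + 1) : ℝ) *
        ‖(run p (X ω) (n + 1)).received i - g ω‖ ^ 2 :=
      hGH fun i => (updates b i (n + 1) : ℝ) * ‖(run p (X ω) (n + 1)).received i - g ω‖ ^ 2
    rw [hGsum, e, div_le_iff₀ hS0]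
    have e2 : (2 / S * ∑ i ∈ H, ‖N ω i‖ ^ 2 / updates b i (n + 1) + 2 * B ^ 2) * S =
        ∑ i ∈ H, (2 * (‖N ω i‖ ^ 2 / updates b i (n + 1)) + 2 * updates b i (n + 1) * B ^ 2) := by
      rw [Finset.sum_add_distrib, ← Finset.mul_sum, ← Finset.sum_mul, ← Finset.mul_sum, ← hS]
      field_simp
    rw [e2]
    refine Finset.sum_le_sum fun i hi => ?_
    have := hp.updates_mul_norm_received_sub_sq_le (𝒟 := 𝒟) (X ω) hL hP.diameter
      (fun x hx y hy => hP.norm_meanGrad_sub_le hx hy) n (i := i) (by rw [hb ω]; exact hi)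
    rw [hb ω] at this
    exact this
  have hp2 : ∀ ω, ‖weightedMean G s (rec ω) - g ω‖ ^ 2 ≤
      2 * (‖∑ i ∈ H, N ω i‖ ^ 2 / S ^ 2) + 2 * B ^ 2 := by
    intro ω
    have := hp.norm_weightedMean_sub_sq_le (𝒟 := 𝒟) (X ω) hL hP.diameter
      (fun x hx y hy => hP.norm_meanGrad_sub_le hx hy) n (S := S) (by rw [hb ω]) hS0
    rw [hb ω] at this
    rw [weightedMean, hGsum]
    have e : ∑ j ∈ G, s j • rec ω j =
        ∑ i ∈ H, (updates b i (n + 1) : ℝ) • (run p (X ω) (n + 1)).received i :=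
      hGH fun i => (updates b i (n + 1) : ℝ) • (run p (X ω) (n + 1)).received i
    rw [e]
    exact this
  obtain ⟨⟨hi1, hi2⟩, hi3⟩ := hX.weightedNoise_moments hp hP hagg hb hκ hdelay hn H hHpos
  have hs0 : ∀ i ∈ H, (0 : ℝ) < updates b i (n + 1) := fun i hi => by exact_mod_cast hHpos i hi
  -- the means of the robustness error and of the error of the honest mean
  have hPint : Integrable (fun ω => c * (2 / S * ∑ i ∈ H, ‖N ω i‖ ^ 2 / updates b i (n + 1) +
      2 * B ^ 2)) μ :=
    (((integrable_finsetSum H fun i hi => (hi3 i hi).1.div_const _).const_mul _).add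
      (integrable_const _)).const_mul c
  have hPle : ∫ ω, c * (2 / S * ∑ i ∈ H, ‖N ω i‖ ^ 2 / updates b i (n + 1) + 2 * B ^ 2) ∂μ ≤
      c * (2 / S * (m * (2 * noiseLevel D σ κ σL)) + 2 * B ^ 2) := by
    rw [integral_const_mul, integral_add ((integrable_finsetSum H fun i hi =>
      (hi3 i hi).1.div_const _).const_mul _) (integrable_const _), integral_const_mul,
      integral_finsetSum _ fun i hi => (hi3 i hi).1.div_const _, integral_const, probReal_univ,
      one_smul]
    gcongr
    calc _ ≤ ∑ i ∈ H, 2 * noiseLevel D σ κ σL := Finset.sum_le_sum fun i hi => by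
          rw [integral_div, div_le_iff₀ (hs0 i hi)]
          exact (hi3 i hi).2.trans_eq (by ring)
      _ = H.card * (2 * noiseLevel D σ κ σL) := by rw [Finset.sum_const, nsmul_eq_mul]
      _ ≤ m * (2 * noiseLevel D σ κ σL) := by
          gcongr
          simpa using Finset.card_le_univ H
  have hQint : Integrable (fun ω => 2 * (‖∑ i ∈ H, N ω i‖ ^ 2 / S ^ 2) + 2 * B ^ 2) μ :=
    ((hi1.div_const _).const_mul 2).add (integrable_const _)
  have hQle : ∫ ω, (2 * (‖∑ i ∈ H, N ω i‖ ^ 2 / S ^ 2) + 2 * B ^ 2) ∂μ ≤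
      2 * (5 * ((n : ℝ) + 1) * noiseLevel D σ κ σL / S ^ 2) + 2 * B ^ 2 := by
    rw [integral_add ((hi1.div_const _).const_mul 2) (integrable_const _), integral_const_mul,
      integral_div, integral_const, probReal_univ, one_smul]
    push_cast at hi2
    gcongr
  have h1 : ∀ ω, ‖direction p (X ω) (n + 1) (run p (X ω) n) - g ω‖ₑ ^ 2 ≤
      ENNReal.ofReal 2 *
        ‖p.agg W (rec ω) s ((X ω).seed (n + 1)) - weightedMean G s (rec ω)‖ₑ ^ 2 +
      ENNReal.ofReal 2 * ENNReal.ofReal (2 * (‖∑ i ∈ H, N ω i‖ ^ 2 / S ^ 2) + 2 * B ^ 2) := by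
    intro ω
    rw [hdir, ← sub_add_sub_cancel _ (weightedMean G s (rec ω)) (g ω),
      enorm_sq_eq_ofReal, enorm_sq_eq_ofReal, ← ENNReal.ofReal_mul (by norm_num),
      ← ENNReal.ofReal_mul (by norm_num), ← ENNReal.ofReal_add (by positivity) (by positivity)]
    refine ENNReal.ofReal_le_ofReal ((norm_add_sq_le_two_mul _ _).trans ?_)
    linarith [hp2 ω]
  have hm1 : Measurable fun ω => ENNReal.ofReal 2 *
      ‖p.agg W (rec ω) s ((X ω).seed (n + 1)) - weightedMean G s (rec ω)‖ₑ ^ 2 :=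
    ((hdirm.sub hmeanm).enorm.pow_const 2).const_mul _
  refine (lintegral_mono h1).trans ?_
  rw [lintegral_add_left hm1, lintegral_const_mul' _ _ ENNReal.ofReal_ne_top,
    lintegral_const_mul' _ _ ENNReal.ofReal_ne_top]
  have h2 := hrob.trans (lintegral_mono fun ω => ENNReal.ofReal_le_ofReal
    (mul_le_mul_of_nonneg_left (hp1 ω) hc))
  rw [← ofReal_integral_eq_lintegral_ofReal hPint (.of_forall fun ω => by positivity)] at h2
  rw [← ofReal_integral_eq_lintegral_ofReal hQint (.of_forall fun ω => by positivity)]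
  refine (add_le_add (mul_le_mul_right (h2.trans (ENNReal.ofReal_le_ofReal hPle)) _)
    (mul_le_mul_right (ENNReal.ofReal_le_ofReal hQle) _)).trans ?_
  rw [← ENNReal.ofReal_mul (by norm_num), ← ENNReal.ofReal_mul (by norm_num),
    ← ENNReal.ofReal_add (by positivity) (by positivity)]
  refine ENNReal.ofReal_le_ofReal ?_
  clear_value N
  have ht : (0 : ℝ) < (n : ℝ) + 1 := by positivity
  have hSinv : 1 / S ≤ 2 / ((n : ℝ) + 1) := by
    rw [div_le_div_iff₀ hS0 ht]; linarith
  have hSinv2 : ((n : ℝ) + 1) / S ^ 2 ≤ 4 / ((n : ℝ) + 1) := by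
    rw [div_le_div_iff₀ (by positivity) ht]
    nlinarith
  have hBB : 16 * (1 + c) * (L * D * maxDelay b (n + 1) / ((n : ℝ) + 1)) ^ 2 =
      (4 * c + 4) * B ^ 2 := by rw [hB]; ring
  rw [hBB]
  have e1 : 8 * c * m * noiseLevel D σ κ σL * (1 / S) ≤
      8 * c * m * noiseLevel D σ κ σL * (2 / ((n : ℝ) + 1)) :=
    mul_le_mul_of_nonneg_left hSinv (by positivity)
  have e2 : 20 * noiseLevel D σ κ σL * (((n : ℝ) + 1) / S ^ 2) ≤
      20 * noiseLevel D σ κ σL * (4 / ((n : ℝ) + 1)) :=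
    mul_le_mul_of_nonneg_left hSinv2 (by positivity)
  have e3 : 0 ≤ 64 * c * m * noiseLevel D σ κ σL * (1 / ((n : ℝ) + 1)) := by positivity
  have e4 : 2 * (c * (2 / S * (m * (2 * noiseLevel D σ κ σL)) + 2 * B ^ 2)) +
      2 * (2 * (5 * ((n : ℝ) + 1) * noiseLevel D σ κ σL / S ^ 2) + 2 * B ^ 2) =
      8 * c * m * noiseLevel D σ κ σL * (1 / S) +
      20 * noiseLevel D σ κ σL * (((n : ℝ) + 1) / S ^ 2) + (4 * c + 4) * B ^ 2 := by ring
  have e5 : 80 * (1 + c * m) * noiseLevel D σ κ σL / ((n : ℝ) + 1) =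
      8 * c * m * noiseLevel D σ κ σL * (2 / ((n : ℝ) + 1)) +
      20 * noiseLevel D σ κ σL * (4 / ((n : ℝ) + 1)) +
      64 * c * m * noiseLevel D σ κ σL * (1 / ((n : ℝ) + 1)) := by ring
  rw [e4, e5]
  linarith

end SecondMoment

/-! ### Expected excess loss -/

section ExpectedExcess

lemma measurable_comp_of_continuousOn {α β : Type*} [MeasurableSpace α] [TopologicalSpace β]
    [MeasurableSpace β] [BorelSpace β] {K : Set β} {f : β → ℝ} (hf : ContinuousOn f K)
    {Y : α → β} (hY : Measurable Y) (hmem : ∀ x, Y x ∈ K) :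
    Measurable fun x => f (Y x) :=
  (continuousOn_iff_continuous_domRestrict.1 hf).measurable.comp (hY.subtype_mk (h := hmem))

variable {m d : ℕ} {Z Ξ Ω : Type*} [MeasurableSpace Z] {𝒟 : Measure Z}
  {p : Params m d Z Ξ} {F : Vec d → Z → ℝ} {gradf : Vec d → Vec d} {D σ L σL κ : ℝ} {T : ℕ}

lemma IsStochasticProblem.continuousOn_expLoss {dom : Set (Vec d)} {grad : Vec d → Z → Vec d}
    (hP : IsStochasticProblem 𝒟 dom F grad gradf D σ L σL) : ContinuousOn (expLoss 𝒟 F) dom :=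
  fun x hx => (hP.grad_expLoss x hx).hasFDerivWithinAt.continuousWithinAt

variable [MeasurableSpace Ω] {μ : Measure Ω} [IsFiniteMeasure μ] {X : Ω → Trace m d Z Ξ}

lemma integrable_excess (hp : p.IsStandard)
    (hP : IsStochasticProblem 𝒟 p.dom F p.grad gradf D σ L σL) (xstar : Vec d)
    (hX : Measurable fun ω => excess 𝒟 F p T xstar (X ω)) :
    Integrable (fun ω => excess 𝒟 F p T xstar (X ω)) μ := by
  obtain ⟨C, hC⟩ := hP.compact.exists_bound_of_continuousOn hP.continuousOn_expLoss
  refine Integrable.of_bound hX.aestronglyMeasurable (C + ‖expLoss 𝒟 F xstar‖)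
    (.of_forall fun ω => ?_)
  exact (norm_sub_le _ _).trans (add_le_add_left (hC _ (hp.run_x_mem (X ω) (T - 1))) _)

end ExpectedExcess

section Deterministic

variable {m d : ℕ} {Z Ξ Ω : Type*} [MeasurableSpace Z] [MeasurableSpace Ξ]
  [mΩ : MeasurableSpace Ω] {μ : Measure Ω} {𝒟 : Measure Z} {ν : Measure Ξ}
  {ℱ : Filtration ℕ mΩ} {X : Ω → Trace m d Z Ξ} {p : Params m d Z Ξ} {b : ℕ → Fin m}
  {F : Vec d → Z → ℝ} {gradf : Vec d → Vec d} {D σ L σL κ : ℝ} {T : ℕ}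

lemma IsExecution.measurable_excess [SFinite 𝒟] (hX : IsExecution μ 𝒟 ν ℱ X) (hp : p.IsStandard)
    (hP : IsStochasticProblem 𝒟 p.dom F p.grad gradf D σ L σL)
    (hagg : ∀ (W : Finset (Fin m)) (s : W → ℝ),
      Measurable (fun q : (W → Vec d) × Ξ => p.agg W q.1 s q.2))
    (hb : ∀ ω, (X ω).arrival = b) (T : ℕ) (xstar : Vec d) :
    Measurable fun ω => excess 𝒟 F p T xstar (X ω) :=
  (measurable_comp_of_continuousOn hP.continuousOn_expLoss
    ((hX.measurableState hp hP.grad_measurable hagg hb (T - 1)).x.mono (ℱ.le _) le_rfl)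
    (fun ω => hp.run_x_mem (X ω) (T - 1))).sub measurable_const

variable [IsProbabilityMeasure 𝒟] [IsProbabilityMeasure μ] [IsProbabilityMeasure ν]

lemma IsExecution.integral_norm_direction_sub_le (hX : IsExecution μ 𝒟 ν ℱ X) (hp : p.IsStandard)
    (hP : IsStochasticProblem 𝒟 p.dom F p.grad gradf D σ L σL)
    (hagg : ∀ (W : Finset (Fin m)) (s : W → ℝ),
      Measurable (fun q : (W → Vec d) × Ξ => p.agg W q.1 s q.2))
    (hb : ∀ ω, (X ω).arrival = b) (hL : 0 ≤ L) (hκ : 0 < κ) (hdelay : BoundedDelay b T κ)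
    {c lam : ℝ} (hA : IsWeightedRobust ν p.agg c lam) (hlam : lam < 1 / 2)
    (hbyz : BoundedByzantine b p.honest T lam) {n : ℕ} (hn : n + 1 ≤ T) :
    Integrable (fun ω => ‖direction p (X ω) (n + 1) (run p (X ω) n) -
        meanGrad 𝒟 p.grad (run p (X ω) n).x‖) μ ∧
      ((n : ℝ) + 1) * ∫ ω, ‖direction p (X ω) (n + 1) (run p (X ω) n) -
        meanGrad 𝒟 p.grad (run p (X ω) n).x‖ ∂μ ≤
      9 * Real.sqrt (noiseLevel D σ κ σL) * Real.sqrt (1 + c * m) * Real.sqrt T +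
        4 * Real.sqrt (1 + c) * (L * D * maxDelay b (n + 1)) := by
  have hD : 0 ≤ D := (norm_nonneg _).trans (hP.diameter _ hp.start_mem _ hp.start_mem)
  have hc := hA.1
  have hnl := noiseLevel_nonneg D σ κ σL
  have ht : (0 : ℝ) < (n : ℝ) + 1 := by positivity
  have hstate := hX.measurableState hp hP.grad_measurable hagg hb n
  have hdirm : Measurable fun ω => direction p (X ω) (n + 1) (run p (X ω) n) :=
    measurable_direction hagg hb n
      (fun i => ((hX.measurableState hp hP.grad_measurable hagg hb (n + 1)).received i).mono
        (ℱ.le _) le_rfl) ((hX.seed_meas (by omega)).mono (ℱ.le _) le_rfl)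
  have hgm : Measurable fun ω => meanGrad 𝒟 p.grad (run p (X ω) n).x :=
    (measurable_meanGrad hP.grad_measurable).comp (hstate.x.mono (ℱ.le _) le_rfl)
  set u := 9 * Real.sqrt (noiseLevel D σ κ σL) * Real.sqrt (1 + c * m) / Real.sqrt (n + 1) with hu
  set v := 4 * Real.sqrt (1 + c) * (L * D * maxDelay b (n + 1) / (n + 1)) with hv
  have hu0 : 0 ≤ u := by positivity
  have hv0 : 0 ≤ v := by positivity
  have hle : 80 * (1 + c * m) * noiseLevel D σ κ σL / (n + 1) +
      16 * (1 + c) * (L * D * maxDelay b (n + 1) / (n + 1)) ^ 2 ≤ (u + v) ^ 2 := by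
    have e1 : u ^ 2 = 81 * (1 + c * m) * noiseLevel D σ κ σL / (n + 1) := by
      rw [hu, div_pow, mul_pow, mul_pow, Real.sq_sqrt hnl, Real.sq_sqrt (by positivity),
        Real.sq_sqrt ht.le]
      ring
    have e2 : v ^ 2 = 16 * (1 + c) * (L * D * maxDelay b (n + 1) / (n + 1)) ^ 2 := by
      rw [hv, mul_pow, mul_pow, Real.sq_sqrt (by positivity)]
      ring
    have e3 : 80 * (1 + c * m) * noiseLevel D σ κ σL / (n + 1) ≤ u ^ 2 := by
      rw [e1]
      gcongr
      norm_num
    rw [← e2, add_sq]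
    linarith [mul_nonneg hu0 hv0]
  obtain ⟨h1, h2⟩ := integral_norm_le_of_lintegral_sq_le (μ := μ)
    (hdirm.sub hgm).aestronglyMeasurable (b := u + v) (by positivity)
    ((hX.lintegral_direction_sub_sq_le hp hP hagg hb hL hκ hdelay hA hlam hbyz hn).trans
      (ENNReal.ofReal_le_ofReal hle))
  refine ⟨h1, (mul_le_mul_of_nonneg_left h2 ht.le).trans ?_⟩
  have e1 : ((n : ℝ) + 1) * u = 9 * Real.sqrt (noiseLevel D σ κ σL) * Real.sqrt (1 + c * m) *
      Real.sqrt (n + 1) := by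
    rw [hu, mul_div_assoc']
    rw [div_eq_iff (by positivity)]
    linear_combination (-9 * Real.sqrt (noiseLevel D σ κ σL) * Real.sqrt (1 + c * m)) *
      Real.mul_self_sqrt ht.le
  have e2 : ((n : ℝ) + 1) * v = 4 * Real.sqrt (1 + c) * (L * D * maxDelay b (n + 1)) := by
    rw [hv]; field_simp
  have e3 : Real.sqrt ((n : ℝ) + 1) ≤ Real.sqrt T := Real.sqrt_le_sqrt (by exact_mod_cast hn)
  rw [mul_add, e1, e2]
  gcongr

/-- The convergence rate for a deterministic schedule. The drift term `L D² / T` of the regret is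
absorbed by the delay term, as the average maximal delay is at least `1`. -/
lemma IsExecution.integral_excess_le (hX : IsExecution μ 𝒟 ν ℱ X) (hp : p.IsStandard)
    (hP : IsStochasticProblem 𝒟 p.dom F p.grad gradf D σ L σL)
    (hagg : ∀ (W : Finset (Fin m)) (s : W → ℝ),
      Measurable (fun q : (W → Vec d) × Ξ => p.agg W q.1 s q.2))
    (hb : ∀ ω, (X ω).arrival = b) (hL : 0 ≤ L) (hκ : 0 < κ) (hdelay : BoundedDelay b T κ)
    {c lam : ℝ} (hA : IsWeightedRobust ν p.agg c lam) (hlam : lam < 1 / 2)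
    (hbyz : BoundedByzantine b p.honest T lam) (hη : 0 < p.η) (hT : 1 ≤ T)
    {xstar : Vec d} (hxs : xstar ∈ p.dom) :
    ∫ ω, excess 𝒟 F p T xstar (X ω) ∂μ ≤
      D ^ 2 / (p.η * T ^ 2) + 20 * rate b T ‖gradf xstar‖ D σ L σL κ c := by
  obtain ⟨N, rfl⟩ : ∃ N, T = N + 1 := ⟨T - 1, by omega⟩
  have hD : 0 ≤ D := (norm_nonneg _).trans (hP.diameter _ hp.start_mem _ hp.start_mem)
  have hc := hA.1
  have hnl := noiseLevel_nonneg D σ κ σL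
  set T : ℝ := ((N + 1 : ℕ) : ℝ) with hTdef
  have hT0 : 0 < T := by rw [hTdef]; positivity
  have hT' : T = (N : ℝ) + 1 := by rw [hTdef]; push_cast; rfl
  set G := ‖gradf xstar‖ with hG
  set M := avgMaxDelay b (N + 1) with hM
  have hM1 : 1 ≤ M := one_le_avgMaxDelay b hT
  set Q := Real.sqrt (noiseLevel D σ κ σL) * Real.sqrt (1 + c * m) with hQ
  have hQ0 : 0 ≤ Q := by positivity
  set R := Real.sqrt (1 + c) with hR
  have hR1 : 1 ≤ R := by rw [hR]; exact Real.one_le_sqrt.2 (by linarith)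
  have hint := fun n (hn : n ∈ Finset.range (N + 1)) =>
    hX.integral_norm_direction_sub_le hp hP hagg hb hL hκ hdelay hA hlam hbyz
      (n := n) (Finset.mem_range.1 hn)
  -- the regret bound, averaged
  have h1 : T * (T + 1) / 2 * ∫ ω, excess 𝒟 F p (N + 1) xstar (X ω) ∂μ ≤
      D ^ 2 / (2 * p.η) + T * (2 * G * D + 4 * L * D ^ 2) +
        D * ∑ n ∈ Finset.range (N + 1), ((n : ℝ) + 1) *
          ∫ ω, ‖direction p (X ω) (n + 1) (run p (X ω) n) -
            meanGrad 𝒟 p.grad (run p (X ω) n).x‖ ∂μ := by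
    have hsum : Integrable (fun ω => ∑ n ∈ Finset.range (N + 1), ((n : ℝ) + 1) *
        ‖direction p (X ω) (n + 1) (run p (X ω) n) -
          meanGrad 𝒟 p.grad (run p (X ω) n).x‖) μ :=
      integrable_finsetSum _ fun n hn => (hint n hn).1.const_mul _
    have e : D ^ 2 / (2 * p.η) + T * (2 * G * D + 4 * L * D ^ 2) +
        D * ∑ n ∈ Finset.range (N + 1), ((n : ℝ) + 1) *
          ∫ ω, ‖direction p (X ω) (n + 1) (run p (X ω) n) -
            meanGrad 𝒟 p.grad (run p (X ω) n).x‖ ∂μ =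
        ∫ ω, (D ^ 2 / (2 * p.η) + T * (2 * G * D + 4 * L * D ^ 2) +
          D * ∑ n ∈ Finset.range (N + 1), ((n : ℝ) + 1) *
            ‖direction p (X ω) (n + 1) (run p (X ω) n) -
              meanGrad 𝒟 p.grad (run p (X ω) n).x‖) ∂μ := by
      rw [integral_add (integrable_const _) (hsum.const_mul D), integral_const, probReal_univ,
        one_smul, integral_const_mul, integral_finsetSum _ fun n hn => (hint n hn).1.const_mul _]
      simp only [integral_const_mul]
    rw [e, ← integral_const_mul]
    refine integral_mono ((integrable_excess hp hP xstar
      (hX.measurable_excess hp hP hagg hb _ xstar)).const_mul _)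
      ((integrable_const _).add (hsum.const_mul D)) fun ω => ?_
    have h := hp.excess_le (X ω) (f := expLoss 𝒟 F) (g := meanGrad 𝒟 p.grad) (G := G) hL hη
      hP.diameter (fun x hx y hy => ?_) (fun x hx y hy => hP.norm_meanGrad_sub_le hx hy) hxs
      (by rw [hP.meanGrad_eq hxs]) N
    · rw [hT']
      have e2 : ((N : ℝ) + 1) * (N + 1 + 1) / 2 = (N + 1) * (N + 2) / 2 := by ring
      simp only
      rw [e2]
      exact h
    · rw [hP.meanGrad_eq hx]
      exact add_inner_gradientWithin_le hP.loss_convex hx hy (hP.grad_expLoss x hx)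
  have h2 : ∑ n ∈ Finset.range (N + 1), ((n : ℝ) + 1) *
      ∫ ω, ‖direction p (X ω) (n + 1) (run p (X ω) n) -
        meanGrad 𝒟 p.grad (run p (X ω) n).x‖ ∂μ ≤
      T * (9 * Q * Real.sqrt T) + 4 * R * (L * D) * (T * M) := by
    have hsumM : T * M = ∑ n ∈ Finset.range (N + 1), (maxDelay b (n + 1) : ℝ) := by
      rw [hM, avgMaxDelay, mul_div_cancel₀ _ hT0.ne', Finset.range_eq_Ico,
        Finset.sum_Ico_add' (fun n => (maxDelay b n : ℝ)) 0 (N + 1) 1]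
      rfl
    calc _ ≤ ∑ n ∈ Finset.range (N + 1),
          (9 * Q * Real.sqrt T + 4 * R * (L * D) * maxDelay b (n + 1)) :=
          Finset.sum_le_sum fun n hn => (hint n hn).2.trans_eq (by rw [hQ]; ring)
      _ = _ := by
        rw [Finset.sum_add_distrib, Finset.sum_const, Finset.card_range, nsmul_eq_mul,
          ← Finset.mul_sum, ← hsumM]
  have h3 : T * (T + 1) / 2 * ∫ ω, excess 𝒟 F p (N + 1) xstar (X ω) ∂μ ≤
      D ^ 2 / (2 * p.η) + T * (2 * G * D + 4 * L * D ^ 2) +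
        D * (T * (9 * Q * Real.sqrt T) + 4 * R * (L * D) * (T * M)) :=
    h1.trans (add_le_add_right (mul_le_mul_of_nonneg_left h2 hD) _)
  have hG0 : 0 ≤ G := norm_nonneg _
  set S := Real.sqrt T with hS
  have hS0 : 0 < S := Real.sqrt_pos.2 hT0
  have hSS : S * S = T := Real.mul_self_sqrt hT0.le
  have hMR : 1 ≤ M * R := one_le_mul_of_one_le_of_one_le hM1 hR1
  have h4 : T * (T + 1) / 2 * ∫ ω, excess 𝒟 F p (N + 1) xstar (X ω) ∂μ ≤
      T * T / 2 * (D ^ 2 / (p.η * T ^ 2) +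
        20 * ((G * D + L * D ^ 2 * M * R) / T + D * Q / S)) := by
    refine h3.trans ?_
    have e1 : T * T / 2 * (D ^ 2 / (p.η * T ^ 2) +
        20 * ((G * D + L * D ^ 2 * M * R) / T + D * Q / S)) =
        D ^ 2 / (2 * p.η) + T * (10 * G * D + 10 * L * D ^ 2 * (M * R)) + 10 * D * Q * (T * S) := by
      have e2 : T * T / S = T * S := by
        rw [div_eq_iff hS0.ne']; linear_combination (-T) * hSS
      have e3 : T * T / 2 * (D ^ 2 / (p.η * T ^ 2)) = D ^ 2 / (2 * p.η) := by field_simp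
      have e4 : T * T / 2 * (20 * ((G * D + L * D ^ 2 * M * R) / T)) =
          T * (10 * G * D + 10 * L * D ^ 2 * (M * R)) := by field_simp; ring
      rw [mul_add, mul_add 20, mul_add (T * T / 2), e3, e4]
      linear_combination (10 * D * Q) * e2
    rw [e1]
    have e5 : T * (4 * L * D ^ 2) ≤ T * (4 * L * D ^ 2) * (M * R) :=
      le_mul_of_one_le_right (by positivity) hMR
    have e6 : 0 ≤ T * (8 * G * D) := by positivity
    have e7 : 0 ≤ D * Q * (T * S) := by positivity
    have e8 : 0 ≤ T * (2 * L * D ^ 2) * (M * R) := by positivity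
    linarith
  have e : rate b (N + 1) G D σ L σL κ c = (G * D + L * D ^ 2 * M * R) / T + D * Q / S := by
    rw [rate, hQ, noiseLevel]
    simp only [← mul_assoc]
    rfl
  rw [e]
  have hX0 : 0 ≤ D ^ 2 / (p.η * T ^ 2) +
        20 * ((G * D + L * D ^ 2 * M * R) / T + D * Q / S) := by positivity
  refine le_of_mul_le_mul_left (h4.trans ?_) (by positivity : 0 < T * (T + 1) / 2)
  exact mul_le_mul_of_nonneg_right (by nlinarith) hX0

end Deterministic

/-! ### Conditioning on the schedule -/

section Conditioning

variable {Ω α : Type*} {m₀ : MeasurableSpace Ω} [mΩ : MeasurableSpace Ω] [MeasurableSpace α]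
  {μ : Measure Ω}

lemma map_cond_of_indep [IsFiniteMeasure μ] (hm : m₀ ≤ mΩ) {Y : Ω → α} (hY : Measurable Y)
    (hind : Indep (MeasurableSpace.comap Y inferInstance) m₀ μ) {B : Set Ω}
    (hB : MeasurableSet[m₀] B) (hB0 : μ B ≠ 0) : (cond μ B).map Y = μ.map Y := by
  ext E hE
  rw [Measure.map_apply hY hE, Measure.map_apply hY hE, cond_apply (hm B hB), Set.inter_comm,
    (Indep_iff _ _ _).1 hind _ _ ⟨E, hE, rfl⟩ hB, mul_comm, mul_assoc,
    ENNReal.mul_inv_cancel hB0 (measure_ne_top μ B), mul_one]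

lemma indep_cond [IsFiniteMeasure μ] {m₁ : MeasurableSpace Ω} (hm : m₀ ≤ mΩ) (hind : Indep m₁ m₀ μ) {B : Set Ω}
    (hB : MeasurableSet[m₀] B) (hB0 : μ B ≠ 0) : Indep m₁ m₀ (cond μ B) := by
  rw [Indep_iff]
  intro s t hs ht
  have hi := (Indep_iff _ _ _).1 hind
  have e1 : B ∩ (s ∩ t) = s ∩ (B ∩ t) := by
    ext x; simp only [Set.mem_inter_iff]; tauto
  rw [cond_apply (hm B hB), cond_apply (hm B hB), cond_apply (hm B hB), e1,
    hi s _ hs (MeasurableSet.inter hB ht), Set.inter_comm B s, hi s _ hs hB]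
  calc (μ B)⁻¹ * (μ s * μ (B ∩ t)) = μ s * 1 * ((μ B)⁻¹ * μ (B ∩ t)) := by ring
    _ = μ s * ((μ B)⁻¹ * μ B) * ((μ B)⁻¹ * μ (B ∩ t)) := by
      rw [ENNReal.inv_mul_cancel hB0 (measure_ne_top μ B)]
    _ = _ := by ring

lemma condExp_le_of_forall_setIntegral_le [IsFiniteMeasure μ] (hm : m₀ ≤ mΩ) {f g : Ω → ℝ} (hf : Integrable f μ)
    (hg : Integrable g μ) (hgm : StronglyMeasurable[m₀] g)
    (h : ∀ s, MeasurableSet[m₀] s → ∫ ω in s, f ω ∂μ ≤ ∫ ω in s, g ω ∂μ) :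
    μ[f | m₀] ≤ᵐ[μ] g := by
  refine ae_le_of_ae_le_trim (hm := hm) ?_
  refine ae_le_of_forall_setIntegral_le (integrable_condExp.trim hm stronglyMeasurable_condExp)
    (hg.trim hm hgm) fun s hs _ => ?_
  rw [← setIntegral_trim hm stronglyMeasurable_condExp hs, ← setIntegral_trim hm hgm hs,
    setIntegral_condExp hm hf hs]
  exact h s hs

lemma setIntegral_le_of_forall_fiber {V : Type*} [Finite V] [MeasurableSpace V]
    [MeasurableSingletonClass V] {φ : Ω → V} (hφ : Measurable φ) {f g : Ω → ℝ}
    (hf : Integrable f μ) (hg : Integrable g μ) {s : Set Ω} (hs : MeasurableSet s)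
    (h : ∀ v, ∫ ω in s ∩ φ ⁻¹' {v}, f ω ∂μ ≤ ∫ ω in s ∩ φ ⁻¹' {v}, g ω ∂μ) :
    ∫ ω in s, f ω ∂μ ≤ ∫ ω in s, g ω ∂μ := by
  have := Fintype.ofFinite V
  have e : s = ⋃ v, s ∩ φ ⁻¹' {v} := by ext x; simp
  have hmeas : ∀ v, MeasurableSet (s ∩ φ ⁻¹' {v}) := fun v =>
    hs.inter (hφ (measurableSet_singleton v))
  have hdisj : Pairwise (Function.onFun Disjoint fun v => s ∩ φ ⁻¹' {v}) := fun v v' hv =>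
    Set.disjoint_left.2 fun x hx hx' => hv (hx.2.symm.trans hx'.2)
  rw [e, integral_iUnion_fintype hmeas hdisj fun _ => hf.integrableOn,
    integral_iUnion_fintype hmeas hdisj fun _ => hg.integrableOn]
  exact Finset.sum_le_sum fun v _ => h v

end Conditioning

section ScheduleConditioning

variable {m d : ℕ} {Z Ξ Ω : Type*}

/-- The trace with the arrival schedule replaced by `b`. -/
def Trace.withArrival (tr : Trace m d Z Ξ) (b : ℕ → Fin m) : Trace m d Z Ξ :=
  { tr with arrival := b }

lemma step_withArrival (p : Params m d Z Ξ) (tr : Trace m d Z Ξ) {b : ℕ → Fin m} {t : ℕ}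
    (h : b t = tr.arrival t) (S : State m d) :
    step p (tr.withArrival b) t S = step p tr t S := by
  have key : ∀ i, i = tr.arrival t → step p (tr.withArrival fun _ => i) t S = step p tr t S := by
    rintro _ rfl; rfl
  exact key _ h

lemma run_withArrival (p : Params m d Z Ξ) (tr : Trace m d Z Ξ) {b : ℕ → Fin m} {T : ℕ}
    (h : ∀ k ∈ Finset.Icc 1 T, tr.arrival k = b k) {n : ℕ} (hn : n ≤ T) :
    run p (tr.withArrival b) n = run p tr n := by
  induction n with
  | zero => rfl
  | succ n ih =>
    rw [run, run, ih (by omega),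
      step_withArrival p tr (h (n + 1) (Finset.mem_Icc.2 ⟨by omega, hn⟩)).symm]

variable {X : Ω → Trace m d Z Ξ} {T : ℕ}

/-- The arrivals up to iteration `T`. Unlike the whole schedule, they take finitely many values. -/
def arrivalsUpTo (X : Ω → Trace m d Z Ξ) (T : ℕ) (ω : Ω) (k : Finset.Icc 1 T) : Fin m :=
  (X ω).arrival k

lemma measurable_arrivalsUpTo (X : Ω → Trace m d Z Ξ) (T : ℕ) :
    Measurable[scheduleAlgebra X] (arrivalsUpTo X T) := by
  refine @measurable_pi_lambda Ω _ _ (scheduleAlgebra X) _ _ fun k => ?_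
  exact (measurable_pi_apply (k : ℕ)).comp (comap_measurable _)

lemma arrivalsUpTo_eq {ω ω' : Ω} (h : arrivalsUpTo X T ω = arrivalsUpTo X T ω') :
    ∀ k ∈ Finset.Icc 1 T, (X ω).arrival k = (X ω').arrival k :=
  fun k hk => congrFun h ⟨k, hk⟩

lemma excess_withArrival [MeasurableSpace Z] (𝒟 : Measure Z) (F : Vec d → Z → ℝ)
    (p : Params m d Z Ξ) (xstar : Vec d) {ω ω' : Ω}
    (h : arrivalsUpTo X T ω = arrivalsUpTo X T ω') :
    excess 𝒟 F p T xstar ((X ω).withArrival (X ω').arrival) = excess 𝒟 F p T xstar (X ω) := by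
  rw [excess, excess, output, output, run_withArrival p (X ω) (arrivalsUpTo_eq h) (by omega)]

lemma stronglyMeasurable_rate [Nonempty Ω] (X : Ω → Trace m d Z Ξ) (T : ℕ) (Gs D σ L σL κ c : ℝ) :
    StronglyMeasurable[scheduleAlgebra X]
      (fun ω => rate (X ω).arrival T Gs D σ L σL κ c) ∧
    ∃ C, ∀ ω, ‖rate (X ω).arrival T Gs D σ L σL κ c‖ ≤ C := by
  set φ := arrivalsUpTo X T
  set r : (Finset.Icc 1 T → Fin m) → ℝ := fun v =>
    rate (X (Function.invFun φ v)).arrival T Gs D σ L σL κ c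
  have e : (fun ω => rate (X ω).arrival T Gs D σ L σL κ c) = fun ω => r (φ ω) := by
    funext ω
    exact rate_congr (arrivalsUpTo_eq (Function.invFun_eq (f := φ) ⟨ω, rfl⟩).symm) _ _ _ _ _ _ _
  obtain ⟨C, hC⟩ := (Set.finite_range fun v => ‖r v‖).bddAbove
  refine ⟨?_, C, fun ω => ?_⟩
  · rw [e]
    exact ((measurable_of_finite r).comp (measurable_arrivalsUpTo X T)).stronglyMeasurable
  · rw [congrFun e ω]
    exact hC ⟨φ ω, rfl⟩

variable [MeasurableSpace Z] [MeasurableSpace Ξ] [mΩ : MeasurableSpace Ω] {μ : Measure Ω}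
  {𝒟 : Measure Z} {ν : Measure Ξ} {ℱ : Filtration ℕ mΩ}

lemma IsExecution.withArrival (hX : IsExecution μ 𝒟 ν ℱ X) (b : ℕ → Fin m) :
    IsExecution μ 𝒟 ν ℱ fun ω => (X ω).withArrival b where
  arrival_meas := measurable_const
  initSample_meas := hX.initSample_meas
  byzMsg_meas := hX.byzMsg_meas
  fresh_meas := hX.fresh_meas
  initSample_law := hX.initSample_law
  initSample_indep := hX.initSample_indep
  fresh_law := hX.fresh_law
  fresh_indep := hX.fresh_indep

/-- Conditioning on an event of the schedule keeps the model: samples and seeds are fresh. -/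
lemma IsExecution.cond [IsProbabilityMeasure μ] (hX : IsExecution μ 𝒟 ν ℱ X) {B : Set Ω}
    (hB : MeasurableSet[ℱ 0] B) (hB0 : μ B ≠ 0) :
    IsExecution (ProbabilityTheory.cond μ B) 𝒟 ν ℱ X where
  arrival_meas := hX.arrival_meas
  initSample_meas := hX.initSample_meas
  byzMsg_meas := hX.byzMsg_meas
  fresh_meas := hX.fresh_meas
  initSample_law := by
    rw [map_cond_of_indep (ℱ.le 0) (hX.initSample_meas.mono (ℱ.le _) le_rfl) hX.initSample_indep
      hB hB0, hX.initSample_law]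
  initSample_indep := indep_cond (ℱ.le 0) hX.initSample_indep hB hB0
  fresh_law t ht := by
    rw [map_cond_of_indep (ℱ.le t) ((hX.fresh_meas t ht).mono (ℱ.le _) le_rfl)
      (hX.fresh_indep t ht) (ℱ.mono (Nat.zero_le t) B hB) hB0, hX.fresh_law t ht]
  fresh_indep t ht := indep_cond (ℱ.le t) (hX.fresh_indep t ht) (ℱ.mono (Nat.zero_le t) B hB) hB0

end ScheduleConditioning

section Conditional

variable {m d : ℕ} {Z Ξ Ω : Type*} [MeasurableSpace Z] [MeasurableSpace Ξ]
  [mΩ : MeasurableSpace Ω] {μ : Measure Ω} {𝒟 : Measure Z} {ν : Measure Ξ}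
  {ℱ : Filtration ℕ mΩ} {X : Ω → Trace m d Z Ξ} {p : Params m d Z Ξ}
  [IsProbabilityMeasure 𝒟] [IsProbabilityMeasure μ]
  {F : Vec d → Z → ℝ} {gradf : Vec d → Vec d} {D σ L σL κ : ℝ} {T : ℕ}

lemma IsExecution.measurable_excess_random (hX : IsExecution μ 𝒟 ν ℱ X) (hp : p.IsStandard)
    (hP : IsStochasticProblem 𝒟 p.dom F p.grad gradf D σ L σL)
    (hagg : ∀ (W : Finset (Fin m)) (s : W → ℝ),
      Measurable (fun q : (W → Vec d) × Ξ => p.agg W q.1 s q.2)) (T : ℕ) (xstar : Vec d) :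
    Measurable fun ω => excess 𝒟 F p T xstar (X ω) := by
  have : Nonempty Ω := nonempty_of_isProbabilityMeasure μ
  set φ := arrivalsUpTo X T
  have hφ : Measurable φ :=
    (measurable_arrivalsUpTo X T).mono (hX.arrival_meas.comap_le.trans (ℱ.le 0)) le_rfl
  have h : Measurable fun q : Ω × (Finset.Icc 1 T → Fin m) => excess 𝒟 F p T xstar
      ((X q.1).withArrival (X (Function.invFun φ q.2)).arrival) :=
    measurable_from_prod_countable_left fun v =>
      (hX.withArrival (X (Function.invFun φ v)).arrival).measurable_excess hp hP hagg
        (fun _ => rfl) T xstar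
  have e : (fun ω => excess 𝒟 F p T xstar (X ω)) = fun ω => excess 𝒟 F p T xstar
      ((X ω).withArrival (X (Function.invFun φ (φ ω))).arrival) := by
    funext ω
    rw [excess_withArrival]
    exact (Function.invFun_eq ⟨ω, rfl⟩).symm
  rw [e]
  exact h.comp (measurable_id.prodMk hφ)

/-- The convergence rate, conditionally on the schedule. -/
lemma IsExecution.condExp_excess_le [IsProbabilityMeasure ν] (hX : IsExecution μ 𝒟 ν ℱ X) (hp : p.IsStandard)
    (hP : IsStochasticProblem 𝒟 p.dom F p.grad gradf D σ L σL)
    (hagg : ∀ (W : Finset (Fin m)) (s : W → ℝ),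
      Measurable (fun q : (W → Vec d) × Ξ => p.agg W q.1 s q.2))
    (hL : 0 ≤ L) (hκ : 0 < κ) (hdelay : ∀ᵐ ω ∂μ, BoundedDelay (X ω).arrival T κ)
    {c lam : ℝ} (hA : IsWeightedRobust ν p.agg c lam) (hlam : lam < 1 / 2)
    (hbyz : ∀ᵐ ω ∂μ, BoundedByzantine (X ω).arrival p.honest T lam) (hη : 0 < p.η) (hT : 1 ≤ T)
    {xstar : Vec d} (hxs : xstar ∈ p.dom) :
    μ[fun ω => excess 𝒟 F p T xstar (X ω) | scheduleAlgebra X] ≤ᵐ[μ]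
      fun ω => D ^ 2 / (p.η * T ^ 2) + 20 * rate (X ω).arrival T ‖gradf xstar‖ D σ L σL κ c := by
  have hm0 : scheduleAlgebra X ≤ ℱ 0 := hX.arrival_meas.comap_le
  have hm : scheduleAlgebra X ≤ mΩ := hm0.trans (ℱ.le 0)
  have : Nonempty Ω := nonempty_of_isProbabilityMeasure μ
  obtain ⟨hr, C, hC⟩ := stronglyMeasurable_rate X T ‖gradf xstar‖ D σ L σL κ c
  have hex : Integrable (fun ω => excess 𝒟 F p T xstar (X ω)) μ :=
    integrable_excess hp hP xstar (hX.measurable_excess_random hp hP hagg T xstar)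
  have hri : Integrable (fun ω => rate (X ω).arrival T ‖gradf xstar‖ D σ L σL κ c) μ :=
    Integrable.of_bound (hr.mono hm).aestronglyMeasurable C (.of_forall hC)
  have hgi : Integrable (fun ω => D ^ 2 / (p.η * T ^ 2) +
      20 * rate (X ω).arrival T ‖gradf xstar‖ D σ L σL κ c) μ :=
    (integrable_const _).add (hri.const_mul 20)
  refine condExp_le_of_forall_setIntegral_le hm hex hgi
    (stronglyMeasurable_const.add (hr.const_mul 20)) fun s hs => ?_
  refine setIntegral_le_of_forall_fiber ((measurable_arrivalsUpTo X T).mono hm le_rfl) hex hgi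
    (hm s hs) fun v => ?_
  set B := s ∩ arrivalsUpTo X T ⁻¹' {v} with hBdef
  have hBm : MeasurableSet[scheduleAlgebra X] B :=
    hs.inter (measurable_arrivalsUpTo X T (measurableSet_singleton v))
  by_cases hB0 : μ B = 0
  · rw [Measure.restrict_eq_zero.2 hB0]; simp
  -- on `B` the schedule up to `T` agrees with that of some typical `ω₀`
  obtain ⟨ω₀, hω₀, h1, h2⟩ : ∃ ω₀ ∈ B, BoundedDelay (X ω₀).arrival T κ ∧
      BoundedByzantine (X ω₀).arrival p.honest T lam := by
    have := (frequently_ae_mem_iff.2 hB0).and_eventually (hdelay.and hbyz)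
    obtain ⟨ω, h, h'⟩ := this.exists
    exact ⟨ω, h, h'⟩
  have hB : ∀ ω ∈ B, arrivalsUpTo X T ω = arrivalsUpTo X T ω₀ := fun ω hω =>
    hω.2.trans hω₀.2.symm
  have : IsProbabilityMeasure (ProbabilityTheory.cond μ B) := cond_isProbabilityMeasure hB0
  have key := ((hX.cond (hm0 B hBm) hB0).withArrival (X ω₀).arrival).integral_excess_le hp hP hagg
    (fun _ => rfl) hL hκ h1 hA hlam h2 hη hT hxs
  have e1 : ∫ ω in B, excess 𝒟 F p T xstar (X ω) ∂μ =
      ∫ ω in B, excess 𝒟 F p T xstar ((X ω).withArrival (X ω₀).arrival) ∂μ :=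
    setIntegral_congr_fun (hm B hBm) fun ω hω => (excess_withArrival 𝒟 F p xstar (hB ω hω)).symm
  have e2 : ∫ ω in B, (D ^ 2 / (p.η * T ^ 2) +
        20 * rate (X ω).arrival T ‖gradf xstar‖ D σ L σL κ c) ∂μ =
      ∫ ω in B, (D ^ 2 / (p.η * T ^ 2) +
        20 * rate (X ω₀).arrival T ‖gradf xstar‖ D σ L σL κ c) ∂μ :=
    setIntegral_congr_fun (hm B hBm) fun ω hω => by
      rw [rate_congr (arrivalsUpTo_eq (hB ω hω))]
  rw [e1, e2, setIntegral_const, smul_eq_mul]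
  have hpos : 0 < μ.real B := ENNReal.toReal_pos hB0 (measure_ne_top μ B)
  rw [ProbabilityTheory.cond, integral_smul_measure, ENNReal.toReal_inv, smul_eq_mul] at key
  change (μ.real B)⁻¹ * _ ≤ _ at key
  rwa [inv_mul_le_iff₀ hpos] at key

end Conditional

lemma const_le_rate {m : ℕ} (a : ℕ → Fin m) {T : ℕ} (hT : 1 ≤ T) {Gs D σ L σL κ c : ℝ}
    (hG : 0 ≤ Gs) (hD : 0 ≤ D) (hL : 0 ≤ L) (hc : 0 ≤ c) :
    L * D ^ 2 / T ≤ rate a T Gs D σ L σL κ c := by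
  have h1 : 1 ≤ avgMaxDelay a T * Real.sqrt (1 + c) :=
    one_le_mul_of_one_le_of_one_le (one_le_avgMaxDelay a hT) (Real.one_le_sqrt.2 (by linarith))
  have h2 : L * D ^ 2 ≤ Gs * D + L * D ^ 2 * avgMaxDelay a T * Real.sqrt (1 + c) := by
    have := le_mul_of_one_le_right (by positivity : 0 ≤ L * D ^ 2) h1
    have := mul_nonneg hG hD
    linarith
  rw [rate]
  have h3 := div_le_div_of_nonneg_right h2 (Nat.cast_nonneg (α := ℝ) T)
  have h4 : 0 ≤ D * Real.sqrt (2 * σ ^ 2 + 32 * D ^ 2 * κ ^ 2 * σL ^ 2) *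
      Real.sqrt (1 + c * m) / Real.sqrt T := by positivity
  linarith

end AsyncByz

end

theorem mainTheorem1 :
    ∃ C : ℝ, 0 < C ∧
    ∀ (m d T : ℕ), 1 ≤ T →
    ∀ (Z Ξ Ω : Type*) [MeasurableSpace Z] [MeasurableSpace Ξ] [mΩ : MeasurableSpace Ω]
      (𝒟 : Measure Z) [IsProbabilityMeasure 𝒟] (ν : Measure Ξ) [IsProbabilityMeasure ν]
      (μ : Measure Ω) [IsProbabilityMeasure μ]
      (dom : Set (AsyncByz.Vec d)) (F : AsyncByz.Vec d → Z → ℝ)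
      (grad : AsyncByz.Vec d → Z → AsyncByz.Vec d) (gradf : AsyncByz.Vec d → AsyncByz.Vec d)
      (D σ L σL κ lam c η : ℝ),
      0 < D → 0 ≤ σ → 0 < L → 0 ≤ σL → 0 < κ → 0 ≤ lam → lam < 1 / 2 →
      AsyncByz.IsStochasticProblem 𝒟 dom F grad gradf D σ L σL →
    ∀ (A : AsyncByz.AggRule m d Ξ),
      (∀ (W : Finset (Fin m)) (s : W → ℝ),
        Measurable (fun p : (W → AsyncByz.Vec d) × Ξ => A W p.1 s p.2)) →
      AsyncByz.IsWeightedRobust ν A c lam →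
    ∀ (honest : Finset (Fin m)) (ℱ : Filtration ℕ mΩ) (X : Ω → AsyncByz.Trace m d Z Ξ),
      AsyncByz.IsExecution μ 𝒟 ν ℱ X →
      (∀ᵐ ω ∂μ, AsyncByz.BoundedDelay (X ω).arrival T κ) →
      (∀ᵐ ω ∂μ, AsyncByz.BoundedByzantine (X ω).arrival honest T lam) →
    ∀ (start : AsyncByz.Vec d), start ∈ dom →
    ∀ (xstar : AsyncByz.Vec d), xstar ∈ dom → IsMinOn (AsyncByz.expLoss 𝒟 F) dom xstar →
      0 < η → η ≤ 1 / (4 * L * T) →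
      (∀ᵐ ω ∂μ, AsyncByz.output (AsyncByz.stdParams dom grad A honest η start) (X ω) T ∈ dom) ∧
      Integrable (fun ω => AsyncByz.excess 𝒟 F
        (AsyncByz.stdParams dom grad A honest η start) T xstar (X ω)) μ ∧
      (μ[fun ω => AsyncByz.excess 𝒟 F
          (AsyncByz.stdParams dom grad A honest η start) T xstar (X ω)
          | AsyncByz.scheduleAlgebra X] ≤ᵐ[μ]
        fun ω => C * (D ^ 2 / (η * T ^ 2) +
          AsyncByz.rate (X ω).arrival T ‖gradf xstar‖ D σ L σL κ c)) ∧
      (η = 1 / (4 * L * T) →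
        μ[fun ω => AsyncByz.excess 𝒟 F
          (AsyncByz.stdParams dom grad A honest η start) T xstar (X ω)
          | AsyncByz.scheduleAlgebra X] ≤ᵐ[μ]
        fun ω => C * AsyncByz.rate (X ω).arrival T ‖gradf xstar‖ D σ L σL κ c) := by
  refine ⟨24, by norm_num, ?_⟩
  intro m d T hT Z Ξ Ω _ _ mΩ 𝒟 _ ν _ μ _ dom F grad gradf D σ L σL κ lam c η hD hσ hL hσL hκ
    hlam0 hlam hP A hAm hA honest ℱ X hX hdelay hbyz start hstart xstar hxs _ hη0 hη
  set p := AsyncByz.stdParams dom grad A honest η start with hpdef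
  have hp : p.IsStandard :=
    ⟨fun _ => rfl, fun _ => rfl, hP.compact.isClosed, hP.convex, hstart⟩
  have hT0 : (0 : ℝ) < T := by exact_mod_cast hT
  have hc := hA.1
  have key := hX.condExp_excess_le (p := p) (T := T) hp hP hAm hL.le hκ hdelay hA hlam hbyz hη0 hT
    hxs
  have hrate : ∀ ω, L * D ^ 2 / T ≤
      AsyncByz.rate (X ω).arrival T ‖gradf xstar‖ D σ L σL κ c := fun ω =>
    AsyncByz.const_le_rate _ hT (norm_nonneg _) hD.le hL.le hc
  have hLD : 0 ≤ L * D ^ 2 / T := by positivity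
  refine ⟨.of_forall fun ω => hp.run_x_mem (X ω) (T - 1), AsyncByz.integrable_excess hp hP xstar
    (hX.measurable_excess_random hp hP hAm T xstar), ?_, fun hηeq => ?_⟩
  · filter_upwards [key] with ω hω
    refine hω.trans ?_
    have h1 : 0 ≤ D ^ 2 / (η * T ^ 2) := by positivity
    change D ^ 2 / (η * T ^ 2) + _ ≤ _
    linarith [hrate ω]
  · filter_upwards [key] with ω hω
    refine hω.trans ?_
    have h1 : D ^ 2 / (η * T ^ 2) = 4 * (L * D ^ 2 / T) := by
      rw [hηeq]; field_simp
    change D ^ 2 / (η * T ^ 2) + _ ≤ _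
    rw [h1]
    linarith [hrate ω]
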